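/- **Setting.** Let $I=(0,1]$ and let $\rho=(\rho_\varepsilon)\in(0,1]^I$ be a net with $\rho_\varepsilon\to0$ as $\varepsilon\to0^+$. For a finite-dimensional real normed space $E$, a net $(x_\varepsilon)\in E^I$ is *moderate* if $|x_\varepsilon|\le\rho_\varepsilon^{-N}$ for some $N\in\mathbb N$ and $\varepsilon$ small, and *negligible* if $|x_\varepsilon|\le\rho_\varepsilon^{n}$ for every $n\in\mathbb N$ and $\varepsilon$ small (depending on $n$). Moderate nets modulo negligible nets form $\widetilde{\mathbb R}$, $\widetilde{\mathbb C}$, $\widetilde{\mathbb R}^2$ for $E=\mathbb R,\mathbb C,\mathbb R^2$; $[x_\varepsilon]$ is the class of $(x_\varepsilon)$ and $d\rho=[\rho_\varepsilon]$. In $\widetilde{\mathbb R}$: $x\le y$ means $x_\varepsilon\le y_\varepsilon$ for $\varepsilon$ small for suitable representatives; $x<y$ means $x\le y$ and $y-x$ invertible. Intervals, $|x|$, $\min$, $\max$, $\cos$, $e^{i\theta}$, $S(z)=\frac12\int_{-1}^1\cos(zt)\,dt$ are taken in this sense (the functions by $\varepsilon$-wise evaluation). A map $f:X\to\widetilde{\mathbb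 C}$, $X\subseteq\widetilde{\mathbb R}^n$, is a *generalized smooth function* (GSF) if there are open $\Omega_\varepsilon\subseteq\mathbb R^n$ and $f_\varepsilon\in C^\infty(\Omega_\varepsilon,\mathbb C)$ such that for every $x\in X$ and every representative $(x_\varepsilon)$ of $x$: $x_\varepsilon\in\Omega_\varepsilon$ for $\varepsilon$ small, $f(x)=[f_\varepsilon(x_\varepsilon)]$, and all $(\partial^\alpha f_\varepsilon(x_\varepsilon))$ are moderate. Then $\partial^\alpha f(x)=[\partial^\alpha f_\varepsilon(x_\varepsilon)]$ and $\int_a^bf=[\int_{a_\varepsilon}^{b_\varepsilon}f_\varepsilon]$. For $\Phi:\widetilde{\mathbb R}\to\widetilde{\mathbb C}$, $\lim_{h\to+\infty}\Phi(h)=l$ means $\forall q\in\mathbb N\,\exists h_0\in\widetilde{\mathbb R}\,\forall h\ge h_0:\ |\Phi(h)-l|\le d\rho^q$. Fix a positive infinite $k\in\widetilde{\mathbb R}$ (i.e. $k>0$ and $k\ge r$ for all real $r>0$) and put $K=[-k,k]$, $\mathring K=(-k,k)$, $\mathcal F_k(f)(\omega)=\int_{-k}^kf(x)e^{-ix\omega}dx$,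 $\mathcal F_h^{-1}(f)(x)=\frac1{2\pi}\int_{-h}^hf(\omega)e^{ix\omega}d\omega$, and $\Delta v(\omega)=v(k)e^{-ik\omega}-v(-k)e^{ik\omega}$ for $v$ defined on $K$. **Theorem.** Let $c\in\widetilde{\mathbb R}$ be invertible, let $f,g:K\to\widetilde{\mathbb C}$ be GSF, and let $u:K\times\widetilde{\mathbb R}_{\ge0}\to\widetilde{\mathbb C}$ be a GSF with $u_{tt}=c^2u_{xx}$ on $K\times\widetilde{\mathbb R}_{\ge0}$, $u(-,0)=f$ and $u_t(-,0)=g$ on $K$. Set $$\Delta_u(\omega,s)=c^2\big(i\omega\,\Delta(u(-,s))(\omega)+\Delta(\partial_xu(-,s))(\omega)\big),$$ $$R_h(x,t)=\mathcal F_h^{-1}\Big(tS(c\omega t)\int_0^t\Delta_u(\omega,s)\cos(c\omega s)\,ds\Big)(x)-\mathcal F_h^{-1}\Big(\cos(c\omega t)\int_0^ts\,\Delta_u(\omega,s)S(c\omega s)\,ds\Big)(x).$$ ($\Delta_u$ depends only on the boundary values $u(\pm k,-)$ and $\partial_xu(\pm k,-)$.) 1. For all $x\in\mathring K$ and $t\ge0$,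 $$u(x,t)=\lim_{h\to+\infty}\Big\{\mathcal F_h^{-1}\big(\mathcal F_k(g)(\omega)\,tS(c\omega t)+\mathcal F_k(f)(\omega)\cos(c\omega t)\big)(x)+R_h(x,t)\Big\}.$$ 2. (Generalized d'Alembert formula.) Write $\pi(y)=\max(-k,\min(y,k))$ and $f_0(y)=[\chi_\varepsilon(y)]\cdot f(\pi(y))$, where $\chi_\varepsilon(y)=1$ if $|y_\varepsilon|<k_\varepsilon$ and $0$ otherwise, for the extension of $f$ by zero (so $f_0(y)=f(y)$ for $y\in\mathring K$ and $f_0(y)=0$ if $|y|>k$), and let $$D(x,t)=\tfrac12\big[f_0(x-ct)+f_0(x+ct)\big]+\tfrac1{2c}\int_{\pi(x-ct)}^{\pi(x+ct)}g(x')\,dx'.$$ For all $x\in\mathring K$ and $t\ge0$ such that $|x-ct|-k$ and $|x+ct|-k$ are invertible, the limit $\lim_{h\to+\infty}R_h(x,t)$ exists and $$u(x,t)=D(x,t)+\lim_{h\to+\infty}R_h(x,t).$$ In particular, if $x\pm ct\in\mathring K$, then $D(x,t)=\frac12[f(x-ct)+f(x+ct)]+\frac1{2c}\int_{x-ct}^{x+ct}g$.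 3. Let $t\ge0$ and assume $u(\pm k,s)=0=\partial_xu(\pm k,s)$ for all $s\in[0,t]$. Then $f(\pm k)=0$, and $u(x,t)=D(x,t)$ for all $x\in\mathring K$, i.e. $u(-,t)$ is the usual d'Alembert solution for the data $f,g$ extended by zero. 4. If in addition to the assumption in 3, $f=0$ on $K$ and $g=\delta|_K$, then for all $x\in\mathring K$ $$u(x,t)=\frac1{2c}\big[H(x+ct)-H(x-ct)\big].$$ Here $\delta(x)=[b_\varepsilon\psi_\varepsilon(b_\varepsilon x_\varepsilon)]$ and $H(x)=\big[\int_{-\infty}^{x_\varepsilon}b_\varepsilon\psi_\varepsilon(b_\varepsilon y)\,dy\big]$ are the embedded Dirac delta and Heaviside function given by any moderate net $b_\varepsilon>0$ with $b_\varepsilon\to+\infty$ and any net of even $\psi_\varepsilon\in C_c^\infty(\mathbb R)$ with support in $(-1,1)$, $\psi_\varepsilon(0)=1$, $\int\psi_\varepsilon=1$; for every $j$, $\sup|\psi_\varepsilon^{(j)}|=O(b_\varepsilon^p)$ for some $p$, and $\int x^i\psi_\varepsilon=0$ for $1\le i\le j$ and $\varepsilon$ small; and for every real $\eta>0$, $\int|\psi_\varepsilon|\le1+\eta$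 for $\varepsilon$ small. -/

import Mathlib

open Filter Set
open scoped ContDiff Topology

noncomputable section

namespace GenSmooth

/-- The index set `I = (0,1]`.  "For `ε` small" is `∀ᶠ ε in atBot`: there is `ε₀ ∈ I` such that the
property holds for all `ε ≤ ε₀` in `I`. -/
abbrev Idx : Type := Set.Ioc (0 : ℝ) 1

/-- A gauge: a net `ρ ∈ (0,1]^I` with `ρ_ε → 0` as `ε → 0⁺`. -/
structure Gauge where
  /-- the net -/
  net : Idx → ℝ
  pos : ∀ ε, 0 < net ε
  le_one : ∀ ε, net ε ≤ 1
  tendsto_zero : Tendsto net atBot (𝓝 0)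

section Ring

variable (ρ : Gauge) (A : Type) [NormedCommRing A]

/-- A net is `ρ`-moderate if `‖x_ε‖ ≤ ρ_ε^{-N}` for some `N` and `ε` small. -/
def Moderate (x : Idx → A) : Prop :=
  ∃ N : ℕ, ∀ᶠ ε in atBot, ‖x ε‖ ≤ (ρ.net ε ^ N)⁻¹

/-- A net is `ρ`-negligible if `‖x_ε‖ ≤ ρ_ε^n` for all `n` and `ε` small. -/
def Negligible (x : Idx → A) : Prop :=
  ∀ n : ℕ, ∀ᶠ ε in atBot, ‖x ε‖ ≤ ρ.net ε ^ n

theorem eventually_le_inv_pow (C : ℝ) : ∀ᶠ ε in atBot, C ≤ (ρ.net ε ^ 1)⁻¹ := by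
  have h : Tendsto (fun ε => (ρ.net ε)⁻¹) atBot atTop :=
    Tendsto.comp tendsto_inv_nhdsGT_zero
      (tendsto_nhdsWithin_iff.mpr ⟨ρ.tendsto_zero, Eventually.of_forall ρ.pos⟩)
  simpa using h.eventually_ge_atTop C

theorem eventually_mul_pow_le (C : ℝ) (n : ℕ) :
    ∀ᶠ ε in atBot, C * ρ.net ε ^ (n + 1) ≤ ρ.net ε ^ n := by
  filter_upwards [eventually_le_inv_pow ρ C] with ε h
  have hp := ρ.pos ε
  have hn : 0 < ρ.net ε ^ n := pow_pos hp n
  rw [pow_one] at h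
  have : C * ρ.net ε ≤ 1 := by
    calc C * ρ.net ε ≤ (ρ.net ε)⁻¹ * ρ.net ε := by gcongr
      _ = 1 := inv_mul_cancel₀ hp.ne'
  calc C * ρ.net ε ^ (n + 1) = (C * ρ.net ε) * ρ.net ε ^ n := by ring
    _ ≤ 1 * ρ.net ε ^ n := by gcongr
    _ = _ := one_mul _

theorem moderate_const (a : A) : Moderate ρ A (fun _ => a) :=
  ⟨1, eventually_le_inv_pow ρ ‖a‖⟩

variable {ρ A}

theorem Moderate.add {x y : Idx → A} (hx : Moderate ρ A x) (hy : Moderate ρ A y) :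
    Moderate ρ A (x + y) := by
  obtain ⟨N, hN⟩ := hx
  obtain ⟨M, hM⟩ := hy
  refine ⟨N + M + 1, ?_⟩
  filter_upwards [hN, hM, eventually_le_inv_pow ρ 2] with ε h1 h2 h3
  have hp := ρ.pos ε
  have l1 : (ρ.net ε ^ N)⁻¹ ≤ (ρ.net ε ^ (N + M))⁻¹ :=
    inv_anti₀ (pow_pos hp _) (pow_le_pow_of_le_one hp.le (ρ.le_one ε) (by omega))
  have l2 : (ρ.net ε ^ M)⁻¹ ≤ (ρ.net ε ^ (N + M))⁻¹ :=
    inv_anti₀ (pow_pos hp _) (pow_le_pow_of_le_one hp.le (ρ.le_one ε) (by omega))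
  have hpos : 0 ≤ (ρ.net ε ^ (N + M))⁻¹ := (inv_pos.mpr (pow_pos hp _)).le
  calc ‖(x + y) ε‖ ≤ ‖x ε‖ + ‖y ε‖ := norm_add_le _ _
    _ ≤ 2 * (ρ.net ε ^ (N + M))⁻¹ := by linarith
    _ ≤ (ρ.net ε ^ 1)⁻¹ * (ρ.net ε ^ (N + M))⁻¹ := by gcongr
    _ = (ρ.net ε ^ (N + M + 1))⁻¹ := by rw [← mul_inv, ← pow_add, add_comm 1]

theorem Moderate.mul {x y : Idx → A} (hx : Moderate ρ A x) (hy : Moderate ρ A y) :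
    Moderate ρ A (x * y) := by
  obtain ⟨N, hN⟩ := hx
  obtain ⟨M, hM⟩ := hy
  refine ⟨N + M, ?_⟩
  filter_upwards [hN, hM] with ε h1 h2
  calc ‖(x * y) ε‖ ≤ ‖x ε‖ * ‖y ε‖ := norm_mul_le _ _
    _ ≤ (ρ.net ε ^ N)⁻¹ * (ρ.net ε ^ M)⁻¹ := by
        gcongr
        exact (inv_pos.mpr (pow_pos (ρ.pos ε) _)).le
    _ = _ := by rw [← mul_inv, ← pow_add]

theorem Moderate.neg {x : Idx → A} (hx : Moderate ρ A x) : Moderate ρ A (-x) := by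
  obtain ⟨N, hN⟩ := hx
  exact ⟨N, by simpa using hN⟩

theorem Negligible.add {x y : Idx → A} (hx : Negligible ρ A x) (hy : Negligible ρ A y) :
    Negligible ρ A (x + y) := by
  intro n
  filter_upwards [hx (n + 1), hy (n + 1), eventually_mul_pow_le ρ 2 n] with ε h1 h2 h3
  calc ‖(x + y) ε‖ ≤ ‖x ε‖ + ‖y ε‖ := norm_add_le _ _
    _ ≤ _ := by linarith

theorem Moderate.mul_negligible {x y : Idx → A} (hx : Moderate ρ A x) (hy : Negligible ρ A y) :
    Negligible ρ A (x * y) := by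
  intro n
  obtain ⟨N, hN⟩ := hx
  filter_upwards [hN, hy (N + n)] with ε h1 h2
  have hp := pow_pos (ρ.pos ε) N
  calc ‖(x * y) ε‖ ≤ ‖x ε‖ * ‖y ε‖ := norm_mul_le _ _
    _ ≤ (ρ.net ε ^ N)⁻¹ * ρ.net ε ^ (N + n) := by
        gcongr
    _ = _ := by rw [pow_add, inv_mul_cancel_left₀ hp.ne']

variable (ρ A)

/-- The ring of `ρ`-moderate nets. -/
def moderateNets : Subring (Idx → A) where
  carrier := {x | Moderate ρ A x}
  mul_mem' := Moderate.mul
  one_mem' := moderate_const ρ A 1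
  add_mem' := Moderate.add
  zero_mem' := moderate_const ρ A 0
  neg_mem' := Moderate.neg

/-- The ideal of `ρ`-negligible nets. -/
def negligibleNets : Ideal (moderateNets ρ A) where
  carrier := {x | Negligible ρ A x.1}
  add_mem' := Negligible.add
  zero_mem' := by
    intro n
    exact Eventually.of_forall fun ε => by simpa using (pow_pos (ρ.pos ε) n).le
  smul_mem' := fun x _ hy => Moderate.mul_negligible x.2 hy

/-- `A`-valued generalized numbers: moderate nets modulo negligible nets.  `Gen ρ ℝ` is the
Robinson-Colombeau ring, `Gen ρ ℂ` its complexification; `Gen ρ (ℝ × ℝ)` is the generalized plane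
(its points are the pairs of elements of `Gen ρ ℝ`). -/
def Gen : Type := moderateNets ρ A ⧸ negligibleNets ρ A

instance : CommRing (Gen ρ A) :=
  inferInstanceAs (CommRing (moderateNets ρ A ⧸ negligibleNets ρ A))

variable {A}

open Classical in
/-- The class `[x_ε]` of a moderate net (and `0` if the net is not moderate). -/
def ofNet (x : Idx → A) : Gen ρ A :=
  if h : x ∈ moderateNets ρ A then Ideal.Quotient.mk (negligibleNets ρ A) ⟨x, h⟩ else 0

variable {ρ}

/-- The moderate net `(x_ε)` is a representative of `x`. -/
def Rep (x : Gen ρ A) (xe : Idx → A) : Prop := Moderate ρ A xe ∧ ofNet ρ xe = x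

theorem exists_rep (x : Gen ρ A) : ∃ xe, Rep x xe := by
  obtain ⟨⟨xe, h⟩, rfl⟩ := Ideal.Quotient.mk_surjective x
  exact ⟨xe, h, dif_pos h⟩

/-- Some representative of `x`. -/
def rep (x : Gen ρ A) : Idx → A := Classical.choose (exists_rep x)

theorem rep_spec (x : Gen ρ A) : Rep x (rep x) := Classical.choose_spec (exists_rep x)

variable (ρ) in
/-- The constant `a`, as a generalized number. -/
def const (a : A) : Gen ρ A := ofNet ρ fun _ => a

/-- The extension `[x_ε] ↦ [φ(x_ε)]` of a globally Lipschitz map `φ`. -/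
def map {B : Type} [NormedCommRing B] (φ : A → B) (x : Gen ρ A) : Gen ρ B :=
  ofNet ρ fun ε => φ (rep x ε)

/-- The generalized norm `|[x_ε]| = [|x_ε|]`. -/
def gnorm (x : Gen ρ A) : Gen ρ ℝ := map norm x

end Ring

section Scalars

variable {ρ : Gauge}

/-- `x ≤ y` iff `x_ε ≤ y_ε` for `ε` small, for suitable representatives. -/
instance : LE (Gen ρ ℝ) :=
  ⟨fun x y => ∃ xe ye, Rep x xe ∧ Rep y ye ∧ ∀ᶠ ε in atBot, xe ε ≤ ye ε⟩

/-- `x < y` iff `x ≤ y` and `y - x` is invertible. -/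
instance : LT (Gen ρ ℝ) := ⟨fun x y => x ≤ y ∧ IsUnit (y - x)⟩

/-- The infinitesimal `dρ = [ρ_ε]`. -/
def dRho (ρ : Gauge) : Gen ρ ℝ := ofNet ρ ρ.net

/-- `x` is infinite: `|x| ≥ r` for all real `r > 0`. -/
def IsInfinite (x : Gen ρ ℝ) : Prop := ∀ r : ℝ, 0 < r → const ρ r ≤ gnorm x

/-- The inclusion of the real in the complex generalized numbers. -/
def toC (x : Gen ρ ℝ) : Gen ρ ℂ := map (fun a : ℝ => (a : ℂ)) x

/-- The point `(x, t)` of the generalized plane. -/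
def pair (x t : Gen ρ ℝ) : Gen ρ (ℝ × ℝ) :=
  map (fun a : ℝ => ((a, 0) : ℝ × ℝ)) x + map (fun b : ℝ => ((0, b) : ℝ × ℝ)) t

/-- `cos`. -/
def gcos (x : Gen ρ ℝ) : Gen ρ ℝ := map Real.cos x

/-- `S(z) = ½ ∫_{-1}^{1} cos(z t) dt`, the smooth extension of `sin z / z`. -/
def gS (x : Gen ρ ℝ) : Gen ρ ℝ := map (fun z : ℝ => 1 / 2 * ∫ t in (-1 : ℝ)..1, Real.cos (z * t)) x

/-- `e^{iθ}`. -/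
def gcis (θ : Gen ρ ℝ) : Gen ρ ℂ := map (fun a : ℝ => Complex.exp (a * Complex.I)) θ

/-- The interval `[-k, k]`. -/
def box (k : Gen ρ ℝ) : Set (Gen ρ ℝ) := {x | -k ≤ x ∧ x ≤ k}

/-- The sharp interior `(-k, k)` of `[-k, k]`. -/
def boxInterior (k : Gen ρ ℝ) : Set (Gen ρ ℝ) := {x | -k < x ∧ x < k}

/-- The half-line `{t | 0 ≤ t}`. -/
def nonneg (ρ : Gauge) : Set (Gen ρ ℝ) := {t | 0 ≤ t}

/-- The half-strip `[-k, k] × {t | 0 ≤ t}`. -/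
def strip (k : Gen ρ ℝ) : Set (Gen ρ (ℝ × ℝ)) :=
  {p | ∃ x ∈ box k, ∃ t ∈ nonneg ρ, p = pair x t}

/-- `lim_{h → +∞} Φ(h) = l` in the sharp topology. -/
def LimAtTop (Φ : Gen ρ ℝ → Gen ρ ℂ) (l : Gen ρ ℂ) : Prop :=
  ∀ q : ℕ, ∃ h₀ : Gen ρ ℝ, ∀ h : Gen ρ ℝ, h₀ ≤ h → gnorm (Φ h - l) ≤ dRho ρ ^ q

end Scalars

section GSF

variable {ρ : Gauge} {A B : Type} [NormedCommRing A] [NormedAlgebra ℝ A]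
  [NormedCommRing B] [NormedAlgebra ℝ B]

/-- The net of smooth functions `F_ε : Ω_ε → B` on open sets defines the map `f : X → Gen ρ B`. -/
structure Defines (X : Set (Gen ρ A)) (f : Gen ρ A → Gen ρ B)
    (Ω : Idx → Set A) (F : Idx → A → B) : Prop where
  isOpen : ∀ ε, IsOpen (Ω ε)
  smooth : ∀ ε, ContDiffOn ℝ ∞ (F ε) (Ω ε)
  /-- every point of `X` strongly belongs to `(Ω_ε)` -/
  subset : ∀ x ∈ X, ∀ xe, Rep x xe → ∀ᶠ ε in atBot, xe ε ∈ Ω ε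
  value : ∀ x ∈ X, ∀ xe, Rep x xe → Rep (f x) fun ε => F ε (xe ε)
  moderate : ∀ x ∈ X, ∀ xe, Rep x xe → ∀ m : ℕ,
    Moderate ρ ℝ fun ε => ‖iteratedFDeriv ℝ m (F ε) (xe ε)‖

/-- The restriction of `f` to `X` is a generalized smooth function. -/
def IsGSF (X : Set (Gen ρ A)) (f : Gen ρ A → Gen ρ B) : Prop := ∃ Ω F, Defines X f Ω F

open Classical in
/-- A net of smooth functions that defines `f` on `X` (and `0` if there is none). -/
def defNet (X : Set (Gen ρ A)) (f : Gen ρ A → Gen ρ B) : Idx → A → B :=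
  if h : IsGSF X f then Classical.choose (Classical.choose_spec h) else 0

/-- The iterated directional derivative `∂ᵐf/∂vᵐ (x) = [∂ᵐf_ε/∂vᵐ (x_ε)]` of the generalized smooth
function `f` on `X`. On sets `X` with dense interior, as all those below, it depends neither on the
net defining `f` nor on the representative of `x ∈ X`. -/
def gderiv (X : Set (Gen ρ A)) (m : ℕ) (v : A) (f : Gen ρ A → Gen ρ B) (x : Gen ρ A) : Gen ρ B :=
  ofNet ρ fun ε => iteratedFDeriv ℝ m (defNet X f ε) (rep x ε) fun _ => v

/-- The integral `∫_a^b f = [∫_{a_ε}^{b_ε} f_ε]` of a generalized smooth function on an interval `X`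
that contains `a` and `b`. -/
def gint (X : Set (Gen ρ ℝ)) (f : Gen ρ ℝ → Gen ρ ℂ) (a b : Gen ρ ℝ) : Gen ρ ℂ :=
  ofNet ρ fun ε => ∫ s in (rep a ε)..(rep b ε), defNet X f ε s

end GSF

section Fourier

variable {ρ : Gauge}

/-- The hyperfinite Fourier transform `F_k(f)(w) = ∫_{-k}^{k} f(x) e^{-ixw} dx`. -/
def HFT (k : Gen ρ ℝ) (f : Gen ρ ℝ → Gen ρ ℂ) (w : Gen ρ ℝ) : Gen ρ ℂ :=
  gint (box k) (fun x => f x * gcis (-(x * w))) (-k) k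

/-- The inverse transform `F_h⁻¹(f)(x) = (2π)⁻¹ ∫_{-h}^{h} f(w) e^{ixw} dw`. -/
def invHFT (h : Gen ρ ℝ) (f : Gen ρ ℝ → Gen ρ ℂ) (x : Gen ρ ℝ) : Gen ρ ℂ :=
  const ρ ((1 / (2 * Real.pi) : ℝ) : ℂ) *
    gint (box h) (fun w => f w * gcis (x * w)) (-h) h

/-- The boundary term `v(k) e^{-ikw} - v(-k) e^{ikw}`. -/
def bdry (k : Gen ρ ℝ) (v : Gen ρ ℝ → Gen ρ ℂ) (w : Gen ρ ℝ) : Gen ρ ℂ :=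
  v k * gcis (-(k * w)) - v (-k) * gcis (k * w)

end Fourier

section Wave

variable {ρ : Gauge}

/-- `∂ᵐu/∂xᵐ` on `[-k, k] × {t | 0 ≤ t}`. -/
def dX (k : Gen ρ ℝ) (m : ℕ) (u : Gen ρ (ℝ × ℝ) → Gen ρ ℂ) (x t : Gen ρ ℝ) : Gen ρ ℂ :=
  gderiv (strip k) m ((1, 0) : ℝ × ℝ) u (pair x t)

/-- `∂ᵐu/∂tᵐ` on `[-k, k] × {t | 0 ≤ t}`. -/
def dT (k : Gen ρ ℝ) (m : ℕ) (u : Gen ρ (ℝ × ℝ) → Gen ρ ℂ) (x t : Gen ρ ℝ) : Gen ρ ℂ :=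
  gderiv (strip k) m ((0, 1) : ℝ × ℝ) u (pair x t)

/-- `u` is a generalized smooth solution of `u_tt = c² u_xx` on `[-k, k] × {t | 0 ≤ t}` with
`u(-, 0) = f` and `u_t(-, 0) = g`. -/
structure IsWaveSolution (k c : Gen ρ ℝ) (f g : Gen ρ ℝ → Gen ρ ℂ)
    (u : Gen ρ (ℝ × ℝ) → Gen ρ ℂ) : Prop where
  isGSF : IsGSF (strip k) u
  wave : ∀ x ∈ box k, ∀ t ∈ nonneg ρ, dT k 2 u x t = toC (c ^ 2) * dX k 2 u x t
  init : ∀ x ∈ box k, u (pair x 0) = f x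
  init_deriv : ∀ x ∈ box k, dT k 1 u x 0 = g x

/-- `Δ_u(w, s) = c² (iw Δ_{1k}(u(-,s))(w) + Δ_{1k}(∂ₓu(-,s))(w))`: it depends only on the boundary
values `u(±k, s)` and `∂ₓu(±k, s)`. -/
def waveBdry (k c : Gen ρ ℝ) (u : Gen ρ (ℝ × ℝ) → Gen ρ ℂ) (w s : Gen ρ ℝ) : Gen ρ ℂ :=
  toC (c ^ 2) * (const ρ Complex.I * toC w * bdry k (fun x => u (pair x s)) w
    + bdry k (fun x => dX k 1 u x s) w)

/-- `F_h⁻¹( t S(cwt) ∫_0^t Δ_u(w,s) cos(cws) ds ) (x)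
  - F_h⁻¹( cos(cwt) ∫_0^t s Δ_u(w,s) S(cws) ds ) (x)`. -/
def waveExtra (k c : Gen ρ ℝ) (u : Gen ρ (ℝ × ℝ) → Gen ρ ℂ) (x t h : Gen ρ ℝ) : Gen ρ ℂ :=
  invHFT h (fun w => toC (t * gS (c * w * t)) *
      gint (nonneg ρ) (fun s => waveBdry k c u w s * toC (gcos (c * w * s))) 0 t) x
  - invHFT h (fun w => toC (gcos (c * w * t)) *
      gint (nonneg ρ) (fun s => toC s * waveBdry k c u w s * toC (gS (c * w * s))) 0 t) x

/-- `F_h⁻¹( F_k(g)(w) t S(cwt) + F_k(f)(w) cos(cwt) ) (x)`. -/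
def waveFree (k c : Gen ρ ℝ) (f g : Gen ρ ℝ → Gen ρ ℂ) (x t h : Gen ρ ℝ) : Gen ρ ℂ :=
  invHFT h (fun w => HFT k g w * toC (t * gS (c * w * t)) + HFT k f w * toC (gcos (c * w * t))) x

/-- The projection `y ↦ (-k) ∨ (y ∧ k)` onto `[-k, k]`. -/
def clip (k y : Gen ρ ℝ) : Gen ρ ℝ :=
  map (fun p : ℝ × ℝ => max (-p.1) (min p.2 p.1)) (pair k y)

/-- The extension by `0` of a function on `[-k, k]`: the net `f_ε(y_ε)` where `|y_ε| < k_ε`, and `0`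
for the other `ε`.  So it is `f y` if `-k < y < k`, and `0` if `|y| > k`. It is independent of the
representatives whenever `|y| - k` is invertible or `f(k) = f(-k) = 0`. -/
def zeroExt (k : Gen ρ ℝ) (f : Gen ρ ℝ → Gen ρ ℂ) (y : Gen ρ ℝ) : Gen ρ ℂ :=
  ofNet ρ (fun ε => if 0 < rep (k - gnorm y) ε then (1 : ℂ) else 0) * f (clip k y)

/-- The d'Alembert expression `½ [f(x-ct) + f(x+ct)] + (2c)⁻¹ ∫_{x-ct}^{x+ct} g` for data `f`, `g` on
`[-k, k]`, extended by `0` outside `[-k, k]`. -/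
def dAlembert (k : Gen ρ ℝ) (c : (Gen ρ ℝ)ˣ) (f g : Gen ρ ℝ → Gen ρ ℂ) (x t : Gen ρ ℝ) : Gen ρ ℂ :=
  const ρ (1 / 2 : ℂ) * (zeroExt k f (x - c * t) + zeroExt k f (x + c * t))
  + const ρ (1 / 2 : ℂ) * toC ↑c⁻¹ * gint (box k) g (clip k (x - c * t)) (clip k (x + c * t))

end Wave

/-- A one-dimensional Colombeau mollifier `(ψ_ε)` with its positive infinite scale `b = [b_ε]`. -/
structure Mollifier (ρ : Gauge) where
  /-- the scale -/
  b : Idx → ℝ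
  /-- the net of test functions -/
  ψ : Idx → ℝ → ℝ
  b_pos : ∀ ε, 0 < b ε
  b_moderate : Moderate ρ ℝ b
  b_tendsto : Tendsto b atBot atTop
  smooth : ∀ ε, ContDiff ℝ ∞ (ψ ε)
  support : ∀ ε, tsupport (ψ ε) ⊆ Metric.ball 0 1
  even : ∀ ε x, ψ ε (-x) = ψ ε x
  at_zero : ∀ ε, ψ ε 0 = 1
  integral_eq : ∀ ε, ∫ x, ψ ε x = 1
  deriv_bound : ∀ j : ℕ, ∃ p : ℕ, ∃ C : ℝ, ∀ᶠ ε in atBot, ∀ x,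
    |iteratedDeriv j (ψ ε) x| ≤ C * b ε ^ p
  moments : ∀ j : ℕ, ∀ᶠ ε in atBot, ∀ i : ℕ, 1 ≤ i → i ≤ j → ∫ x, x ^ i * ψ ε x = 0
  small_neg : ∀ η : ℝ, 0 < η → ∀ᶠ ε in atBot, ∫ x, |ψ ε x| ≤ 1 + η

section Delta

variable {ρ : Gauge}

/-- The Dirac delta `δ(x) = b ψ(b x)`. -/
def Mollifier.delta (M : Mollifier ρ) (x : Gen ρ ℝ) : Gen ρ ℝ :=
  ofNet ρ fun ε => M.b ε * M.ψ ε (M.b ε * rep x ε)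

/-- The Heaviside function: the net `x ↦ ∫_{-∞}^x b_ε ψ_ε(b_ε y) dy`, i.e. the convolution of the
classical Heaviside function with `b_ε ψ_ε(b_ε y)`. -/
def Mollifier.heaviside (M : Mollifier ρ) (x : Gen ρ ℝ) : Gen ρ ℝ :=
  ofNet ρ fun ε => ∫ y in Set.Iic (rep x ε), M.b ε * M.ψ ε (M.b ε * y)

end Delta

end GenSmooth

end

/-! Transform in space. For fixed `w`, the function `v(s) = F_k(u(-,s))(w)` satisfies `v'' + (cw)² v
= Δ_u(w,s)`, because two integrations by parts turn the transform of `u_xx` into `-w² v` plus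
boundary values at `±k`. Variation of constants then expresses `v(t)` by the data and by `∫₀ᵗ
Δ_u(w,s) sin(cw(t-s))/(cw) ds`, and the addition theorem for the sine separates `t` from `s`, which
gives the two terms inside `R_h` (`IsWaveSolution.HFT_eq`). Hence the bracket in the first claim
equals `F_h⁻¹ F_k (u(-,t))` for large `h`, and everything rests on Fourier inversion on `[-k,k]`.

Inversion (`limAtTop_invHFT_HFT`) is the Dirichlet integral. The kernel `sin(h(y-z))/(π(y-z))` has
the primitive `-sineInt (h(y-z))`, and `sineInt r` is within `min 1 |r|⁻¹` of `sign r / 2`.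
Integrating by parts leaves the value at `y`, boundary terms at `±k`, and an error governed by `v'`.
In the sharp topology `h` may be taken above any fixed power `ρ^(-n)`, so this explicit rate beats
all moderate constants. The boundary terms disappear if `|y| - k` is invertible or if `v(±k) = 0`;
the limit is the extension of `v` by zero.

Applied to `u(-,t)` at interior points, inversion gives the first claim. For the free part,
multiplication by `cos(cwt)` averages the translates by `±ct`, so inversion applies to `f` at `x ±
ct`; for `g`, Fubini yields a difference of two sine integrals, which tends to the integral of `g`
between the clipped points `x ± ct` (`limAtTop_invHFT_mul_gS`). Thus the free part tends to the
d'Alembert expression, and `R_h` converges as a difference of convergent terms. If the boundary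
values vanish on `[0,t]`, then `R_h = 0`; moreover `f(±k) = 0` by taking `s = 0`, so no
invertibility is needed. For `g = δ`, the support lies in `[-1,1] ⊆ [-k_ε,k_ε]`, so clipping does
not change the integral and differences of `H` appear.

The passage between classical estimates and generalized numbers rests on three facts. Pointwise
moderateness or negligibility along all nets in sets `S_ε` is automatically uniform in `S_ε`
(`uniform_moderate`, `uniform_eventually`). A generalized integral may be computed from any net with
the right values (`gint_rep`). Finally, defining nets can be replaced by globally smooth ones near
closed sets (`exists_smooth_net`). In particular the wave equation holds for representatives only up
to a uniformly negligible residual, and the classical estimate `norm_transform_sub_le` carries that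
residual along. -/

namespace GenSmooth

/-! ### Calculus of moderate nets, negligible nets and representatives -/

section Nets

variable {ρ : Gauge} {A B : Type} [NormedCommRing A] [NormedCommRing B]

theorem Moderate.of_le {x : Idx → A} {y : Idx → B} (hy : Moderate ρ B y)
    (h : ∀ᶠ ε in atBot, ‖x ε‖ ≤ ‖y ε‖) : Moderate ρ A x := by
  obtain ⟨N, hN⟩ := hy
  exact ⟨N, by filter_upwards [h, hN] with ε h1 h2 using h1.trans h2⟩

theorem Negligible.of_le {x : Idx → A} {y : Idx → B} (hy : Negligible ρ B y)
    (h : ∀ᶠ ε in atBot, ‖x ε‖ ≤ ‖y ε‖) : Negligible ρ A x := fun n => by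
  filter_upwards [h, hy n] with ε h1 h2 using h1.trans h2

theorem Negligible.moderate {x : Idx → A} (hx : Negligible ρ A x) : Moderate ρ A x :=
  ⟨0, by simpa using hx 0⟩

theorem Negligible.neg {x : Idx → A} (hx : Negligible ρ A x) : Negligible ρ A (-x) := fun n => by
  simpa using hx n

theorem Negligible.sub {x y : Idx → A} (hx : Negligible ρ A x) (hy : Negligible ρ A y) :
    Negligible ρ A (x - y) := by
  rw [sub_eq_add_neg]; exact hx.add hy.neg

theorem Negligible.mul_moderate {x y : Idx → A} (hx : Negligible ρ A x) (hy : Moderate ρ A y) :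
    Negligible ρ A (x * y) := by
  rw [mul_comm]; exact hy.mul_negligible hx

theorem Negligible.norm {x : Idx → A} (hx : Negligible ρ A x) :
    Negligible ρ ℝ (fun ε => ‖x ε‖) := fun n => by simpa using hx n

theorem Moderate.norm {x : Idx → A} (hx : Moderate ρ A x) :
    Moderate ρ ℝ (fun ε => ‖x ε‖) := by
  obtain ⟨N, hN⟩ := hx
  exact ⟨N, by simpa using hN⟩

theorem Moderate.sub {x y : Idx → A} (hx : Moderate ρ A x) (hy : Moderate ρ A y) :
    Moderate ρ A (x - y) := by
  rw [sub_eq_add_neg]; exact hx.add hy.neg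

theorem Moderate.pow {x : Idx → A} (hx : Moderate ρ A x) (n : ℕ) :
    Moderate ρ A (fun ε => x ε ^ n) := (moderateNets ρ A).pow_mem (x := x) hx n

theorem Moderate.sum {ι : Type} (s : Finset ι) {x : ι → Idx → A} (hx : ∀ i ∈ s, Moderate ρ A (x i)) :
    Moderate ρ A (fun ε => ∑ i ∈ s, x i ε) := by
  have : Moderate ρ A (∑ i ∈ s, x i) := (moderateNets ρ A).sum_mem hx
  convert this using 1
  ext ε; simp

theorem moderate_inv_pow (ρ : Gauge) (N : ℕ) : Moderate ρ ℝ fun ε => (ρ.net ε ^ N)⁻¹ :=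
  ⟨N, Eventually.of_forall fun ε => by
    rw [Real.norm_of_nonneg (inv_nonneg.2 (pow_pos (ρ.pos ε) N).le)]⟩

theorem moderate_gauge (ρ : Gauge) : Moderate ρ ℝ ρ.net :=
  ⟨0, Eventually.of_forall fun ε => by
    simpa [Real.norm_of_nonneg (ρ.pos ε).le] using ρ.le_one ε⟩

theorem rep_iff {x : Gen ρ A} {xe : Idx → A} :
    Rep x xe ↔ ∃ h : xe ∈ moderateNets ρ A, Ideal.Quotient.mk (negligibleNets ρ A) ⟨xe, h⟩ = x := by
  constructor
  · rintro ⟨h, h2⟩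
    exact ⟨h, (dif_pos (show xe ∈ moderateNets ρ A from h)).symm.trans h2⟩
  · rintro ⟨h, h2⟩
    exact ⟨h, (dif_pos h).trans h2⟩

theorem Moderate.rep {xe : Idx → A} (h : Moderate ρ A xe) : Rep (ofNet ρ xe) xe := ⟨h, rfl⟩

theorem Rep.negligible_sub {x : Gen ρ A} {xe ye : Idx → A} (hx : Rep x xe) (hy : Rep x ye) :
    Negligible ρ A (xe - ye) := by
  obtain ⟨h1, rfl⟩ := rep_iff.1 hx
  obtain ⟨h2, h3⟩ := rep_iff.1 hy
  exact Ideal.Quotient.eq.1 h3.symm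

theorem Rep.of_negligible_sub {x : Gen ρ A} {xe ye : Idx → A} (hx : Rep x xe)
    (h : Negligible ρ A (ye - xe)) : Rep x ye := by
  obtain ⟨h1, rfl⟩ := rep_iff.1 hx
  have h2 : Moderate ρ A ye := by simpa using h.moderate.add hx.1
  exact rep_iff.2 ⟨h2, Ideal.Quotient.eq.2 h⟩

theorem Rep.eq {x y : Gen ρ A} {xe : Idx → A} (hx : Rep x xe) (hy : Rep y xe) : x = y :=
  hx.2.symm.trans hy.2

theorem Rep.eq_of_negligible {x y : Gen ρ A} {xe ye : Idx → A} (hx : Rep x xe) (hy : Rep y ye)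
    (h : Negligible ρ A (ye - xe)) : x = y := (hx.of_negligible_sub h).eq hy

theorem Rep.congr {x : Gen ρ A} {xe ye : Idx → A} (hx : Rep x xe)
    (h : ∀ᶠ ε in atBot, ye ε = xe ε) : Rep x ye :=
  hx.of_negligible_sub fun n => by
    filter_upwards [h] with ε h
    simpa [h] using (pow_pos (ρ.pos ε) n).le

theorem Rep.add {x y : Gen ρ A} {xe ye : Idx → A} (hx : Rep x xe) (hy : Rep y ye) :
    Rep (x + y) (fun ε => xe ε + ye ε) := by
  obtain ⟨h1, rfl⟩ := rep_iff.1 hx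
  obtain ⟨h2, rfl⟩ := rep_iff.1 hy
  exact rep_iff.2 ⟨h1.add h2, rfl⟩

theorem Rep.mul {x y : Gen ρ A} {xe ye : Idx → A} (hx : Rep x xe) (hy : Rep y ye) :
    Rep (x * y) (fun ε => xe ε * ye ε) := by
  obtain ⟨h1, rfl⟩ := rep_iff.1 hx
  obtain ⟨h2, rfl⟩ := rep_iff.1 hy
  exact rep_iff.2 ⟨h1.mul h2, rfl⟩

theorem Rep.neg {x : Gen ρ A} {xe : Idx → A} (hx : Rep x xe) : Rep (-x) (fun ε => -xe ε) := by
  obtain ⟨h1, rfl⟩ := rep_iff.1 hx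
  exact rep_iff.2 ⟨h1.neg, rfl⟩

theorem Rep.sub {x y : Gen ρ A} {xe ye : Idx → A} (hx : Rep x xe) (hy : Rep y ye) :
    Rep (x - y) (fun ε => xe ε - ye ε) := by
  simpa only [sub_eq_add_neg] using hx.add hy.neg

theorem rep_zero : Rep (0 : Gen ρ A) (fun _ => 0) := rep_iff.2 ⟨(moderateNets ρ A).zero_mem, rfl⟩

theorem rep_one : Rep (1 : Gen ρ A) (fun _ => 1) := rep_iff.2 ⟨(moderateNets ρ A).one_mem, rfl⟩

theorem rep_const (a : A) : Rep (const ρ a) (fun _ => a) := (moderate_const ρ A a).rep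

theorem Rep.pow {x : Gen ρ A} {xe : Idx → A} (hx : Rep x xe) (n : ℕ) :
    Rep (x ^ n) (fun ε => xe ε ^ n) := by
  induction n with
  | zero => simpa using rep_one
  | succ n ih => simpa only [pow_succ] using ih.mul hx

theorem Rep.eq_zero_iff {x : Gen ρ A} {xe : Idx → A} (hx : Rep x xe) :
    x = 0 ↔ Negligible ρ A xe := by
  constructor
  · rintro rfl
    have := hx.negligible_sub rep_zero
    exact this.of_le (Eventually.of_forall fun ε => by simp)
  · intro h
    exact hx.eq_of_negligible rep_zero
      (h.of_le (Eventually.of_forall fun ε => by simp))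

/-- A Lipschitz map sends negligible differences to negligible ones, so the representative picked in
the definition of `map` does not matter. -/
theorem Rep.map {φ : A → B} {K : NNReal} (hφ : LipschitzWith K φ) {x : Gen ρ A} {xe : Idx → A}
    (hx : Rep x xe) : Rep (map φ x) (fun ε => φ (xe ε)) := by
  have key : ∀ {xe ye : Idx → A}, Negligible ρ A (xe - ye) →
      Negligible ρ B (fun ε => φ (xe ε) - φ (ye ε)) := by
    intro xe ye h
    have h2 := (moderate_const ρ ℝ (K : ℝ)).mul_negligible h.norm
    refine h2.of_le (Eventually.of_forall fun ε => ?_)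
    have := hφ.dist_le_mul (xe ε) (ye ε)
    rw [dist_eq_norm, dist_eq_norm] at this
    exact this.trans (Real.le_norm_self _)
  have hmod : ∀ {xe : Idx → A}, Moderate ρ A xe → Moderate ρ B (fun ε => φ (xe ε)) := by
    intro xe h
    have h2 := ((moderate_const ρ ℝ (K : ℝ)).mul h.norm).add (moderate_const ρ ℝ ‖φ 0‖)
    refine h2.of_le (Eventually.of_forall fun ε => ?_)
    have := hφ.dist_le_mul (xe ε) 0
    rw [dist_eq_norm, dist_eq_norm, sub_zero] at this
    refine le_trans ?_ (Real.le_norm_self _)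
    have h3 := norm_add_le (φ (xe ε) - φ 0) (φ 0)
    rw [sub_add_cancel] at h3
    simp only [Pi.add_apply, Pi.mul_apply]
    linarith
  exact (hmod (rep_spec x).1).rep.of_negligible_sub (key (hx.negligible_sub (rep_spec x)))

theorem Rep.gnorm {x : Gen ρ A} {xe : Idx → A} (hx : Rep x xe) :
    Rep (gnorm x) (fun ε => ‖xe ε‖) := hx.map lipschitzWith_one_norm

end Nets

/-! ### Order, invertibility and elementary functions on generalized numbers -/

section Scalars

variable {ρ : Gauge} {A : Type} [NormedCommRing A]

theorem lipschitzWith_ofReal : LipschitzWith 1 (fun a : ℝ => (a : ℂ)) :=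
  Complex.isometry_ofReal.lipschitz

theorem Rep.toC {x : Gen ρ ℝ} {xe : Idx → ℝ} (hx : Rep x xe) :
    Rep (toC x) (fun ε => (xe ε : ℂ)) := hx.map lipschitzWith_ofReal

theorem Rep.gcos {x : Gen ρ ℝ} {xe : Idx → ℝ} (hx : Rep x xe) :
    Rep (gcos x) (fun ε => Real.cos (xe ε)) := hx.map Real.lipschitzWith_cos

theorem Rep.pair {x t : Gen ρ ℝ} {xe te : Idx → ℝ} (hx : Rep x xe) (ht : Rep t te) :
    Rep (pair x t) (fun ε => (xe ε, te ε)) := by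
  have h1 : LipschitzWith 1 (fun a : ℝ => ((a, 0) : ℝ × ℝ)) :=
    LipschitzWith.of_dist_le_mul fun a b => by simp [Prod.dist_eq]
  have h2 : LipschitzWith 1 (fun a : ℝ => ((0, a) : ℝ × ℝ)) :=
    LipschitzWith.of_dist_le_mul fun a b => by simp [Prod.dist_eq]
  have h3 := (hx.map h1).add (ht.map h2)
  simp only [Prod.mk_add_mk, add_zero, zero_add] at h3
  exact h3

theorem Rep.of_pair_fst {x t : Gen ρ ℝ} {p : Idx → ℝ × ℝ} (h : Rep (GenSmooth.pair x t) p) :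
    Rep x (fun ε => (p ε).1) := by
  have h1 := h.negligible_sub ((rep_spec x).pair (rep_spec t))
  exact (rep_spec x).of_negligible_sub
    (h1.of_le (Eventually.of_forall fun ε => norm_fst_le (p ε - (rep x ε, rep t ε))))

theorem Rep.of_pair_snd {x t : Gen ρ ℝ} {p : Idx → ℝ × ℝ} (h : Rep (GenSmooth.pair x t) p) :
    Rep t (fun ε => (p ε).2) := by
  have h1 := h.negligible_sub ((rep_spec x).pair (rep_spec t))
  exact (rep_spec t).of_negligible_sub
    (h1.of_le (Eventually.of_forall fun ε => norm_snd_le (p ε - (rep x ε, rep t ε))))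

/-- Frees the order from its existential over representatives. For the converse, `min xe ye` is
again a representative of `x`, since it differs from `xe` by at most the slack. -/
theorem le_iff_forall {x y : Gen ρ ℝ} {xe ye : Idx → ℝ} (hx : Rep x xe) (hy : Rep y ye) :
    x ≤ y ↔ ∀ n : ℕ, ∀ᶠ ε in atBot, xe ε ≤ ye ε + ρ.net ε ^ n := by
  constructor
  · rintro ⟨xe', ye', hx', hy', h⟩ n
    have h1 := (hx.negligible_sub hx').add (hy'.negligible_sub hy) n
    filter_upwards [h, h1] with ε h2 h3
    have := (le_abs_self _).trans h3
    simp only [Pi.add_apply, Pi.sub_apply] at this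
    linarith
  · intro h
    refine ⟨fun ε => min (xe ε) (ye ε), ye, hx.of_negligible_sub fun n => ?_, hy,
      Eventually.of_forall fun ε => min_le_right _ _⟩
    filter_upwards [h n] with ε h
    have hp := pow_pos (ρ.pos ε) n
    rw [Pi.sub_apply, Real.norm_eq_abs, abs_le]
    constructor
    · rcases min_cases (xe ε) (ye ε) with h1 | h1 <;> rw [h1.1] <;> linarith
    · linarith [min_le_left (xe ε) (ye ε)]

theorem le_of_eventually {x y : Gen ρ ℝ} {xe ye : Idx → ℝ} (hx : Rep x xe) (hy : Rep y ye)
    (h : ∀ᶠ ε in atBot, xe ε ≤ ye ε) : x ≤ y := ⟨xe, ye, hx, hy, h⟩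

theorem Gen.le_refl (x : Gen ρ ℝ) : x ≤ x :=
  le_of_eventually (rep_spec x) (rep_spec x) (Eventually.of_forall fun _ => le_rfl)

/-- The inverse is at most `ρ^(-N)` and the product is near `1`, so `|x_ε| ≥ ρ^N / 2`; one more
power of `ρ` absorbs the factor `1/2`. -/
theorem IsUnit.eventually_ge {x : Gen ρ ℝ} (h : IsUnit x) {xe : Idx → ℝ} (hx : Rep x xe) :
    ∃ m : ℕ, ∀ᶠ ε in atBot, ρ.net ε ^ m ≤ |xe ε| := by
  obtain ⟨y, hy⟩ := h.exists_right_inv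
  obtain ⟨N, hN⟩ := (rep_spec y).1
  have h1 := (hx.mul (rep_spec y)).negligible_sub (hy ▸ rep_one) 1
  refine ⟨N + 1, ?_⟩
  -- Used twice: to keep the product above `1/2`, and to bound `ρ^(N+1)` by `ρ^N / 2`.
  have h2 := ρ.tendsto_zero.eventually (gt_mem_nhds (show (0:ℝ) < 1/2 by norm_num))
  filter_upwards [hN, h1, h2] with ε h1 h2 h3
  have hp := pow_pos (ρ.pos ε) N
  rw [pow_one] at h2
  have h4 : 1 / 2 ≤ |xe ε * rep y ε| := by
    have := abs_sub_abs_le_abs_sub 1 (xe ε * rep y ε)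
    rw [abs_one, abs_sub_comm] at this
    have h5 : |xe ε * rep y ε - 1| ≤ ρ.net ε := h2
    linarith
  rw [abs_mul] at h4
  have h6 : |xe ε| * |rep y ε| ≤ |xe ε| * (ρ.net ε ^ N)⁻¹ := by gcongr; exact h1
  have h7 : 1 / 2 ≤ |xe ε| * (ρ.net ε ^ N)⁻¹ := h4.trans h6
  rw [← div_eq_mul_inv, le_div_iff₀ hp] at h7
  rw [pow_succ]
  nlinarith

theorem rep_dRho (ρ : Gauge) : Rep (dRho ρ) ρ.net := (moderate_gauge ρ).rep

theorem gnorm_le_dRho_pow {z : Gen ρ A} {ze : Idx → A} (hz : Rep z ze) {q : ℕ}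
    (h : ∀ᶠ ε in atBot, ‖ze ε‖ ≤ ρ.net ε ^ q) : gnorm z ≤ dRho ρ ^ q :=
  le_of_eventually hz.gnorm ((rep_dRho ρ).pow q) h

/-- Points of `[-k, k]` have representatives in `[-k_ε, k_ε]`. -/
theorem exists_rep_mem_Icc {k x : Gen ρ ℝ} (hx : x ∈ box k) {ke : Idx → ℝ} (hk : Rep k ke)
    (hk0 : ∀ ε, 0 ≤ ke ε) : ∃ xe, Rep x xe ∧ ∀ ε, xe ε ∈ Icc (-ke ε) (ke ε) := by
  -- Clamping an arbitrary representative moves it by no more than the slack in the two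
  -- inequalities, which is negligible.
  refine ⟨fun ε => max (-ke ε) (min (rep x ε) (ke ε)), (rep_spec x).of_negligible_sub fun n => ?_,
    fun ε => ⟨le_max_left _ _, max_le (by linarith [hk0 ε]) (min_le_right _ _)⟩⟩
  filter_upwards [(le_iff_forall hk.neg (rep_spec x)).1 hx.1 n,
    (le_iff_forall (rep_spec x) hk).1 hx.2 n] with ε h1 h2
  have hp := pow_pos (ρ.pos ε) n
  rw [Pi.sub_apply, Real.norm_eq_abs, abs_le]
  rcases max_cases (-ke ε) (min (rep x ε) (ke ε)) with h3 | h3 <;>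
  rcases min_cases (rep x ε) (ke ε) with h4 | h4 <;> rw [h3.1] <;> constructor <;>
  linarith [hk0 ε]

theorem mem_box_of_eventually {k x : Gen ρ ℝ} {ke xe : Idx → ℝ} (hk : Rep k ke) (hx : Rep x xe)
    (h : ∀ᶠ ε in atBot, xe ε ∈ Icc (-ke ε) (ke ε)) : x ∈ box k :=
  ⟨le_of_eventually hk.neg hx (h.mono fun _ h => h.1), le_of_eventually hx hk (h.mono fun _ h => h.2)⟩

theorem exists_rep_nonneg {t : Gen ρ ℝ} (ht : t ∈ nonneg ρ) :
    ∃ te, Rep t te ∧ ∀ ε, 0 ≤ te ε := by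
  refine ⟨fun ε => max 0 (rep t ε), (rep_spec t).of_negligible_sub fun n => ?_,
    fun ε => le_max_left _ _⟩
  filter_upwards [(le_iff_forall rep_zero (rep_spec t)).1 ht n] with ε h1
  have hp := pow_pos (ρ.pos ε) n
  rw [Pi.sub_apply, Real.norm_eq_abs, abs_le]
  rcases max_cases 0 (rep t ε) with h3 | h3 <;> rw [h3.1] <;> constructor <;> linarith

theorem mem_nonneg_of_eventually {t : Gen ρ ℝ} {te : Idx → ℝ} (ht : Rep t te)
    (h : ∀ᶠ ε in atBot, 0 ≤ te ε) : t ∈ nonneg ρ := le_of_eventually rep_zero ht h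

end Scalars

/-! ### From pointwise to uniform estimates -/

section Uniform

variable {ρ : Gauge} {A : Type} [NormedCommRing A]

/-- Diagonal gluing: pick indices `φ n ≤ 1/(n+1)` with a witness of the `n`-th property, put the
witnesses at these indices and the default `d` elsewhere. Since the properties get stronger with
`n`, the glued net has each of them at arbitrarily small indices. -/
theorem exists_net_of_frequently {E : Type} {P : ℕ → Idx → E → Prop}
    (hP : ∀ N ε y, P (N + 1) ε y → P N ε y) (d : Idx → E)
    (h : ∀ N, ∃ᶠ ε in atBot, ∃ y, P N ε y) :
    ∃ ye : Idx → E, (∀ N, ∀ᶠ ε in atBot, ye ε = d ε ∨ P N ε (ye ε)) ∧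
      ∀ N, ∃ᶠ ε in atBot, P N ε (ye ε) := by
  classical
  have hanti : ∀ {M N : ℕ}, N ≤ M → ∀ {ε y}, P M ε y → P N ε y := by
    intro M N hMN ε y hy
    induction hMN with
    | refl => exact hy
    | step _ ih => exact ih (hP _ _ _ hy)
  have hex : ∀ n : ℕ, ∃ ε : Idx, (ε : ℝ) ≤ 1 / (n + 1) ∧ ∃ y, P n ε y := by
    intro n
    have hn : (0 : ℝ) < 1 / (n + 1) := by positivity
    obtain ⟨ε, hε, hy⟩ := frequently_atBot.1 (h n) ⟨min 1 (1 / (n + 1)), lt_min one_pos hn, min_le_left _ _⟩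
    exact ⟨ε, (show (ε : ℝ) ≤ min 1 _ from hε).trans (min_le_right _ _), hy⟩
  choose φ hφ y hy using hex
  -- Below `φ 0, …, φ (N-1)`, an index can be hit only by some `φ n` with `n ≥ N`. This takes care
  -- of a possibly non-injective `φ`.
  have key : ∀ N, ∀ᶠ ε : Idx in atBot, ∀ n < N, ε < φ n := by
    intro N
    refine (eventually_all_finite (Set.finite_lt_nat N)).2 fun n _ => ?_
    have hpos : (0 : ℝ) < (φ n : ℝ) := (φ n).2.1
    filter_upwards [eventually_le_atBot
      (⟨(φ n : ℝ) / 2, by positivity, by linarith [(φ n).2.2]⟩ : Idx)] with ε hε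
    have : (ε : ℝ) ≤ φ n / 2 := hε
    exact Subtype.coe_lt_coe.1 (by linarith)
  refine ⟨fun ε => if h : ∃ n, φ n = ε then y h.choose else d ε, ?_, ?_⟩
  · intro N
    filter_upwards [key N] with ε hε
    by_cases h : ∃ n, φ n = ε
    · right
      rw [dif_pos h]
      have h2 := h.choose_spec
      have h3 : N ≤ h.choose := by
        by_contra h4
        exact absurd h2 (hε _ (not_le.1 h4)).ne'
      have h4 := hanti h3 (hy h.choose)
      rwa [h2] at h4
    · left
      exact dif_neg h
  · intro N
    rw [frequently_atBot]
    intro a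
    -- The preimage of `φ n` may contain several numbers; all of them must be at least `N`, because
    -- `choose` may return any.
    have hcases : ∃ n : ℕ, φ n ≤ a ∧ ∀ m, φ m = φ n → N ≤ m := by
      obtain ⟨b, hba, hb⟩ : ∃ b : Idx, b ≤ a ∧ ∀ m < N, b < φ m := by
        obtain ⟨b, hb1, hb2⟩ := ((eventually_le_atBot a).and (key N)).exists
        exact ⟨b, hb1, hb2⟩
      obtain ⟨n, hn⟩ := exists_nat_one_div_lt b.2.1
      have hnb : φ n ≤ b := Subtype.coe_le_coe.1 ((hφ n).trans hn.le)
      refine ⟨n, hnb.trans hba, fun m hm => ?_⟩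
      by_contra h4
      have := hb m (not_le.1 h4)
      rw [hm] at this
      exact absurd this (not_lt.2 hnb)
    obtain ⟨n, hn, hm⟩ := hcases
    refine ⟨φ n, hn, ?_⟩
    have h : ∃ m, φ m = φ n := ⟨n, rfl⟩
    beta_reduce
    rw [dif_pos h]
    have h2 := h.choose_spec
    have h4 := hanti (hm _ h2) (hy h.choose)
    rwa [h2] at h4

/-- Otherwise every power `ρ^(-N)` is exceeded at arbitrarily small indices, and gluing the
offending points gives a single net in `S` along which `Q` is not moderate. -/
theorem uniform_moderate {E : Type} {S : Idx → Set E} (hS : ∀ᶠ ε in atBot, (S ε).Nonempty)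
    {Q : Idx → E → ℝ}
    (h : ∀ ye : Idx → E, (∀ᶠ ε in atBot, ye ε ∈ S ε) → Moderate ρ ℝ fun ε => Q ε (ye ε)) :
    ∃ N : ℕ, ∀ᶠ ε in atBot, ∀ y ∈ S ε, |Q ε y| ≤ (ρ.net ε ^ N)⁻¹ := by
  classical
  by_contra hcon
  push Not at hcon
  obtain ⟨e, he⟩ := hS.exists
  have hne : Nonempty E := ⟨he.some⟩
  obtain ⟨ye, h1, h2⟩ := exists_net_of_frequently (E := E)
    (P := fun N ε y => y ∈ S ε ∧ (ρ.net ε ^ N)⁻¹ < |Q ε y|) (by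
      rintro N ε y ⟨hy, h⟩
      refine ⟨hy, lt_of_le_of_lt ?_ h⟩
      exact inv_anti₀ (pow_pos (ρ.pos ε) _) (pow_le_pow_of_le_one (ρ.pos ε).le (ρ.le_one ε) (by omega)))
    (fun ε => if h : (S ε).Nonempty then h.some else Classical.arbitrary E) (fun N => by
      refine (hcon N).mono fun ε => ?_
      rintro ⟨y, hy⟩; exact ⟨y, hy⟩)
  obtain ⟨N, hN⟩ := h ye (by
    filter_upwards [h1 0, hS] with ε h1 hS
    rcases h1 with h1 | h1
    · rw [h1, dif_pos hS]; exact hS.some_mem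
    · exact h1.1)
  obtain ⟨ε, h3, h4⟩ := ((h2 N).and_eventually hN).exists
  exact absurd h3.2 (not_lt.2 h4)

/-- Here no diagonal argument is needed: take a counterexample at each index that has one, and apply
the hypothesis to that net. -/
theorem uniform_eventually {E : Type} {S : Idx → Set E} (hS : ∀ᶠ ε in atBot, (S ε).Nonempty)
    {P : Idx → E → Prop}
    (h : ∀ ye : Idx → E, (∀ᶠ ε in atBot, ye ε ∈ S ε) → ∀ᶠ ε in atBot, P ε (ye ε)) :
    ∀ᶠ ε in atBot, ∀ y ∈ S ε, P ε y := by
  classical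
  by_contra hcon
  obtain ⟨e, he⟩ := hS.exists
  have hne : Nonempty E := ⟨he.some⟩
  let ye : Idx → E := fun ε => if h : ∃ y ∈ S ε, ¬ P ε y then h.choose else
    if h : (S ε).Nonempty then h.some else Classical.arbitrary E
  have h1 := h ye (by
    filter_upwards [hS] with ε hS
    by_cases h : ∃ y ∈ S ε, ¬ P ε y
    · simp only [ye, dif_pos h]; exact h.choose_spec.1
    · simp only [ye, dif_neg h, dif_pos hS]; exact hS.some_mem)
  refine hcon ?_
  filter_upwards [h1] with ε h1
  by_contra h
  push Not at h
  simp only [ye, dif_pos h] at h1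
  exact h.choose_spec.2 h1

/-- Every net in the sets `S_ε` represents a point of `X`. -/
def NetsIn (X : Set (Gen ρ A)) (S : Idx → Set A) : Prop :=
  (∀ᶠ ε in atBot, (S ε).Nonempty) ∧
    ∀ xe : Idx → A, (∀ᶠ ε in atBot, xe ε ∈ S ε) → ∃ x ∈ X, Rep x xe

theorem netsIn_Icc_box {k : Gen ρ ℝ} {ke : Idx → ℝ} (hk : Rep k ke) (hk0 : ∀ᶠ ε in atBot, 0 ≤ ke ε) :
    NetsIn (box k) (fun ε => Icc (-ke ε) (ke ε)) := by
  refine ⟨hk0.mono fun ε h => ⟨0, by simpa using h⟩, fun xe h => ?_⟩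
  have hm : Moderate ρ ℝ xe := hk.1.of_le (h.mono fun ε h =>
    (abs_le.2 h).trans (Real.le_norm_self _))
  exact ⟨ofNet ρ xe, mem_box_of_eventually hk hm.rep h, hm.rep⟩

theorem Moderate.of_mem_uIcc {ae be xe : Idx → ℝ} (ha : Moderate ρ ℝ ae) (hb : Moderate ρ ℝ be)
    (h : ∀ᶠ ε in atBot, xe ε ∈ uIcc (ae ε) (be ε)) : Moderate ρ ℝ xe := by
  refine (ha.norm.add hb.norm).of_le (h.mono fun ε h => ?_)
  refine le_trans ?_ (Real.le_norm_self _)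
  simp only [Pi.add_apply, Real.norm_eq_abs]
  rw [abs_le]
  rcases mem_uIcc.1 h with h | h <;> constructor <;>
  linarith [neg_abs_le (ae ε), neg_abs_le (be ε), le_abs_self (ae ε), le_abs_self (be ε),
    abs_nonneg (ae ε), abs_nonneg (be ε)]

theorem netsIn_uIcc_box {k a b : Gen ρ ℝ} (ha : a ∈ box k) (hb : b ∈ box k) {ae be : Idx → ℝ}
    (hae : Rep a ae) (hbe : Rep b be) : NetsIn (box k) (fun ε => uIcc (ae ε) (be ε)) := by
  refine ⟨Eventually.of_forall fun ε => nonempty_uIcc, fun xe h => ?_⟩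
  have hm := Moderate.of_mem_uIcc hae.1 hbe.1 h
  refine ⟨ofNet ρ xe, ⟨?_, ?_⟩, hm.rep⟩
  · rw [le_iff_forall (rep_spec k).neg hm.rep]
    intro n
    filter_upwards [h, (le_iff_forall (rep_spec k).neg hae).1 ha.1 n,
      (le_iff_forall (rep_spec k).neg hbe).1 hb.1 n] with ε h h1 h2
    rcases mem_uIcc.1 h with h | h <;> linarith
  · rw [le_iff_forall hm.rep (rep_spec k)]
    intro n
    filter_upwards [h, (le_iff_forall hae (rep_spec k)).1 ha.2 n,
      (le_iff_forall hbe (rep_spec k)).1 hb.2 n] with ε h h1 h2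
    rcases mem_uIcc.1 h with h | h <;> linarith

theorem netsIn_uIcc_nonneg {a b : Gen ρ ℝ} (ha : a ∈ nonneg ρ) (hb : b ∈ nonneg ρ) {ae be : Idx → ℝ}
    (hae : Rep a ae) (hbe : Rep b be) : NetsIn (nonneg ρ) (fun ε => uIcc (ae ε) (be ε)) := by
  refine ⟨Eventually.of_forall fun ε => nonempty_uIcc, fun xe h => ?_⟩
  have hm := Moderate.of_mem_uIcc hae.1 hbe.1 h
  refine ⟨ofNet ρ xe, ?_, hm.rep⟩
  show (0 : Gen ρ ℝ) ≤ _
  rw [le_iff_forall rep_zero hm.rep]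
  intro n
  filter_upwards [h, (le_iff_forall rep_zero hae).1 ha n,
    (le_iff_forall rep_zero hbe).1 hb n] with ε h h1 h2
  rcases mem_uIcc.1 h with h | h <;> linarith

end Uniform

/-! ### Cutoffs, tame functions and integrals depending smoothly on a parameter -/

section Smooth

/-- Multiply by a smooth cutoff. The agreement holds near each point of `K`, not only on `K`, so
that all derivatives agree there too. -/
theorem exists_contDiff_eventuallyEq {E F : Type} [NormedAddCommGroup E] [NormedSpace ℝ E]
    [FiniteDimensional ℝ E] [NormedAddCommGroup F] [NormedSpace ℝ F] {K Ω : Set E}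
    (hK : IsClosed K) (hΩ : IsOpen Ω) (h : K ⊆ Ω) {f : E → F} (hf : ContDiffOn ℝ ∞ f Ω) :
    ∃ g : E → F, ContDiff ℝ ∞ g ∧ ∀ x ∈ K, g =ᶠ[𝓝 x] f := by
  obtain ⟨u, hu, hKu, huΩ⟩ := normal_exists_closure_subset hK hΩ h
  obtain ⟨χ, h1, h0, -⟩ := exists_contMDiffMap_one_nhds_of_subset_interior
    (n := ⊤) (modelWithCornersSelf ℝ E) hK (t := closure u)
    (hKu.trans (hu.subset_interior_iff.2 subset_closure))
  have hχ : ContDiff ℝ ∞ χ := χ.contMDiff.contDiff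
  refine ⟨fun x => χ x • f x, contDiff_iff_contDiffAt.2 fun x => ?_, fun x hx => ?_⟩
  · by_cases hx : x ∈ closure u
    · exact hχ.contDiffAt.smul (hf.contDiffAt (hΩ.mem_nhds (huΩ hx)))
    · refine (contDiffAt_const (c := (0 : F))).congr_of_eventuallyEq ?_
      filter_upwards [isClosed_closure.isOpen_compl.mem_nhds hx] with y hy
      rw [h0 y hy, zero_smul]
  · filter_upwards [(eventually_nhdsSet_iff_forall.1 h1) x hx] with y hy
    rw [hy, one_smul]

variable {A B : Type} [NormedCommRing A] [NormedAlgebra ℝ A] [NormedCommRing B] [NormedAlgebra ℝ B]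

theorem norm_iteratedFDeriv_mul_le_of_isOpen {Ω : Set A} (hΩ : IsOpen Ω) {f g : A → B}
    (hf : ContDiffOn ℝ ∞ f Ω) (hg : ContDiffOn ℝ ∞ g Ω) {x : A} (hx : x ∈ Ω) (m : ℕ) :
    ‖iteratedFDeriv ℝ m (fun y => f y * g y) x‖ ≤ ∑ i ∈ Finset.range (m + 1),
      (m.choose i : ℝ) * ‖iteratedFDeriv ℝ i f x‖ * ‖iteratedFDeriv ℝ (m - i) g x‖ := by
  have := norm_iteratedFDerivWithin_mul_le hf hg hΩ.uniqueDiffOn hx (n := m)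
    (by exact_mod_cast le_top)
  simpa only [iteratedFDerivWithin_of_isOpen _ hΩ hx] using this

/-- Smooth functions with bounded derivatives. -/
structure Tame (φ : ℝ → B) : Prop where
  contDiff : ContDiff ℝ ∞ φ
  bound : ∀ m : ℕ, 1 ≤ m → ∃ C : ℝ, ∀ x, ‖iteratedDeriv m φ x‖ ≤ C

theorem Tame.exists_lipschitz {φ : ℝ → B} (h : Tame φ) : ∃ K : NNReal, LipschitzWith K φ := by
  obtain ⟨C, hC⟩ := h.bound 1 le_rfl
  refine ⟨C.toNNReal, lipschitzWith_of_nnnorm_deriv_le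
    (h.contDiff.differentiable (by simp)) fun x => ?_⟩
  rw [← NNReal.coe_le_coe, coe_nnnorm]
  have := hC x
  rw [iteratedDeriv_one] at this
  exact this.trans (Real.le_coe_toNNReal C)

/-- The bound on `ψ'` provides a dominating function valid for all `w` at once. The amplitude `a` is
only continuous, so that the factors `(cs)^m` can later be absorbed in it. -/
theorem hasDerivAt_integral_mul_comp {p q c : ℝ} {a ψ ψ' : ℝ → ℂ} (ha : ContinuousOn a (uIcc p q))
    (hψ : ∀ x, HasDerivAt ψ (ψ' x) x) (hψ' : Continuous ψ') {C : ℝ} (hC : ∀ x, ‖ψ' x‖ ≤ C) (w : ℝ) :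
    HasDerivAt (fun w : ℝ => ∫ s in p..q, a s * ψ (c * w * s))
      (∫ s in p..q, (a s * ((c * s : ℝ) : ℂ)) * ψ' (c * w * s)) w := by
  have hψc : Continuous ψ := continuous_iff_continuousAt.2 fun x => (hψ x).continuousAt
  have hcont : ∀ w : ℝ, ContinuousOn (fun s => a s * ψ (c * w * s)) (uIcc p q) := fun w =>
    ha.mul (by fun_prop)
  refine (intervalIntegral.hasDerivAt_integral_of_dominated_loc_of_deriv_le
    (F := fun w s => a s * ψ (c * w * s))
    (F' := fun w s => (a s * ((c * s : ℝ) : ℂ)) * ψ' (c * w * s)) (x₀ := w) (s := univ)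
    (bound := fun s => ‖a s‖ * |c * s| * C) univ_mem
    (Eventually.of_forall fun w => ?_) ((hcont w).intervalIntegrable) ?_ ?_ ?_ ?_).2
  · exact ((hcont w).mono uIoc_subset_uIcc).aestronglyMeasurable measurableSet_uIoc
  · refine (ContinuousOn.mono ?_ uIoc_subset_uIcc).aestronglyMeasurable measurableSet_uIoc
    exact (ha.mul (by fun_prop)).mul (by fun_prop)
  · refine Eventually.of_forall fun s _ w _ => ?_
    rw [norm_mul, norm_mul, Complex.norm_real, Real.norm_eq_abs]
    gcongr
    exact hC _
  · exact ContinuousOn.intervalIntegrable ((ha.norm.mul (by fun_prop)).mul (by fun_prop))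
  · refine Eventually.of_forall fun s _ w _ => ?_
    have h1 : HasDerivAt (fun w : ℝ => c * w * s) (c * s) w := by
      simpa using ((hasDerivAt_id w).const_mul c).mul_const s
    have h2 := ((hψ (c * w * s)).scomp w h1).const_mul (a s)
    exact h2.congr_deriv (by rw [Complex.real_smul]; ring)

variable {p q c : ℝ} {a φ : ℝ → ℂ}

theorem iteratedDeriv_integral_mul_comp (ha : ContinuousOn a (uIcc p q)) (hφ : Tame φ) (m : ℕ) :
    iteratedDeriv m (fun w : ℝ => ∫ s in p..q, a s * φ (c * w * s)) =
      fun w => ∫ s in p..q, (a s * (((c * s) ^ m : ℝ) : ℂ)) * iteratedDeriv m φ (c * w * s) := by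
  induction m with
  | zero => simp
  | succ m ih =>
    rw [iteratedDeriv_succ, ih]
    ext w
    obtain ⟨C, hC⟩ := hφ.bound (m + 1) (by omega)
    have h := hasDerivAt_integral_mul_comp (p := p) (q := q) (c := c)
      (a := fun s => a s * (((c * s) ^ m : ℝ) : ℂ)) (ψ := iteratedDeriv m φ)
      (ψ' := iteratedDeriv (m + 1) φ) (ha.mul (by fun_prop))
      (fun x => by
        rw [iteratedDeriv_succ]
        exact ((hφ.contDiff.differentiable_iteratedDeriv m
          (by exact_mod_cast ENat.natCast_lt_top m)) x).hasDerivAt)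
      (hφ.contDiff.continuous_iteratedDeriv (m + 1) (by exact_mod_cast le_top)) hC w
    rw [h.deriv]
    congr 1
    ext s
    push_cast
    ring

theorem contDiff_integral_mul_comp (ha : ContinuousOn a (uIcc p q)) (hφ : Tame φ) :
    ContDiff ℝ ∞ (fun w : ℝ => ∫ s in p..q, a s * φ (c * w * s)) := by
  refine contDiff_of_differentiable_iteratedDeriv fun m _ => ?_
  rw [iteratedDeriv_integral_mul_comp ha hφ m]
  intro w
  obtain ⟨C, hC⟩ := hφ.bound (m + 1) (by omega)
  exact (hasDerivAt_integral_mul_comp (p := p) (q := q) (c := c)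
      (a := fun s => a s * (((c * s) ^ m : ℝ) : ℂ)) (ψ := iteratedDeriv m φ)
      (ψ' := iteratedDeriv (m + 1) φ) (ha.mul (by fun_prop))
      (fun x => by
        rw [iteratedDeriv_succ]
        exact ((hφ.contDiff.differentiable_iteratedDeriv m
          (by exact_mod_cast ENat.natCast_lt_top m)) x).hasDerivAt)
      (hφ.contDiff.continuous_iteratedDeriv (m + 1) (by exact_mod_cast le_top)) hC w).differentiableAt

end Smooth

/-! ### Closure properties of generalized smooth functions -/

section GSF

variable {ρ : Gauge} {A B : Type} [NormedCommRing A] [NormedAlgebra ℝ A]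
  [NormedCommRing B] [NormedAlgebra ℝ B]

theorem IsGSF.defines {X : Set (Gen ρ A)} {f : Gen ρ A → Gen ρ B} (h : IsGSF X f) :
    ∃ Ω, Defines X f Ω (defNet X f) := by
  rw [defNet, dif_pos h]
  exact ⟨_, Classical.choose_spec (Classical.choose_spec h)⟩

theorem IsGSF.congr {X : Set (Gen ρ A)} {f g : Gen ρ A → Gen ρ B} (hf : IsGSF X f)
    (h : ∀ x ∈ X, g x = f x) : IsGSF X g := by
  obtain ⟨Ω, F, hF⟩ := hf
  exact ⟨Ω, F, hF.isOpen, hF.smooth, hF.subset, fun x hx xe hxe => h x hx ▸ hF.value x hx xe hxe,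
    hF.moderate⟩

theorem isGSF_const (X : Set (Gen ρ A)) (b : Gen ρ B) : IsGSF X (fun _ => b) := by
  refine ⟨fun _ => univ, fun ε _ => rep b ε, fun _ => isOpen_univ, fun _ => contDiffOn_const,
    fun _ _ _ _ => Eventually.of_forall fun _ => mem_univ _, fun _ _ _ _ => rep_spec b,
    fun x hx xe hxe m => ?_⟩
  rcases Nat.eq_zero_or_pos m with rfl | hm
  · simpa using (rep_spec b).1.norm
  · simp only [iteratedFDeriv_const_of_ne hm.ne', Pi.zero_apply, norm_zero]
    exact rep_zero.1

theorem IsGSF.mul {X : Set (Gen ρ A)} {f g : Gen ρ A → Gen ρ B} (hf : IsGSF X f) (hg : IsGSF X g) :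
    IsGSF X (fun x => f x * g x) := by
  obtain ⟨Ω, F, hF⟩ := hf
  obtain ⟨Ω', G, hG⟩ := hg
  have ho := fun ε => (hF.isOpen ε).inter (hG.isOpen ε)
  have hs1 := fun ε => (hF.smooth ε).mono (inter_subset_left (t := Ω' ε))
  have hs2 := fun ε => (hG.smooth ε).mono (inter_subset_right (s := Ω ε))
  have hsub : ∀ x ∈ X, ∀ xe, Rep x xe → ∀ᶠ ε in atBot, xe ε ∈ Ω ε ∩ Ω' ε := fun x hx xe hxe => by
    filter_upwards [hF.subset x hx xe hxe, hG.subset x hx xe hxe] with ε h1 h2 using ⟨h1, h2⟩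
  refine ⟨fun ε => Ω ε ∩ Ω' ε, fun ε x => F ε x * G ε x, ho, fun ε => (hs1 ε).mul (hs2 ε),
    hsub, fun x hx xe hxe => (hF.value x hx xe hxe).mul (hG.value x hx xe hxe),
    fun x hx xe hxe m => ?_⟩
  have hmod : Moderate ρ ℝ fun ε => ∑ i ∈ Finset.range (m + 1),
      (m.choose i : ℝ) * ‖iteratedFDeriv ℝ i (F ε) (xe ε)‖ * ‖iteratedFDeriv ℝ (m - i) (G ε) (xe ε)‖ :=
    Moderate.sum _ fun i _ => ((moderate_const ρ ℝ _).mul (hF.moderate x hx xe hxe i)).mul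
      (hG.moderate x hx xe hxe (m - i))
  refine hmod.of_le ?_
  filter_upwards [hsub x hx xe hxe] with ε hε
  rw [norm_norm]
  exact (norm_iteratedFDeriv_mul_le_of_isOpen (ho ε) (hs1 ε) (hs2 ε) hε m).trans
    (Real.le_norm_self _)

theorem IsGSF.add {X : Set (Gen ρ A)} {f g : Gen ρ A → Gen ρ B} (hf : IsGSF X f) (hg : IsGSF X g) :
    IsGSF X (fun x => f x + g x) := by
  obtain ⟨Ω, F, hF⟩ := hf
  obtain ⟨Ω', G, hG⟩ := hg
  have ho := fun ε => (hF.isOpen ε).inter (hG.isOpen ε)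
  have hs1 := fun ε => (hF.smooth ε).mono (inter_subset_left (t := Ω' ε))
  have hs2 := fun ε => (hG.smooth ε).mono (inter_subset_right (s := Ω ε))
  have hsub : ∀ x ∈ X, ∀ xe, Rep x xe → ∀ᶠ ε in atBot, xe ε ∈ Ω ε ∩ Ω' ε := fun x hx xe hxe => by
    filter_upwards [hF.subset x hx xe hxe, hG.subset x hx xe hxe] with ε h1 h2 using ⟨h1, h2⟩
  refine ⟨fun ε => Ω ε ∩ Ω' ε, fun ε x => F ε x + G ε x, ho, fun ε => (hs1 ε).add (hs2 ε),
    hsub, fun x hx xe hxe => (hF.value x hx xe hxe).add (hG.value x hx xe hxe),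
    fun x hx xe hxe m => ?_⟩
  refine ((hF.moderate x hx xe hxe m).add (hG.moderate x hx xe hxe m)).of_le ?_
  filter_upwards [hsub x hx xe hxe] with ε hε
  rw [norm_norm]
  have h1 := ((hs1 ε).contDiffAt ((ho ε).mem_nhds hε)).of_le (m := m) (by exact_mod_cast le_top)
  have h2 := ((hs2 ε).contDiffAt ((ho ε).mem_nhds hε)).of_le (m := m) (by exact_mod_cast le_top)
  have h3 : iteratedFDeriv ℝ m (fun x => F ε x + G ε x) (xe ε) = _ := iteratedFDeriv_add_apply h1 h2
  rw [h3]
  exact (norm_add_le _ _).trans (Real.le_norm_self _)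

theorem IsGSF.neg {X : Set (Gen ρ A)} {f : Gen ρ A → Gen ρ B} (hf : IsGSF X f) :
    IsGSF X (fun x => -f x) :=
  ((isGSF_const X (-1)).mul hf).congr fun x _ => by ring

theorem IsGSF.sub {X : Set (Gen ρ A)} {f g : Gen ρ A → Gen ρ B} (hf : IsGSF X f) (hg : IsGSF X g) :
    IsGSF X (fun x => f x - g x) :=
  (hf.add hg.neg).congr fun x _ => by ring

theorem Tame.rep_map {φ : ℝ → B} (hφ : Tame φ) {x : Gen ρ ℝ} {xe : Idx → ℝ} (hx : Rep x xe) :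
    Rep (map φ x) (fun ε => φ (xe ε)) := by
  obtain ⟨K, hK⟩ := hφ.exists_lipschitz
  exact hx.map hK

/-- The `m`-th derivative is `a^m φ^(m)(ax)`: a moderate factor times a bounded one. This covers all
oscillating kernels below. -/
theorem isGSF_map_mul {φ : ℝ → B} (hφ : Tame φ) (a : Gen ρ ℝ) (X : Set (Gen ρ ℝ)) :
    IsGSF X (fun x => map φ (a * x)) := by
  refine ⟨fun _ => univ, fun ε x => φ (rep a ε * x), fun _ => isOpen_univ, fun ε => ?_,
    fun _ _ _ _ => Eventually.of_forall fun _ => mem_univ _,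
    fun x _ xe hxe => hφ.rep_map ((rep_spec a).mul hxe), fun x hx xe hxe m => ?_⟩
  · exact (hφ.contDiff.comp (contDiff_const.mul contDiff_id)).contDiffOn
  · rcases Nat.eq_zero_or_pos m with rfl | hm
    · simpa using (hφ.rep_map ((rep_spec a).mul hxe)).1.norm
    · obtain ⟨C, hC⟩ := hφ.bound m hm
      refine (((rep_spec a).1.pow m).norm.mul (moderate_const ρ ℝ C)).of_le
        (Eventually.of_forall fun ε => ?_)
      rw [norm_norm, norm_iteratedFDeriv_eq_norm_iteratedDeriv,
        iteratedDeriv_comp_const_smul (hφ.contDiff.of_le (by exact_mod_cast le_top)), norm_smul]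
      refine le_trans ?_ (Real.le_norm_self _)
      simp only [Pi.mul_apply]
      gcongr
      exact hC _

theorem NetsIn.defines_subset {X : Set (Gen ρ A)} {S : Idx → Set A} (hS : NetsIn X S)
    {f : Gen ρ A → Gen ρ B} {Ω F} (hF : Defines X f Ω F) : ∀ᶠ ε in atBot, S ε ⊆ Ω ε :=
  uniform_eventually hS.1 fun ye hye => by
    obtain ⟨x, hx, hxe⟩ := hS.2 ye hye
    exact hF.subset x hx ye hxe

theorem NetsIn.defines_moderate {X : Set (Gen ρ A)} {S : Idx → Set A} (hS : NetsIn X S)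
    {f : Gen ρ A → Gen ρ B} {Ω F} (hF : Defines X f Ω F) (m : ℕ) :
    ∃ N : ℕ, ∀ᶠ ε in atBot, ∀ y ∈ S ε, ‖iteratedFDeriv ℝ m (F ε) y‖ ≤ (ρ.net ε ^ N)⁻¹ := by
  obtain ⟨N, hN⟩ := uniform_moderate (ρ := ρ) hS.1 (Q := fun ε y => ‖iteratedFDeriv ℝ m (F ε) y‖)
    fun ye hye => by
      obtain ⟨x, hx, hxe⟩ := hS.2 ye hye
      exact hF.moderate x hx ye hxe m
  exact ⟨N, by simpa only [abs_norm] using hN⟩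

theorem netsIn_of_forall_rep {X : Set (Gen ρ A)} {S : Idx → Set A} {x : Gen ρ A} (hx : x ∈ X)
    {xe d : Idx → A} (hxe : Rep x xe) (hd : Negligible ρ A d) (hS : ∀ᶠ ε in atBot, (S ε).Nonempty)
    (h : ∀ᶠ ε in atBot, ∀ y ∈ S ε, ‖y - xe ε‖ ≤ ‖d ε‖) : NetsIn X S :=
  ⟨hS, fun ye hye => ⟨x, hx, hxe.of_negligible_sub (hd.of_le (by
    filter_upwards [h, hye] with ε h1 h2 using h1 _ h2))⟩⟩

theorem netsIn_segment {X : Set (Gen ρ A)} {x : Gen ρ A} (hx : x ∈ X) {xe ye : Idx → A}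
    (hxe : Rep x xe) (hye : Rep x ye) : NetsIn X (fun ε => segment ℝ (xe ε) (ye ε)) :=
  netsIn_of_forall_rep hx hxe (hye.negligible_sub hxe)
    (Eventually.of_forall fun ε => ⟨_, left_mem_segment ℝ _ _⟩)
    (Eventually.of_forall fun ε y hy => norm_sub_le_of_mem_segment hy)

/-- Mean value inequality on the segment between the representatives. All nets in these segments
represent the same point, so the next derivative is uniformly moderate there, while the length is
negligible. -/
theorem Defines.iteratedFDeriv_sub_negligible {X : Set (Gen ρ A)} {f : Gen ρ A → Gen ρ B} {Ω F}
    (hF : Defines X f Ω F) {x : Gen ρ A} (hx : x ∈ X) {xe ye : Idx → A}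
    (hxe : Rep x xe) (hye : Rep x ye) (m : ℕ) : Negligible ρ ℝ fun ε =>
      ‖iteratedFDeriv ℝ m (F ε) (ye ε) - iteratedFDeriv ℝ m (F ε) (xe ε)‖ := by
  have hS := netsIn_segment hx hxe hye
  obtain ⟨N, hN⟩ := hS.defines_moderate hF (m + 1)
  refine ((moderate_inv_pow ρ N).mul_negligible (hye.negligible_sub hxe).norm).of_le ?_
  filter_upwards [hN, hS.defines_subset hF] with ε h1 h2
  rw [norm_norm]
  refine le_trans ?_ (Real.le_norm_self _)
  refine (convex_segment (xe ε) (ye ε)).norm_image_sub_le_of_norm_fderiv_le (𝕜 := ℝ) (fun y hy => ?_)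
    (fun y hy => ?_) (left_mem_segment ℝ _ _) (right_mem_segment ℝ _ _)
  · exact (((hF.smooth ε).contDiffAt ((hF.isOpen ε).mem_nhds (h2 hy))).differentiableAt_iteratedFDeriv
      (by exact_mod_cast ENat.natCast_lt_top m))
  · rw [norm_fderiv_iteratedFDeriv]
    exact h1 y hy

theorem Defines.rep_iteratedFDeriv {X : Set (Gen ρ A)} {f : Gen ρ A → Gen ρ B} {Ω}
    (hF : Defines X f Ω (defNet X f)) {x : Gen ρ A} (hx : x ∈ X) {xe : Idx → A} (hxe : Rep x xe)
    (m : ℕ) (v : A) : Rep (gderiv X m v f x)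
      (fun ε => iteratedFDeriv ℝ m (defNet X f ε) (xe ε) fun _ => v) := by
  have hmod : Moderate ρ B (fun ε => iteratedFDeriv ℝ m (defNet X f ε) (rep x ε) fun _ => v) := by
    refine ((hF.moderate x hx _ (rep_spec x) m).mul (moderate_const ρ ℝ (‖v‖ ^ m))).of_le
      (Eventually.of_forall fun ε => ?_)
    refine le_trans ?_ (Real.le_norm_self _)
    simpa using (iteratedFDeriv ℝ m (defNet X f ε) (rep x ε)).le_opNorm fun _ => v
  refine hmod.rep.of_negligible_sub
    (((hF.iteratedFDeriv_sub_negligible hx (rep_spec x) hxe m).mul_moderate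
      (moderate_const ρ ℝ (‖v‖ ^ m))).of_le (Eventually.of_forall fun ε => ?_))
  refine le_trans ?_ (Real.le_norm_self _)
  simpa using (iteratedFDeriv ℝ m (defNet X f ε) (xe ε) -
    iteratedFDeriv ℝ m (defNet X f ε) (rep x ε)).le_opNorm fun _ => v

theorem IsGSF.gderiv {X : Set (Gen ρ A)} {f : Gen ρ A → Gen ρ B} (hf : IsGSF X f) (v : A) :
    IsGSF X (gderiv X 1 v f) := by
  obtain ⟨Ω, hF⟩ := hf.defines
  refine ⟨Ω, fun ε x => fderiv ℝ (defNet X f ε) x v, hF.isOpen, fun ε => ?_, hF.subset,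
    fun x hx xe hxe => ?_, fun x hx xe hxe m => ?_⟩
  · exact ((hF.smooth ε).fderiv_of_isOpen (hF.isOpen ε) (m := ∞) (by simp)).clm_apply contDiffOn_const
  · simpa using hF.rep_iteratedFDeriv hx hxe 1 v
  · refine ((moderate_const ρ ℝ ‖v‖).mul (hF.moderate x hx xe hxe (m + 1))).of_le ?_
    filter_upwards [hF.subset x hx xe hxe] with ε hε
    rw [norm_norm]
    refine le_trans ?_ (Real.le_norm_self _)
    have h1 := ((hF.smooth ε).fderiv_of_isOpen (hF.isOpen ε) (m := ∞) (by simp)).contDiffAt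
      ((hF.isOpen ε).mem_nhds hε)
    have h2 := norm_iteratedFDeriv_clm_apply_const (n := m) (c := v) h1 (by exact_mod_cast le_top)
    rw [norm_iteratedFDeriv_fderiv] at h2
    exact h2

/-- Used to freeze one variable of `u`: composing with an affine line multiplies the `m`-th
derivative by at most `‖L‖^m`. -/
theorem isGSF_slice {X : Set (Gen ρ ℝ)} {Y : Set (Gen ρ (ℝ × ℝ))} {u : Gen ρ (ℝ × ℝ) → Gen ρ B}
    (hu : IsGSF Y u) (L : ℝ →L[ℝ] ℝ × ℝ) (ae : Idx → ℝ × ℝ) {φ : Gen ρ ℝ → Gen ρ (ℝ × ℝ)}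
    (hφ : ∀ x ∈ X, φ x ∈ Y) (hr : ∀ x ∈ X, ∀ xe, Rep x xe → Rep (φ x) (fun ε => ae ε + L (xe ε))) :
    IsGSF X (fun x => u (φ x)) := by
  obtain ⟨Ω, F, hF⟩ := hu
  have hc : ∀ ε, Continuous fun s => ae ε + L s := fun ε => by fun_prop
  refine ⟨fun ε => (fun s => ae ε + L s) ⁻¹' Ω ε, fun ε s => F ε (ae ε + L s),
    fun ε => (hF.isOpen ε).preimage (hc ε),
    fun ε => (hF.smooth ε).comp (contDiff_const.add L.contDiff).contDiffOn fun _ h => h,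
    fun x hx xe hxe => hF.subset _ (hφ x hx) _ (hr x hx xe hxe),
    fun x hx xe hxe => hF.value _ (hφ x hx) _ (hr x hx xe hxe), fun x hx xe hxe m => ?_⟩
  refine ((hF.moderate _ (hφ x hx) _ (hr x hx xe hxe) m).mul (moderate_const ρ ℝ (‖L‖ ^ m))).of_le ?_
  filter_upwards [hF.subset _ (hφ x hx) _ (hr x hx xe hxe)] with ε hε
  rw [norm_norm]
  refine le_trans ?_ (Real.le_norm_self _)
  simp only [Pi.mul_apply]
  -- The formula for derivatives of a composition with a linear map is applied to a globally smooth
  -- function, so `F ε` is replaced near the point.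
  obtain ⟨V, hV, hVe⟩ := exists_contDiff_eventuallyEq isClosed_singleton (hF.isOpen ε)
    (singleton_subset_iff.2 hε) (hF.smooth ε)
  have h1 : V =ᶠ[𝓝 (ae ε + L (xe ε))] F ε := hVe _ (mem_singleton _)
  have h2 : (fun s => F ε (ae ε + L s)) =ᶠ[𝓝 (xe ε)] (fun y => V (ae ε + y)) ∘ L :=
    ((hc ε).continuousAt.eventually h1).mono fun s hs => hs.symm
  rw [← (h1.iteratedFDeriv ℝ m).eq_of_nhds, (h2.iteratedFDeriv ℝ m).eq_of_nhds,
    L.iteratedFDeriv_comp_right (f := fun y => V (ae ε + y))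
      (hV.comp (contDiff_const.add contDiff_id)) _ (by exact_mod_cast le_top), iteratedFDeriv_comp_add_left]
  refine ((iteratedFDeriv ℝ m V _).norm_compContinuousLinearMap_le _).trans ?_
  simp

end GSF

/-! ### Generalized integrals -/

section Integral

variable {ρ : Gauge}

theorem IsGSF.continuousOn_segment {X : Set (Gen ρ ℝ)} {f : Gen ρ ℝ → Gen ρ ℂ} {Ω}
    (hF : Defines X f Ω (defNet X f)) {S : Idx → Set ℝ} (hS : NetsIn X S) :
    ∀ᶠ ε in atBot, ContinuousOn (defNet X f ε) (S ε) :=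
  (hS.defines_subset hF).mono fun ε h => (hF.smooth ε).continuousOn.mono h

/-- Changing the representative of an endpoint costs such an integral: a moderate integrand over a
negligible length. -/
theorem negligible_integral_of_rep {X : Set (Gen ρ ℝ)} {f : Gen ρ ℝ → Gen ρ ℂ} {Ω F}
    (hF : Defines X f Ω F) {a : Gen ρ ℝ} (ha : a ∈ X) {ae be : Idx → ℝ} (hae : Rep a ae)
    (hbe : Rep a be) : Negligible ρ ℂ (fun ε => ∫ s in ae ε..be ε, F ε s) := by
  have hS := netsIn_segment ha hae hbe
  obtain ⟨N, hN⟩ := hS.defines_moderate hF 0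
  refine ((moderate_inv_pow ρ N).mul_negligible (hbe.negligible_sub hae).norm).of_le ?_
  filter_upwards [hN] with ε h1
  refine le_trans ?_ (Real.le_norm_self _)
  refine intervalIntegral.norm_integral_le_of_norm_le_const fun s hs => ?_
  have := h1 s (by rw [segment_eq_uIcc]; exact uIoc_subset_uIcc hs)
  simpa using this

/-- The generalized integral is represented by the integrals of any net with the right values. -/
theorem gint_rep {X : Set (Gen ρ ℝ)} {f : Gen ρ ℝ → Gen ρ ℂ} (hf : IsGSF X f) {a b : Gen ρ ℝ}
    {ae be : Idx → ℝ} (ha : Rep a ae) (hb : Rep b be) (hX : NetsIn X fun ε => uIcc (ae ε) (be ε))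
    {F : Idx → ℝ → ℂ}
    (hF : ∀ x ∈ X, ∀ xe, Rep x xe → (∀ᶠ ε in atBot, xe ε ∈ uIcc (ae ε) (be ε)) →
      Rep (f x) (fun ε => F ε (xe ε)))
    (hint : ∀ᶠ ε in atBot, IntervalIntegrable (F ε) MeasureTheory.volume (ae ε) (be ε)) :
    Rep (gint X f a b) (fun ε => ∫ s in ae ε..be ε, F ε s) := by
  obtain ⟨Ω, hG⟩ := hf.defines
  have haX : a ∈ X := by
    obtain ⟨x, hx, hxe⟩ := hX.2 ae (Eventually.of_forall fun ε => left_mem_uIcc)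
    exact ha.eq hxe ▸ hx
  have hbX : b ∈ X := by
    obtain ⟨x, hx, hxe⟩ := hX.2 be (Eventually.of_forall fun ε => right_mem_uIcc)
    exact hb.eq hxe ▸ hx
  have hmod : Moderate ρ ℂ (fun ε => ∫ s in ae ε..be ε, F ε s) := by
    obtain ⟨N, hN⟩ := uniform_moderate (ρ := ρ) hX.1 (Q := fun ε y => ‖F ε y‖) fun ye hye => by
      obtain ⟨x, hx, hxe⟩ := hX.2 ye hye
      exact (hF x hx ye hxe hye).1.norm
    refine ((moderate_inv_pow ρ N).mul (hb.1.sub ha.1).norm).of_le ?_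
    filter_upwards [hN] with ε h1
    refine le_trans ?_ (Real.le_norm_self _)
    refine intervalIntegral.norm_integral_le_of_norm_le_const fun s hs => ?_
    simpa using h1 s (uIoc_subset_uIcc hs)
  -- The integrands differ negligibly along every net, hence uniformly; the exponent `M + n` leaves
  -- room for the interval length `ρ^(-M)`.
  have hdiff : Negligible ρ ℂ (fun ε => ∫ s in ae ε..be ε, (F ε s - defNet X f ε s)) := by
    intro n
    obtain ⟨M, hM⟩ := (hb.1.sub ha.1)
    have h1 := uniform_eventually hX.1 (P := fun ε y => ‖F ε y - defNet X f ε y‖ ≤ ρ.net ε ^ (M + n))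
      fun ye hye => by
        obtain ⟨x, hx, hxe⟩ := hX.2 ye hye
        exact (hF x hx ye hxe hye).negligible_sub (hG.value x hx ye hxe) (M + n)
    filter_upwards [h1, hM] with ε h1 h2
    refine (intervalIntegral.norm_integral_le_of_norm_le_const fun s hs =>
      h1 s (uIoc_subset_uIcc hs)).trans ?_
    have hp := pow_pos (ρ.pos ε) M
    calc ρ.net ε ^ (M + n) * |be ε - ae ε| ≤ ρ.net ε ^ (M + n) * (ρ.net ε ^ M)⁻¹ := by
          gcongr
          · exact (pow_pos (ρ.pos ε) _).le
          · exact h2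
      _ = ρ.net ε ^ n := by rw [pow_add]; field_simp
  have h1 := negligible_integral_of_rep hG haX (rep_spec a) ha
  have h2 := negligible_integral_of_rep hG hbX hb (rep_spec b)
  -- Go from `rep a` to `rep b` through `ae` and `be`; only the middle piece is not negligible.
  have heq : ∀ᶠ ε in atBot, (∫ s in rep a ε..rep b ε, defNet X f ε s) =
      (∫ s in rep a ε..ae ε, defNet X f ε s) + (∫ s in be ε..rep b ε, defNet X f ε s)
      + ((∫ s in ae ε..be ε, F ε s) - ∫ s in ae ε..be ε, (F ε s - defNet X f ε s)) := by
    filter_upwards [hint, IsGSF.continuousOn_segment hG hX,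
      IsGSF.continuousOn_segment hG (netsIn_segment haX (rep_spec a) ha),
      IsGSF.continuousOn_segment hG (netsIn_segment hbX hb (rep_spec b))] with ε h1 h2 h3 h4
    rw [segment_eq_uIcc] at h3 h4
    rw [intervalIntegral.integral_sub h1 h2.intervalIntegrable,
      ← intervalIntegral.integral_add_adjacent_intervals
        (h3.intervalIntegrable.trans h2.intervalIntegrable) h4.intervalIntegrable,
      ← intervalIntegral.integral_add_adjacent_intervals h3.intervalIntegrable h2.intervalIntegrable]
    ring
  have hneg : Negligible ρ ℂ fun ε => (∫ s in rep a ε..rep b ε, defNet X f ε s) -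
      ∫ s in ae ε..be ε, F ε s := by
    refine ((h1.add h2).sub hdiff).of_le ?_
    filter_upwards [heq] with ε h
    rw [h]
    apply le_of_eq
    congr 1
    simp only [Pi.sub_apply, Pi.add_apply]
    ring
  have hm2 : Moderate ρ ℂ fun ε => ∫ s in rep a ε..rep b ε, defNet X f ε s := by
    refine (hneg.moderate.add hmod).of_le (Eventually.of_forall fun ε => ?_)
    simp
  have h3 := hm2.rep.of_negligible_sub (hneg.neg.of_le (Eventually.of_forall fun ε => by
    rw [Pi.neg_apply, neg_sub]; rfl))
  exact h3

/-- On intervals on which it is defined, a generalized smooth function is integrated by its net. -/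
theorem gint_rep_defNet {X : Set (Gen ρ ℝ)} {f : Gen ρ ℝ → Gen ρ ℂ} (hf : IsGSF X f) {a b : Gen ρ ℝ}
    {ae be : Idx → ℝ} (ha : Rep a ae) (hb : Rep b be) (hX : NetsIn X fun ε => uIcc (ae ε) (be ε)) :
    Rep (gint X f a b) (fun ε => ∫ s in ae ε..be ε, defNet X f ε s) := by
  obtain ⟨Ω, hG⟩ := hf.defines
  exact gint_rep hf ha hb hX (fun x hx xe hxe _ => hG.value x hx xe hxe)
    ((IsGSF.continuousOn_segment hG hX).mono fun ε h => h.intervalIntegrable)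

variable {X : Set (Gen ρ ℝ)} {f g : Gen ρ ℝ → Gen ρ ℂ} {a b : Gen ρ ℝ} {ae be : Idx → ℝ}

theorem gint_congr (hf : IsGSF X f) (ha : Rep a ae) (hb : Rep b be)
    (hX : NetsIn X fun ε => uIcc (ae ε) (be ε)) (h : ∀ x ∈ X, f x = g x) :
    gint X f a b = gint X g a b := by
  obtain ⟨Ω, hF⟩ := hf.defines
  refine (gint_rep_defNet hf ha hb hX).eq (gint_rep (hf.congr fun x hx => (h x hx).symm) ha hb hX
    (fun x hx xe hxe _ => h x hx ▸ hF.value x hx xe hxe)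
    ((IsGSF.continuousOn_segment hF hX).mono fun ε h => h.intervalIntegrable))

theorem gint_add (hf : IsGSF X f) (hg : IsGSF X g) (ha : Rep a ae) (hb : Rep b be)
    (hX : NetsIn X fun ε => uIcc (ae ε) (be ε)) :
    gint X (fun x => f x + g x) a b = gint X f a b + gint X g a b := by
  obtain ⟨Ω, hF⟩ := hf.defines
  obtain ⟨Ω', hG⟩ := hg.defines
  have h1 := IsGSF.continuousOn_segment hF hX
  have h2 := IsGSF.continuousOn_segment hG hX
  have h3 := gint_rep (hf.add hg) ha hb hX
    (fun x hx xe hxe _ => (hF.value x hx xe hxe).add (hG.value x hx xe hxe))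
    (h1.mp (h2.mono fun ε h2 h1 => (h1.add h2).intervalIntegrable))
  refine h3.eq (((gint_rep_defNet hf ha hb hX).add (gint_rep_defNet hg ha hb hX)).congr ?_)
  filter_upwards [h1, h2] with ε h1 h2
  exact intervalIntegral.integral_add h1.intervalIntegrable h2.intervalIntegrable

theorem gint_const_mul (z : Gen ρ ℂ) (hf : IsGSF X f) (ha : Rep a ae) (hb : Rep b be)
    (hX : NetsIn X fun ε => uIcc (ae ε) (be ε)) :
    gint X (fun x => z * f x) a b = z * gint X f a b := by
  obtain ⟨Ω, hF⟩ := hf.defines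
  have h1 := IsGSF.continuousOn_segment hF hX
  have h3 := gint_rep ((isGSF_const X z).mul hf) ha hb hX
    (fun x hx xe hxe _ => (rep_spec z).mul (hF.value x hx xe hxe))
    (h1.mono fun ε h1 => (continuousOn_const.mul h1).intervalIntegrable)
  refine h3.eq (((rep_spec z).mul (gint_rep_defNet hf ha hb hX)).congr ?_)
  exact Eventually.of_forall fun ε => intervalIntegral.integral_const_mul _ _

theorem isGSF_gint_mul_map (hf : IsGSF X f) (ha : Rep a ae) (hb : Rep b be)
    (hX : NetsIn X fun ε => uIcc (ae ε) (be ε)) {φ : ℝ → ℂ} (hφ : Tame φ)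
    (hφ0 : ∃ C : ℝ, ∀ x, ‖φ x‖ ≤ C) (c : Gen ρ ℝ) (Y : Set (Gen ρ ℝ)) :
    IsGSF Y (fun w => gint X (fun s => f s * map φ (c * w * s)) a b) := by
  classical
  obtain ⟨Ω, hF⟩ := hf.defines
  have h1 := IsGSF.continuousOn_segment hF hX
  -- A defining net must be smooth at every index, whereas the integrand is known to be continuous
  -- only for small ones; the others get `0`.
  let F : Idx → ℝ → ℂ := fun ε => if ContinuousOn (defNet X f ε) (uIcc (ae ε) (be ε)) then
    defNet X f ε else 0
  have hFc : ∀ ε, ContinuousOn (F ε) (uIcc (ae ε) (be ε)) := fun ε => by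
    by_cases h : ContinuousOn (defNet X f ε) (uIcc (ae ε) (be ε))
    · simp only [F, if_pos h]; exact h
    · simp only [F, if_neg h]; exact continuousOn_const
  have hFe : ∀ᶠ ε in atBot, F ε = defNet X f ε := h1.mono fun ε h => if_pos h
  have hbound : ∀ m, ∃ C : ℝ, ∀ x, ‖iteratedDeriv m φ x‖ ≤ C := fun m => by
    rcases Nat.eq_zero_or_pos m with rfl | hm
    · simpa using hφ0
    · exact hφ.bound m hm
  refine ⟨fun _ => univ, fun ε w => ∫ s in ae ε..be ε, F ε s * φ (rep c ε * w * s),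
    fun _ => isOpen_univ, fun ε => (contDiff_integral_mul_comp (hFc ε) hφ).contDiffOn,
    fun _ _ _ _ => Eventually.of_forall fun _ => mem_univ _, fun w hw we hwe => ?_,
    fun w hw we hwe m => ?_⟩
  · refine gint_rep (hf.mul (isGSF_map_mul hφ _ X)) ha hb hX (fun x hx xe hxe _ => ?_)
      (Eventually.of_forall fun ε => ((hFc ε).mul ?_).intervalIntegrable)
    · refine ((hF.value x hx xe hxe).mul
        (hφ.rep_map (((rep_spec c).mul hwe).mul hxe))).congr ?_
      exact hFe.mono fun ε h => by rw [h]
    · exact (hφ.contDiff.continuous.comp (by fun_prop)).continuousOn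
  · obtain ⟨C, hC⟩ := hbound m
    obtain ⟨N, hN⟩ := hX.defines_moderate hF 0
    have hC0 : 0 ≤ C := (norm_nonneg _).trans (hC 0)
    have hmod := (((moderate_inv_pow ρ N).mul
      (((rep_spec c).1.norm.mul (ha.1.norm.add hb.1.norm)).pow m)).mul
        (moderate_const ρ ℝ C)).mul (hb.1.sub ha.1).norm
    refine hmod.of_le ?_
    filter_upwards [hN, hFe] with ε h1 h2
    rw [norm_norm, norm_iteratedFDeriv_eq_norm_iteratedDeriv,
      iteratedDeriv_integral_mul_comp (hFc ε) hφ]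
    refine le_trans ?_ (Real.le_norm_self _)
    refine intervalIntegral.norm_integral_le_of_norm_le_const fun s hs => ?_
    have hs' := uIoc_subset_uIcc hs
    have h3 := h1 s hs'
    rw [norm_iteratedFDeriv_zero] at h3
    have h4 : |s| ≤ |ae ε| + |be ε| := by
      rw [abs_le]
      rcases mem_uIcc.1 hs' with h | h <;> constructor <;>
      linarith [neg_abs_le (ae ε), neg_abs_le (be ε), le_abs_self (ae ε), le_abs_self (be ε),
        abs_nonneg (ae ε), abs_nonneg (be ε)]
    have hp : 0 ≤ (ρ.net ε ^ N)⁻¹ := inv_nonneg.2 (pow_pos (ρ.pos ε) N).le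
    rw [norm_mul, norm_mul, Complex.norm_real, norm_pow, norm_mul, h2]
    simp only [Pi.mul_apply, Pi.add_apply, Real.norm_eq_abs]
    gcongr
    exact hC _

end Integral

open MeasureTheory

/-! ### The sine integral and its rate of convergence -/

section SineIntegral

/-- The normalized sine integral `r ↦ π⁻¹ ∫_0^r sin s / s ds`. -/
noncomputable def sineInt (r : ℝ) : ℝ := Real.pi⁻¹ * ∫ s in (0 : ℝ)..r, Real.sinc s

theorem hasDerivAt_sineInt (r : ℝ) : HasDerivAt sineInt (Real.pi⁻¹ * Real.sinc r) r :=
  (intervalIntegral.integral_hasDerivAt_right (Real.continuous_sinc.intervalIntegrable _ _)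
    (Real.continuous_sinc.stronglyMeasurableAtFilter _ _)
    Real.continuous_sinc.continuousAt).const_mul _

theorem continuous_sineInt : Continuous sineInt :=
  continuous_iff_continuousAt.2 fun r => (hasDerivAt_sineInt r).continuousAt

theorem sineInt_zero : sineInt 0 = 0 := by simp [sineInt]

theorem sineInt_neg (r : ℝ) : sineInt (-r) = -sineInt r := by
  have h := intervalIntegral.integral_comp_neg (a := 0) (b := r) Real.sinc
  simp only [Real.sinc_neg, neg_zero] at h
  rw [sineInt, sineInt, h, intervalIntegral.integral_symm]
  ring

/-- The Laplace kernel of the complementary sine integral. -/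
noncomputable def sineKernel (R t : ℝ) : ℝ := Real.exp (-R * t) * (t * Real.sin R + Real.cos R) * (1 + t ^ 2)⁻¹

theorem continuous_sineKernel (R : ℝ) : Continuous (sineKernel R) := by
  unfold sineKernel
  have : ∀ t : ℝ, 1 + t ^ 2 ≠ 0 := fun t => by positivity
  fun_prop (disch := exact this _)

/-- The factor `1 + t²` cancels on differentiating. What remains integrates over `t > 0` to `-sin R
/ R`, the negative of the derivative of the sine integral. -/
theorem hasDerivAt_sineKernel (R t : ℝ) :
    HasDerivAt (fun R => sineKernel R t) (-Real.sin R * Real.exp (-R * t)) R := by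
  have h1 : HasDerivAt (fun R : ℝ => Real.exp (-R * t)) (Real.exp (-R * t) * (-t)) R := by
    have : HasDerivAt (fun R : ℝ => -R * t) (-t) R := by
      simpa using ((hasDerivAt_id R).neg).mul_const t
    exact this.exp
  have h2 : HasDerivAt (fun R : ℝ => t * Real.sin R + Real.cos R) (t * Real.cos R + -Real.sin R) R :=
    ((Real.hasDerivAt_sin R).const_mul t).add (Real.hasDerivAt_cos R)
  refine ((h1.mul h2).mul_const ((1 + t ^ 2)⁻¹)).congr_deriv ?_
  have : 1 + t ^ 2 ≠ 0 := by positivity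
  field_simp
  ring

/-- By Cauchy–Schwarz, `(t sin R + cos R)² ≤ 1 + t² ≤ (1 + t²)²`. -/
theorem abs_sineKernel_le (R : ℝ) {t : ℝ} : |sineKernel R t| ≤ Real.exp (-R * t) := by
  have hp : 0 < 1 + t ^ 2 := by positivity
  have h1 : |t * Real.sin R + Real.cos R| ≤ 1 + t ^ 2 := by
    refine abs_le_of_sq_le_sq ?_ hp.le
    have := Real.sin_sq_add_cos_sq R
    nlinarith [sq_nonneg (t * Real.cos R - Real.sin R), sq_nonneg t]
  rw [sineKernel, abs_mul, abs_mul, Real.abs_exp, abs_inv, abs_of_pos hp, mul_assoc]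
  calc Real.exp (-R * t) * (|t * Real.sin R + Real.cos R| * (1 + t ^ 2)⁻¹)
      ≤ Real.exp (-R * t) * ((1 + t ^ 2) * (1 + t ^ 2)⁻¹) := by gcongr
    _ = _ := by rw [mul_inv_cancel₀ hp.ne', mul_one]

theorem integral_exp_neg_mul_Ioi {R : ℝ} (hR : 0 < R) : ∫ t in Ioi (0 : ℝ), Real.exp (-R * t) = R⁻¹ := by
  have h := integral_comp_mul_left_Ioi (fun x => Real.exp (-x)) 0 hR
  simp only [mul_zero, integral_exp_neg_Ioi_zero, smul_eq_mul, mul_one] at h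
  simpa only [neg_mul] using h

theorem integrableOn_sineKernel {R : ℝ} (hR : 0 < R) : IntegrableOn (sineKernel R) (Ioi 0) :=
  (integrableOn_exp_mul_Ioi (neg_lt_zero.2 hR) 0).mono'
    (continuous_sineKernel R).aestronglyMeasurable
    (Eventually.of_forall fun t => abs_sineKernel_le R)

theorem hasDerivAt_integral_sineKernel {R : ℝ} (hR : 0 < R) :
    HasDerivAt (fun R => ∫ t in Ioi (0 : ℝ), sineKernel R t) (-Real.sinc R) R := by
  have h := (hasDerivAt_integral_of_dominated_loc_of_deriv_le (μ := volume.restrict (Ioi (0 : ℝ)))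
    (F := sineKernel) (F' := fun R t => -Real.sin R * Real.exp (-R * t))
    (s := Ioi (R / 2)) (bound := fun t => Real.exp (-(R / 2) * t)) (Ioi_mem_nhds (by linarith))
    (Eventually.of_forall fun R => (continuous_sineKernel R).aestronglyMeasurable)
    (integrableOn_sineKernel hR) (by fun_prop) ?_
    (integrableOn_exp_mul_Ioi (by linarith) 0)
    (Eventually.of_forall fun t R _ => hasDerivAt_sineKernel R t)).2
  · refine h.congr_deriv ?_
    rw [integral_const_mul, integral_exp_neg_mul_Ioi hR, Real.sinc_of_ne_zero hR.ne']
    ring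
  · filter_upwards [ae_restrict_mem measurableSet_Ioi] with t ht r hr
    rw [norm_mul, norm_neg, Real.norm_eq_abs, Real.norm_eq_abs, Real.abs_exp]
    have ht' : 0 < t := ht
    have hr' : R / 2 < r := hr
    calc |Real.sin r| * Real.exp (-r * t) ≤ 1 * Real.exp (-(R / 2) * t) := by
          gcongr
          exact Real.abs_sin_le_one r
      _ = _ := one_mul _

theorem tendsto_integral_sineKernel :
    Tendsto (fun R => ∫ t in Ioi (0 : ℝ), sineKernel R t) (𝓝[>] 0) (𝓝 (Real.pi / 2)) := by
  have h0 : ∫ t in Ioi (0 : ℝ), sineKernel 0 t = Real.pi / 2 := by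
    simp [sineKernel]
  rw [← h0]
  refine tendsto_integral_filter_of_dominated_convergence (fun t => 2 * (1 + t ^ 2)⁻¹)
    (Eventually.of_forall fun R => (continuous_sineKernel R).aestronglyMeasurable) ?_
    (integrable_inv_one_add_sq.integrableOn.const_mul 2) ?_
  · filter_upwards [self_mem_nhdsWithin] with R hR
    filter_upwards [ae_restrict_mem measurableSet_Ioi] with t ht
    have ht' : 0 < t := ht
    have hR' : 0 < R := hR
    rw [sineKernel, norm_mul, norm_mul, Real.norm_eq_abs, Real.norm_eq_abs, Real.norm_eq_abs,
      Real.abs_exp, abs_of_pos (show 0 < (1 + t ^ 2)⁻¹ by positivity)]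
    gcongr
    -- With `tR + 1 ≤ e^{tR}` this bounds the numerator uniformly in `R`, so that `(1 + t²)⁻¹`, up
    -- to a constant, dominates as `R → 0`.
    have h1 : |t * Real.sin R + Real.cos R| ≤ t * R + 1 := by
      refine (abs_add_le _ _).trans (add_le_add ?_ (Real.abs_cos_le_one R))
      rw [abs_mul, abs_of_pos ht']
      gcongr
      have := Real.abs_sin_le_abs (x := R)
      rwa [abs_of_pos hR'] at this
    have h2 : t * R + 1 ≤ Real.exp (t * R) := Real.add_one_le_exp _
    have h3 : Real.exp (-R * t) * Real.exp (t * R) = 1 := by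
      rw [← Real.exp_add]; simp [mul_comm]
    nlinarith [Real.exp_pos (-R * t)]
  · refine Eventually.of_forall fun t => ?_
    exact (hasDerivAt_sineKernel 0 t).continuousAt.tendsto.mono_left nhdsWithin_le_nhds

/-- The sum of the sine integral and the Laplace integral has zero derivative on `(0, ∞)`, and its
limit at `0` is `π/2`. This gives both the limit of the sine integral and its remainder. -/
theorem pi_mul_sineInt {R : ℝ} (hR : 0 < R) :
    Real.pi * sineInt R = Real.pi / 2 - ∫ t in Ioi (0 : ℝ), sineKernel R t := by
  have hder : ∀ R ∈ Ioi (0 : ℝ), HasDerivAt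
      (fun R => Real.pi * sineInt R + ∫ t in Ioi (0 : ℝ), sineKernel R t) 0 R := by
    intro R hR
    refine (((hasDerivAt_sineInt R).const_mul Real.pi).add
      (hasDerivAt_integral_sineKernel hR)).congr_deriv ?_
    have := Real.pi_ne_zero
    field_simp
    ring
  obtain ⟨a, ha⟩ := isOpen_Ioi.exists_is_const_of_deriv_eq_zero (isPreconnected_Ioi (a := (0 : ℝ)))
    (fun R hR => (hder R hR).differentiableAt.differentiableWithinAt)
    (fun R hR => (hder R hR).deriv)
  have hlim : Tendsto (fun R => Real.pi * sineInt R + ∫ t in Ioi (0 : ℝ), sineKernel R t)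
      (𝓝[>] 0) (𝓝 (Real.pi * 0 + Real.pi / 2)) := by
    refine Tendsto.add (Tendsto.const_mul _ ?_) tendsto_integral_sineKernel
    have h := continuous_sineInt.tendsto 0
    rw [sineInt_zero] at h
    exact h.mono_left nhdsWithin_le_nhds
  have hconst : Tendsto (fun R => Real.pi * sineInt R + ∫ t in Ioi (0 : ℝ), sineKernel R t)
      (𝓝[>] 0) (𝓝 a) :=
    tendsto_const_nhds.congr' (by filter_upwards [self_mem_nhdsWithin] with R hR using (ha R hR).symm)
  have h1 := tendsto_nhds_unique hlim hconst
  have h2 := ha R hR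
  linarith

theorem abs_sineInt_sub_half_le {R : ℝ} (hR : 0 < R) : |sineInt R - 1 / 2| ≤ min 1 R⁻¹ := by
  have hpi := Real.pi_gt_three
  have h1 := pi_mul_sineInt hR
  have h2 : |∫ t in Ioi (0 : ℝ), sineKernel R t| ≤ R⁻¹ := by
    rw [← integral_exp_neg_mul_Ioi hR]
    exact norm_integral_le_of_norm_le (f := sineKernel R) (integrableOn_exp_mul_Ioi (neg_lt_zero.2 hR) 0)
      (Eventually.of_forall fun t => abs_sineKernel_le R)
  have h3 : |sineInt R - 1 / 2| ≤ R⁻¹ / 3 := by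
    have : Real.pi * (sineInt R - 1 / 2) = -∫ t in Ioi (0 : ℝ), sineKernel R t := by linarith
    have h4 : Real.pi * |sineInt R - 1 / 2| ≤ R⁻¹ := by
      rw [← abs_of_pos Real.pi_pos, ← abs_mul, this, abs_neg]; exact h2
    have := mul_le_mul_of_nonneg_right hpi.le (abs_nonneg (sineInt R - 1 / 2))
    linarith
  have hRi : 0 < R⁻¹ := inv_pos.2 hR
  refine le_min ?_ (by linarith)
  -- For `R ≥ 1` the decay bound is already below `1`. For `R ≤ 1` the integrand is at most `1`, so
  -- the normalized integral is at most `π⁻¹ ≤ 1/3`.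
  rcases le_total 1 R with h | h
  · have := inv_le_one_of_one_le₀ h
    linarith
  · have h4 : |∫ s in (0 : ℝ)..R, Real.sinc s| ≤ 1 := by
      have := intervalIntegral.norm_integral_le_of_norm_le_const (a := 0) (b := R) (f := Real.sinc)
        (C := 1) (fun s _ => Real.abs_sinc_le_one s)
      rw [sub_zero, abs_of_pos hR] at this
      exact this.trans (by linarith)
    have h5 : |sineInt R| ≤ 1 / 3 := by
      rw [sineInt, abs_mul, abs_of_pos (inv_pos.2 Real.pi_pos)]
      have : Real.pi⁻¹ ≤ 1 / 3 := by
        rw [one_div]; exact inv_anti₀ (by norm_num) hpi.le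
      calc Real.pi⁻¹ * |∫ s in (0 : ℝ)..R, Real.sinc s| ≤ 1 / 3 * 1 := by gcongr
        _ = _ := by norm_num
    rw [abs_le] at h5 ⊢
    constructor <;> linarith

theorem abs_sineInt_sub_sign_le (r : ℝ) : |sineInt r - SignType.sign r / 2| ≤ 1 ∧
    (r ≠ 0 → |sineInt r - SignType.sign r / 2| ≤ |r|⁻¹) := by
  rcases lt_trichotomy r 0 with h | rfl | h
  · have h1 := abs_sineInt_sub_half_le (neg_pos.2 h)
    rw [sineInt_neg] at h1
    have h2 : |sineInt r - SignType.sign r / 2| = |-sineInt r - 1 / 2| := by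
      rw [sign_neg h, ← abs_neg]
      congr 1
      simp only [SignType.coe_neg_one]
      ring
    rw [h2, abs_of_neg h]
    exact ⟨h1.trans (min_le_left _ _), fun _ => h1.trans (min_le_right _ _)⟩
  · simp [sineInt_zero]
  · have h1 := abs_sineInt_sub_half_le h
    have h2 : sineInt r - SignType.sign r / 2 = sineInt r - 1 / 2 := by
      rw [sign_pos h]; simp
    rw [h2, abs_of_pos h]
    exact ⟨h1.trans (min_le_left _ _), fun _ => h1.trans (min_le_right _ _)⟩

end SineIntegral

/-! ### Closed forms of the frequency integrals -/

section Kernel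

/-- Averaging the integral with its reflection under `w ↦ -w` turns the exponential into a cosine.
-/
theorem integral_exp_mul_even {f : ℝ → ℝ} (hf : Continuous f) (hev : ∀ w, f (-w) = f w) (h r : ℝ) :
    ∫ w in (-h)..h, (f w : ℂ) * Complex.exp (((r * w : ℝ) : ℂ) * Complex.I) =
      ((∫ w in (-h)..h, f w * Real.cos (r * w) : ℝ) : ℂ) := by
  have hc : Continuous fun w : ℝ => (f w : ℂ) * Complex.exp (((r * w : ℝ) : ℂ) * Complex.I) := by
    fun_prop
  have h1 := intervalIntegral.integral_comp_neg (a := -h) (b := h)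
    (fun w : ℝ => (f w : ℂ) * Complex.exp (((r * w : ℝ) : ℂ) * Complex.I))
  rw [neg_neg] at h1
  have h2 : (∫ w in (-h)..h, (f w : ℂ) * Complex.exp (((r * w : ℝ) : ℂ) * Complex.I)) +
      (∫ w in (-h)..h, (f w : ℂ) * Complex.exp (((r * w : ℝ) : ℂ) * Complex.I)) =
      2 * ∫ w in (-h)..h, ((f w * Real.cos (r * w) : ℝ) : ℂ) := by
    nth_rewrite 1 [← h1]
    rw [← intervalIntegral.integral_add
        (Continuous.intervalIntegrable (by fun_prop) _ _) (hc.intervalIntegrable _ _),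
      ← intervalIntegral.integral_const_mul]
    congr 1
    ext w
    simp only [hev]
    push_cast
    rw [Complex.cos]
    ring_nf
  rw [← intervalIntegral.integral_ofReal]
  linear_combination h2 / 2

theorem integral_mul_sinc (a h : ℝ) :
    ∫ w in (-h)..h, a * Real.sinc (a * w) = 2 * Real.pi * sineInt (h * a) := by
  rw [intervalIntegral.integral_const_mul, intervalIntegral.mul_integral_comp_mul_left]
  have h1 := intervalIntegral.integral_comp_neg (a := 0) (b := a * h) Real.sinc
  simp only [Real.sinc_neg, neg_zero] at h1
  rw [← intervalIntegral.integral_add_adjacent_intervals (b := 0)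
    (Real.continuous_sinc.intervalIntegrable _ _) (Real.continuous_sinc.intervalIntegrable _ _),
    mul_neg, ← h1, sineInt, mul_comm h a]
  have := Real.pi_ne_zero
  field_simp
  ring

theorem integral_exp_eq_sinc (h r : ℝ) :
    ∫ w in (-h)..h, Complex.exp (((r * w : ℝ) : ℂ) * Complex.I) =
      ((2 * h * Real.sinc (h * r) : ℝ) : ℂ) := by
  have h1 := integral_exp_mul_even (f := fun _ => 1) continuous_const (fun _ => rfl) h r
  simp only [Complex.ofReal_one, one_mul] at h1
  rw [h1]
  congr 1
  by_cases hr : r = 0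
  · subst hr; simp; ring
  by_cases hh : h = 0
  · subst hh; simp
  rw [Real.sinc_of_ne_zero (mul_ne_zero hh hr)]
  have h2 := intervalIntegral.mul_integral_comp_mul_left (a := -h) (b := h) (f := Real.cos) r
  rw [integral_cos, mul_neg, Real.sin_neg] at h2
  rw [mul_comm h r] at *
  field_simp
  linarith

/-- This is the product-to-sum formula for `sin(ctw) cos(rw)` divided by `cw`. It is d'Alembert's
splitting into waves travelling at speeds `±c`, seen in frequency. -/
theorem sinc_mul_cos {c : ℝ} (hc : c ≠ 0) (t r w : ℝ) :
    t * Real.sinc (c * w * t) * Real.cos (r * w) =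
      (2 * c)⁻¹ * ((r + c * t) * Real.sinc ((r + c * t) * w) - (r - c * t) * Real.sinc ((r - c * t) * w)) := by
  by_cases hw : w = 0
  · subst hw; simp; field_simp; ring
  have key : ∀ a : ℝ, a * Real.sinc (a * w) = Real.sin (a * w) / w := fun a => by
    by_cases ha : a = 0
    · subst ha; simp
    rw [Real.sinc_of_ne_zero (mul_ne_zero ha hw)]
    field_simp
  have h1 := key (c * t)
  rw [key, key, show c * w * t = c * t * w by ring]
  have h2 : t * Real.sinc (c * t * w) = c⁻¹ * (Real.sin (c * t * w) / w) := by
    rw [← h1]; field_simp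
  rw [h2, show (r + c * t) * w = r * w + c * t * w by ring,
    show (r - c * t) * w = r * w - c * t * w by ring, Real.sin_add, Real.sin_sub]
  field_simp
  ring

theorem integral_sinc_mul_exp {c : ℝ} (hc : c ≠ 0) (h t r : ℝ) :
    ∫ w in (-h)..h, ((t * Real.sinc (c * w * t) : ℝ) : ℂ) * Complex.exp (((r * w : ℝ) : ℂ) * Complex.I)
      = ((Real.pi / c * (sineInt (h * (r + c * t)) - sineInt (h * (r - c * t))) : ℝ) : ℂ) := by
  rw [integral_exp_mul_even (f := fun w => t * Real.sinc (c * w * t))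
    (continuous_const.mul (Real.continuous_sinc.comp (by fun_prop)))
    (fun w => by rw [mul_neg, neg_mul, Real.sinc_neg])]
  congr 1
  simp only [sinc_mul_cos hc]
  have hi : ∀ a : ℝ, IntervalIntegrable (fun w => a * Real.sinc (a * w)) volume (-h) h := fun a =>
    (continuous_const.mul (Real.continuous_sinc.comp (by fun_prop))).intervalIntegrable _ _
  rw [intervalIntegral.integral_const_mul, intervalIntegral.integral_sub (hi _) (hi _),
    integral_mul_sinc, integral_mul_sinc]
  field_simp

/-- Fubini for inverse transforms of hyperfinite transforms. -/
theorem integral_mul_integral_exp_swap {κ V : ℝ → ℂ} (hκ : Continuous κ) {h k y : ℝ}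
    (hV : ContinuousOn V (uIcc (-k) k)) :
    ∫ w in (-h)..h, κ w * (∫ z in (-k)..k, V z * Complex.exp (((-1 * w * z : ℝ) : ℂ) * Complex.I)) *
        Complex.exp (((y * w : ℝ) : ℂ) * Complex.I) =
      ∫ z in (-k)..k, V z * ∫ w in (-h)..h, κ w * Complex.exp ((((y - z) * w : ℝ) : ℂ) * Complex.I) := by
  have h1 : ∀ w z : ℝ, κ w * (V z * Complex.exp (((-1 * w * z : ℝ) : ℂ) * Complex.I)) *
      Complex.exp (((y * w : ℝ) : ℂ) * Complex.I) =
      V z * (κ w * Complex.exp ((((y - z) * w : ℝ) : ℂ) * Complex.I)) := fun w z => by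
    have : Complex.exp ((((y - z) * w : ℝ) : ℂ) * Complex.I) =
        Complex.exp (((-1 * w * z : ℝ) : ℂ) * Complex.I) * Complex.exp (((y * w : ℝ) : ℂ) * Complex.I) := by
      rw [← Complex.exp_add]
      congr 1
      push_cast
      ring
    rw [this]; ring
  simp only [← intervalIntegral.integral_const_mul, ← intervalIntegral.integral_mul_const, h1]
  refine intervalIntegral_intervalIntegral_swap ?_
  have hcont : ContinuousOn (Function.uncurry fun w z : ℝ =>
      V z * (κ w * Complex.exp ((((y - z) * w : ℝ) : ℂ) * Complex.I))) (uIcc (-h) h ×ˢ uIcc (-k) k) := by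
    have h2 : ContinuousOn (fun p : ℝ × ℝ => V p.2) (uIcc (-h) h ×ˢ uIcc (-k) k) :=
      hV.comp continuousOn_snd fun p hp => hp.2
    have h3 : Continuous fun p : ℝ × ℝ =>
        κ p.1 * Complex.exp ((((y - p.2) * p.1 : ℝ) : ℂ) * Complex.I) := by fun_prop
    exact h2.mul h3.continuousOn
  exact (hcont.integrableOn_compact (isCompact_uIcc.prod isCompact_uIcc)).mono_set
    (prod_mono uIoc_subset_uIcc uIoc_subset_uIcc)

end Kernel

/-! ### Dirichlet integrals with explicit error -/

section Dirichlet

/-- The projection of `y` onto `[-k, k]`. -/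
noncomputable def clipReal (k y : ℝ) : ℝ := max (-k) (min y k)

theorem clipReal_mem {k : ℝ} (hk : 0 ≤ k) (y : ℝ) : clipReal k y ∈ Icc (-k) k :=
  ⟨le_max_left _ _, max_le (by linarith) (min_le_right _ _)⟩

theorem clipReal_of_mem {k y : ℝ} (h : |y| ≤ k) : clipReal k y = y := by
  rw [abs_le] at h
  rw [clipReal, min_eq_left h.2, max_eq_right h.1]

theorem clipReal_of_ge {k y : ℝ} (hk : 0 ≤ k) (h : k ≤ y) : clipReal k y = k := by
  rw [clipReal, min_eq_right h, max_eq_right (by linarith)]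

theorem clipReal_of_le {k y : ℝ} (h : y ≤ -k) : clipReal k y = -k := by
  rw [clipReal, max_eq_left ((min_le_left _ _).trans h)]

theorem le_of_le_clipReal {k a z : ℝ} (h1 : -k < z) (h2 : z ≤ clipReal k a) : z ≤ a := by
  rcases le_max_iff.1 h2 with h | h
  · exact absurd h1 (not_lt.2 h)
  · exact h.trans (min_le_left _ _)

theorem le_of_clipReal_lt {k a z : ℝ} (h1 : z ≤ k) (h2 : clipReal k a < z) : a ≤ z := by
  have h := (max_lt_iff.1 h2).2
  rcases min_lt_iff.1 h with h | h
  · exact h.le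
  · exact absurd h1 (not_le.2 h)

theorem integral_indicator_Ioo_le {a η p q : ℝ} (hpq : p ≤ q) (hη : 0 ≤ η) :
    ∫ z in p..q, (Ioo (a - η) (a + η)).indicator (fun _ => (1 : ℝ)) z ≤ 2 * η := by
  have hi : Integrable ((Ioo (a - η) (a + η)).indicator fun _ => (1 : ℝ)) :=
    (integrable_indicator_iff measurableSet_Ioo).2 (by simp)
  rw [intervalIntegral.integral_of_le hpq]
  refine (setIntegral_le_integral hi (Eventually.of_forall fun z =>
    indicator_nonneg (fun _ _ => zero_le_one) z)).trans ?_
  rw [integral_indicator measurableSet_Ioo, setIntegral_const, Measure.real, Real.volume_Ioo,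
    ENNReal.toReal_ofReal (by linarith)]
  simp only [smul_eq_mul, mul_one]
  linarith

theorem intervalIntegrable_indicator_Ioo (a η p q : ℝ) :
    IntervalIntegrable ((Ioo (a - η) (a + η)).indicator fun _ => (1 : ℝ)) volume p q :=
  ((integrable_indicator_iff measurableSet_Ioo).2 (by simp)).intervalIntegrable

/-- At distance at least `η` from `a` the decay of the sine integral applies; closer to `a` only the
bound `1` is available, which after integration costs at most `2η`. -/
theorem abs_sineInt_sub_half_le_indicator {h η a z : ℝ} (hh : 0 < h) (hη : 0 < η) (hz : z ≤ a) :
    |sineInt (h * (a - z)) - 1 / 2| ≤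
      (h * η)⁻¹ + (Ioo (a - η) (a + η)).indicator (fun _ => (1 : ℝ)) z := by
  have hp : 0 ≤ (h * η)⁻¹ := by positivity
  by_cases hm : z ∈ Ioo (a - η) (a + η)
  · rw [indicator_of_mem hm]
    rcases hz.lt_or_eq with h1 | h1
    · have h2 := (abs_sineInt_sub_half_le (mul_pos hh (sub_pos.2 h1))).trans (min_le_left _ _)
      linarith
    · rw [h1, sub_self, mul_zero, sineInt_zero, zero_sub, abs_neg, abs_of_pos one_half_pos]
      linarith
  · rw [indicator_of_notMem hm, add_zero]
    have h1 : η ≤ a - z := by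
      by_contra h2
      exact hm ⟨by linarith, by linarith⟩
    refine (abs_sineInt_sub_half_le (mul_pos hh (hη.trans_le h1))).trans ((min_le_right _ _).trans ?_)
    gcongr

theorem abs_sineInt_add_half_le_indicator {h η a z : ℝ} (hh : 0 < h) (hη : 0 < η) (hz : a ≤ z) :
    |sineInt (h * (a - z)) + 1 / 2| ≤
      (h * η)⁻¹ + (Ioo (a - η) (a + η)).indicator (fun _ => (1 : ℝ)) z := by
  have h1 := abs_sineInt_sub_half_le_indicator (a := -a) (z := -z) hh hη (neg_le_neg hz)
  have h2 : sineInt (h * (a - z)) = -sineInt (h * (-a - -z)) := by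
    rw [← sineInt_neg]; ring_nf
  have h3 : (Ioo (-a - η) (-a + η)).indicator (fun _ => (1 : ℝ)) (-z) =
      (Ioo (a - η) (a + η)).indicator (fun _ => (1 : ℝ)) z := by
    by_cases hm : z ∈ Ioo (a - η) (a + η)
    · rw [indicator_of_mem hm, indicator_of_mem]
      exact ⟨by linarith [hm.2], by linarith [hm.1]⟩
    · rw [indicator_of_notMem hm, indicator_of_notMem]
      exact fun h => hm ⟨by linarith [h.2], by linarith [h.1]⟩
  rw [h3] at h1
  rwa [h2, ← abs_neg, neg_add, neg_neg, ← sub_eq_add_neg]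

/-- The factor `sineInt (h(a - z))` is close to `1/2` to the left of `a` and to `-1/2` to its right.
Splitting at the clipped point allows `a` to lie outside the interval. The width `η` stays free and
is tied to `h` later. -/
theorem norm_integral_mul_sineInt_sub_le {V : ℝ → ℂ} {k a h η M : ℝ} (hk : 0 ≤ k) (hh : 0 < h)
    (hη : 0 < η) (hV : ContinuousOn V (Icc (-k) k)) (hM : ∀ z ∈ Icc (-k) k, ‖V z‖ ≤ M) :
    ‖(∫ z in (-k)..k, V z * (sineInt (h * (a - z)) : ℂ)) -
      ((∫ z in (-k)..clipReal k a, V z) - ∫ z in clipReal k a..k, V z) / 2‖ ≤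
      M * (2 * k * (h * η)⁻¹ + 2 * η) := by
  set p := clipReal k a with hp
  have hpm := clipReal_mem hk a
  rw [← hp] at hpm
  have hM0 : 0 ≤ M := (norm_nonneg _).trans (hM p hpm)
  let β : ℝ → ℝ := fun z => (h * η)⁻¹ + (Ioo (a - η) (a + η)).indicator (fun _ => (1 : ℝ)) z
  have hβ : ∀ p q, IntervalIntegrable (fun z => M * β z) volume p q := fun p q =>
    ((intervalIntegrable_const).add (intervalIntegrable_indicator_Ioo a η p q)).const_mul M
  have hs1 : uIcc (-k) p ⊆ Icc (-k) k := by
    rw [uIcc_of_le hpm.1]; exact Icc_subset_Icc_right hpm.2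
  have hs2 : uIcc p k ⊆ Icc (-k) k := by
    rw [uIcc_of_le hpm.2]; exact Icc_subset_Icc_left hpm.1
  have hc : Continuous fun z => (sineInt (h * (a - z)) : ℂ) :=
    Complex.continuous_ofReal.comp (continuous_sineInt.comp (by fun_prop))
  have hi1 : IntervalIntegrable (fun z => V z * (sineInt (h * (a - z)) : ℂ)) volume (-k) p :=
    ((hV.mono hs1).mul hc.continuousOn).intervalIntegrable (μ := volume)
  have hi2 : IntervalIntegrable (fun z => V z * (sineInt (h * (a - z)) : ℂ)) volume p k :=
    ((hV.mono hs2).mul hc.continuousOn).intervalIntegrable (μ := volume)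
  have hv1 := (hV.mono hs1).intervalIntegrable (μ := volume)
  have hv2 := (hV.mono hs2).intervalIntegrable (μ := volume)
  have heq : (∫ z in (-k)..k, V z * (sineInt (h * (a - z)) : ℂ)) -
      ((∫ z in (-k)..p, V z) - ∫ z in p..k, V z) / 2 =
      (∫ z in (-k)..p, V z * ((sineInt (h * (a - z)) - 1 / 2 : ℝ) : ℂ)) +
      ∫ z in p..k, V z * ((sineInt (h * (a - z)) + 1 / 2 : ℝ) : ℂ) := by
    rw [← intervalIntegral.integral_add_adjacent_intervals hi1 hi2]
    have e1 : (fun z => V z * ((sineInt (h * (a - z)) - 1 / 2 : ℝ) : ℂ)) =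
        fun z => V z * (sineInt (h * (a - z)) : ℂ) - V z * (1 / 2) := by
      ext z; push_cast; ring
    have e2 : (fun z => V z * ((sineInt (h * (a - z)) + 1 / 2 : ℝ) : ℂ)) =
        fun z => V z * (sineInt (h * (a - z)) : ℂ) + V z * (1 / 2) := by
      ext z; push_cast; ring
    rw [e1, e2, intervalIntegral.integral_sub hi1 (hv1.mul_const _),
      intervalIntegral.integral_add hi2 (hv2.mul_const _), intervalIntegral.integral_mul_const,
      intervalIntegral.integral_mul_const]
    ring
  rw [heq]
  have b1 : ‖∫ z in (-k)..p, V z * ((sineInt (h * (a - z)) - 1 / 2 : ℝ) : ℂ)‖ ≤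
      ∫ z in (-k)..p, M * β z := by
    refine intervalIntegral.norm_integral_le_of_norm_le hpm.1 (Eventually.of_forall fun z hz => ?_)
      (hβ _ _)
    rw [norm_mul, Complex.norm_real]
    refine mul_le_mul (hM z ⟨hz.1.le, hz.2.trans hpm.2⟩) ?_ (norm_nonneg _) hM0
    exact abs_sineInt_sub_half_le_indicator hh hη (le_of_le_clipReal hz.1 hz.2)
  have b2 : ‖∫ z in p..k, V z * ((sineInt (h * (a - z)) + 1 / 2 : ℝ) : ℂ)‖ ≤
      ∫ z in p..k, M * β z := by
    refine intervalIntegral.norm_integral_le_of_norm_le hpm.2 (Eventually.of_forall fun z hz => ?_)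
      (hβ _ _)
    rw [norm_mul, Complex.norm_real]
    refine mul_le_mul (hM z ⟨hpm.1.trans hz.1.le, hz.2⟩) ?_ (norm_nonneg _) hM0
    exact abs_sineInt_add_half_le_indicator hh hη (le_of_clipReal_lt hz.2 hz.1)
  refine (norm_add_le _ _).trans ((add_le_add b1 b2).trans ?_)
  rw [intervalIntegral.integral_add_adjacent_intervals (hβ _ _) (hβ _ _),
    intervalIntegral.integral_const_mul, intervalIntegral.integral_add intervalIntegrable_const
      (intervalIntegrable_indicator_Ioo a η _ _), intervalIntegral.integral_const, smul_eq_mul]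
  refine mul_le_mul_of_nonneg_left (add_le_add (le_of_eq (by ring))
    (integral_indicator_Ioo_le (by linarith) hη.le)) hM0

/-- The Dirichlet integral of a smooth function on `[-k, k]`, with an explicit error. -/
theorem norm_dirichlet_sub_le {V V' : ℝ → ℂ} {k y h η M : ℝ} (hk : 0 ≤ k) (hh : 0 < h)
    (hη : 0 < η) (hV : ∀ z ∈ Icc (-k) k, HasDerivAt V (V' z) z) (hV' : ContinuousOn V' (Icc (-k) k))
    (hM : ∀ z ∈ Icc (-k) k, ‖V' z‖ ≤ M) :
    ‖(∫ z in (-k)..k, V z * ((Real.pi⁻¹ * h * Real.sinc (h * (y - z)) : ℝ) : ℂ)) -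
      (V (clipReal k y) - V k * ((1 / 2 + SignType.sign (y - k) / 2 : ℝ) : ℂ) -
        V (-k) * ((1 / 2 - SignType.sign (y + k) / 2 : ℝ) : ℂ))‖ ≤
      ‖V k‖ * |sineInt (h * (y - k)) - SignType.sign (y - k) / 2| +
      ‖V (-k)‖ * |sineInt (h * (y + k)) - SignType.sign (y + k) / 2| +
      M * (2 * k * (h * η)⁻¹ + 2 * η) := by
  have hkk : -k ≤ k := by linarith
  have hu : uIcc (-k) k = Icc (-k) k := uIcc_of_le hkk
  have hpm := clipReal_mem hk y
  set p := clipReal k y with hp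
  have hs1 : uIcc (-k) p ⊆ Icc (-k) k := by
    rw [uIcc_of_le hpm.1]; exact Icc_subset_Icc_right hpm.2
  have hs2 : uIcc p k ⊆ Icc (-k) k := by
    rw [uIcc_of_le hpm.2]; exact Icc_subset_Icc_left hpm.1
  -- A primitive in `z` of the Dirichlet kernel; integrating by parts against it replaces a large
  -- kernel by a bounded one.
  have hP : ∀ z : ℝ, HasDerivAt (fun z => ((-sineInt (h * (y - z)) : ℝ) : ℂ))
      ((Real.pi⁻¹ * h * Real.sinc (h * (y - z)) : ℝ) : ℂ) z := fun z => by
    have h1 : HasDerivAt (fun z : ℝ => h * (y - z)) (-h) z := by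
      simpa using ((hasDerivAt_id z).const_sub y).const_mul h
    have h2 := ((hasDerivAt_sineInt (h * (y - z))).comp z h1).neg
    refine (h2.congr_deriv ?_).ofReal_comp
    ring
  have hparts := intervalIntegral.integral_mul_deriv_eq_deriv_mul (a := -k) (b := k) (u := V)
    (u' := V') (v := fun z => ((-sineInt (h * (y - z)) : ℝ) : ℂ))
    (fun z hz => hV z (hu ▸ hz)) (fun z _ => hP z) (hu ▸ hV').intervalIntegrable
    (Continuous.intervalIntegrable (Complex.continuous_ofReal.comp
      (continuous_const.mul (Real.continuous_sinc.comp (by fun_prop)))) _ _)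
  have hF1 : ∫ z in (-k)..p, V' z = V p - V (-k) :=
    intervalIntegral.integral_eq_sub_of_hasDerivAt (fun z hz => hV z (hs1 hz))
      (hV'.mono hs1).intervalIntegrable
  have hF2 : ∫ z in p..k, V' z = V k - V p :=
    intervalIntegral.integral_eq_sub_of_hasDerivAt (fun z hz => hV z (hs2 hz))
      (hV'.mono hs2).intervalIntegrable
  have hE := norm_integral_mul_sineInt_sub_le (a := y) hk hh hη hV' hM
  rw [← hp, hF1, hF2] at hE
  have hneg : ∫ z in (-k)..k, V' z * ((-sineInt (h * (y - z)) : ℝ) : ℂ) =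
      -∫ z in (-k)..k, V' z * (sineInt (h * (y - z)) : ℂ) := by
    rw [← intervalIntegral.integral_neg]
    congr 1; ext z; push_cast; ring
  rw [hparts, hneg, sub_neg_eq_add (y) k]
  -- The half difference of the two integrals of `V'` is `V p - (V k + V (-k)) / 2`. The halves
  -- subtracted there combine with the limits `± sign / 2` of the boundary terms.
  have heq : V k * ((-sineInt (h * (y - k)) : ℝ) : ℂ) - V (-k) * ((-sineInt (h * (y + k)) : ℝ) : ℂ) -
      -(∫ z in (-k)..k, V' z * (sineInt (h * (y - z)) : ℂ)) -
      (V p - V k * ((1 / 2 + SignType.sign (y - k) / 2 : ℝ) : ℂ) -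
        V (-k) * ((1 / 2 - SignType.sign (y + k) / 2 : ℝ) : ℂ)) =
      -(V k * ((sineInt (h * (y - k)) - SignType.sign (y - k) / 2 : ℝ) : ℂ)) +
      V (-k) * ((sineInt (h * (y + k)) - SignType.sign (y + k) / 2 : ℝ) : ℂ) +
      ((∫ z in (-k)..k, V' z * (sineInt (h * (y - z)) : ℂ)) - (V p - V (-k) - (V k - V p)) / 2) := by
    push_cast; ring
  rw [heq]
  refine (norm_add₃_le).trans (add_le_add (add_le_add ?_ ?_) hE)
  · rw [norm_neg, norm_mul, Complex.norm_real, Real.norm_eq_abs]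
  · rw [norm_mul, Complex.norm_real, Real.norm_eq_abs]

end Dirichlet

/-! ### Variation of constants and the transform of the wave operator -/

section Duhamel

/-- `r ↦ sin (a r) / a`. -/
noncomputable def sineOver (a r : ℝ) : ℝ := r * Real.sinc (a * r)

theorem mul_sineOver (a r : ℝ) : a * sineOver a r = Real.sin (a * r) := by
  by_cases h : a * r = 0
  · rw [sineOver, h, Real.sin_zero, ← mul_assoc, h, zero_mul]
  · rw [sineOver, Real.sinc_of_ne_zero h, ← mul_assoc, mul_div_cancel₀ _ h]

theorem abs_sineOver_le (a r : ℝ) : |sineOver a r| ≤ |r| := by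
  rw [sineOver, abs_mul]
  exact mul_le_of_le_one_right (abs_nonneg _) (Real.abs_sinc_le_one _)

theorem hasDerivAt_sineOver (a r : ℝ) : HasDerivAt (sineOver a) (Real.cos (a * r)) r := by
  by_cases ha : a = 0
  · subst ha
    have : sineOver 0 = id := by ext; simp [sineOver]
    rw [this]; simpa using hasDerivAt_id r
  · have : sineOver a = fun r => Real.sin (a * r) / a := by
      ext r; rw [← mul_sineOver]; field_simp
    rw [this]
    have h1 : HasDerivAt (fun r : ℝ => a * r) a r := by simpa using (hasDerivAt_id r).const_mul a
    refine (h1.sin.div_const a).congr_deriv (by field_simp)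

theorem continuous_sineOver (a : ℝ) : Continuous (sineOver a) :=
  continuous_iff_continuousAt.2 fun r => (hasDerivAt_sineOver a r).continuousAt

theorem sineOver_sub (a t s : ℝ) : sineOver a (t - s) =
    sineOver a t * Real.cos (a * s) - Real.cos (a * t) * sineOver a s := by
  by_cases ha : a = 0
  · subst ha; simp [sineOver]
  · refine mul_left_cancel₀ ha ?_
    rw [mul_sub, ← mul_assoc, mul_sineOver, mul_sineOver,
      show a * (Real.cos (a * t) * sineOver a s) = Real.cos (a * t) * (a * sineOver a s) by ring,
      mul_sineOver, mul_sub, Real.sin_sub]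

theorem hasDerivAt_integral_of_continuous {F F' : ℝ → ℝ → ℂ} (hF : Continuous (Function.uncurry F))
    (hF' : Continuous (Function.uncurry F')) (h : ∀ s y, HasDerivAt (fun s => F s y) (F' s y) s)
    (a b s : ℝ) : HasDerivAt (fun s => ∫ y in a..b, F s y) (∫ y in a..b, F' s y) s := by
  obtain ⟨C, hC⟩ := ((isCompact_Icc (a := s - 1) (b := s + 1)).prod
    (isCompact_uIcc (a := a) (b := b))).exists_bound_of_continuousOn hF'.continuousOn
  have hc1 : ∀ s, Continuous (F s) := fun s => hF.comp (by fun_prop : Continuous fun y => (s, y))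
  have hc2 : ∀ s, Continuous (F' s) := fun s => hF'.comp (by fun_prop : Continuous fun y => (s, y))
  refine (intervalIntegral.hasDerivAt_integral_of_dominated_loc_of_deriv_le (F := F) (F' := F')
    (bound := fun _ => C) (Icc_mem_nhds (by linarith : s - 1 < s) (by linarith : s < s + 1))
    (Eventually.of_forall fun s => (hc1 s).aestronglyMeasurable)
    ((hc1 s).intervalIntegrable _ _) (hc2 s).aestronglyMeasurable
    (Eventually.of_forall fun y hy s hs => ?_) intervalIntegrable_const
    (Eventually.of_forall fun y _ s _ => h s y)).2
  exact hC (s, y) ⟨hs, uIoc_subset_uIcc hy⟩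

/-- Variation of constants for `v'' + a² v = r`. -/
theorem duhamel {v v' v'' : ℝ → ℂ} {a : ℝ} (h1 : ∀ s, HasDerivAt v (v' s) s)
    (h2 : ∀ s, HasDerivAt v' (v'' s) s) (h3 : Continuous v'') (t : ℝ) :
    v t = v' 0 * (sineOver a t : ℂ) + v 0 * (Real.cos (a * t) : ℂ) +
      ∫ s in (0 : ℝ)..t, (v'' s + (a : ℂ) ^ 2 * v s) * (sineOver a (t - s) : ℂ) := by
  have hv : Continuous v := continuous_iff_continuousAt.2 fun s => (h1 s).continuousAt
  -- This expression equals `v t` at `s = t` and the contribution of the initial data at `s = 0`;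
  -- its derivative contains only the source.
  have hd : ∀ s, HasDerivAt
      (fun s => v' s * (sineOver a (t - s) : ℂ) + v s * (Real.cos (a * (t - s)) : ℂ))
      ((v'' s + (a : ℂ) ^ 2 * v s) * (sineOver a (t - s) : ℂ)) s := fun s => by
    have e0 : HasDerivAt (fun s : ℝ => t - s) (-1) s := by
      simpa using (hasDerivAt_id s).const_sub t
    have e1 := ((hasDerivAt_sineOver a (t - s)).comp s e0).ofReal_comp
    have e2 : HasDerivAt (fun s : ℝ => a * (t - s)) (a * -1) s := e0.const_mul a
    have e3 := e2.cos.ofReal_comp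
    have e4 := ((h2 s).mul e1).add ((h1 s).mul e3)
    refine e4.congr_deriv ?_
    have e5 := mul_sineOver a (t - s)
    rw [← e5]
    push_cast
    simp only [Function.comp_apply]
    ring
  have hsc : Continuous fun s => (sineOver a (t - s) : ℂ) :=
    Complex.continuous_ofReal.comp ((continuous_sineOver a).comp (by fun_prop))
  have h4 := intervalIntegral.integral_eq_sub_of_hasDerivAt (a := 0) (b := t) (fun s _ => hd s)
    (((h3.add (continuous_const.mul hv)).mul hsc).intervalIntegrable _ _)
  rw [h4]
  simp [sineOver]

variable {U : ℝ × ℝ → ℂ}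

/-- The iterated directional derivative of a function on the plane. -/
noncomputable def dirDeriv (U : ℝ × ℝ → ℂ) (m : ℕ) (v : ℝ × ℝ) (p : ℝ × ℝ) : ℂ :=
  iteratedFDeriv ℝ m U p fun _ => v

theorem dirDeriv_zero (v p : ℝ × ℝ) : dirDeriv U 0 v p = U p := rfl

theorem continuous_dirDeriv (hU : ContDiff ℝ ∞ U) (m : ℕ) (v : ℝ × ℝ) :
    Continuous (dirDeriv U m v) :=
  (ContinuousMultilinearMap.apply ℝ (fun _ : Fin m => ℝ × ℝ) ℂ fun _ => v).continuous.comp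
    (hU.continuous_iteratedFDeriv (m := m) (by exact_mod_cast le_top))

theorem hasDerivAt_dirDeriv (hU : ContDiff ℝ ∞ U) (m : ℕ) {v : ℝ × ℝ} {γ : ℝ → ℝ × ℝ} {r : ℝ}
    (hγ : HasDerivAt γ v r) :
    HasDerivAt (fun r => dirDeriv U m v (γ r)) (dirDeriv U (m + 1) v (γ r)) r := by
  have h1 := ((hU.differentiable_iteratedFDeriv (m := m)
    (by exact_mod_cast ENat.natCast_lt_top m)) (γ r)).hasFDerivAt.comp_hasDerivAt r hγ
  have h2 := (ContinuousMultilinearMap.apply ℝ (fun _ : Fin m => ℝ × ℝ) ℂ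
    fun _ => v).hasFDerivAt.comp_hasDerivAt r h1
  exact h2

theorem hasDerivAt_dirDeriv_fst (hU : ContDiff ℝ ∞ U) (m : ℕ) (y s : ℝ) :
    HasDerivAt (fun y => dirDeriv U m (1, 0) (y, s)) (dirDeriv U (m + 1) (1, 0) (y, s)) y :=
  hasDerivAt_dirDeriv hU m ((hasDerivAt_id y).prodMk (hasDerivAt_const y s))

theorem hasDerivAt_dirDeriv_snd (hU : ContDiff ℝ ∞ U) (m : ℕ) (y s : ℝ) :
    HasDerivAt (fun s => dirDeriv U m (0, 1) (y, s)) (dirDeriv U (m + 1) (0, 1) (y, s)) s :=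
  hasDerivAt_dirDeriv hU m ((hasDerivAt_const s y).prodMk (hasDerivAt_id s))

/-- The character `z ↦ e^{-izw}`. -/
noncomputable def character (w z : ℝ) : ℂ := Complex.exp (((-1 * w * z : ℝ) : ℂ) * Complex.I)

theorem norm_character (w z : ℝ) : ‖character w z‖ = 1 := Complex.norm_exp_ofReal_mul_I _

theorem continuous_character (w : ℝ) : Continuous (character w) := by
  unfold character; fun_prop

theorem hasDerivAt_character (w z : ℝ) :
    HasDerivAt (character w) (-(Complex.I * w) * character w z) z := by
  have h1 : HasDerivAt (fun z : ℝ => -1 * w * z) (-1 * w) z := by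
    simpa using (hasDerivAt_id z).const_mul (-1 * w)
  refine ((h1.ofReal_comp.mul_const Complex.I).cexp).congr_deriv ?_
  rw [character]
  push_cast
  ring

theorem integral_deriv_mul_character {v v' : ℝ → ℂ} (hv : ∀ z, HasDerivAt v (v' z) z)
    (hv' : Continuous v') (k w : ℝ) : ∫ z in (-k)..k, v' z * character w z =
      v k * character w k - v (-k) * character w (-k) +
        Complex.I * w * ∫ z in (-k)..k, v z * character w z := by
  have h := intervalIntegral.integral_mul_deriv_eq_deriv_mul (a := -k) (b := k)
    (fun z _ => hasDerivAt_character w z) (fun z _ => hv z)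
    ((continuous_const.mul (continuous_character w)).intervalIntegrable _ _)
    (hv'.intervalIntegrable _ _)
  simp only [mul_comm (character w _)] at h
  rw [h, ← intervalIntegral.integral_const_mul]
  have e : ∀ z, -(Complex.I * w) * character w z * v z = -(Complex.I * w * (v z * character w z)) :=
    fun z => by ring
  simp only [e]
  rw [intervalIntegral.integral_neg]
  ring

/-- The boundary term of the transform of the wave operator. -/
noncomputable def boundaryTerm (U : ℝ × ℝ → ℂ) (k c w s : ℝ) : ℂ :=
  (c : ℂ) ^ 2 * (Complex.I * w * (U (k, s) * character w k - U (-k, s) * character w (-k)) +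
    (dirDeriv U 1 (1, 0) (k, s) * character w k - dirDeriv U 1 (1, 0) (-k, s) * character w (-k)))

theorem continuous_boundaryTerm (hU : ContDiff ℝ ∞ U) (k c w : ℝ) :
    Continuous (boundaryTerm U k c w) := by
  have h1 : ∀ a : ℝ, Continuous fun s => U (a, s) := fun a => hU.continuous.comp (by fun_prop)
  have h2 : ∀ a : ℝ, Continuous fun s => dirDeriv U 1 (1, 0) (a, s) := fun a =>
    (continuous_dirDeriv hU 1 _).comp (by fun_prop)
  unfold boundaryTerm
  fun_prop

/-- The transform of a function on the strip, up to the transform of its wave operator. -/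
theorem norm_transform_sub_le (hU : ContDiff ℝ ∞ U) {k c w t δ : ℝ} (hk : 0 ≤ k) (ht : 0 ≤ t)
    (hδ : ∀ y ∈ Icc (-k) k, ∀ s ∈ Icc 0 t,
      ‖dirDeriv U 2 (0, 1) (y, s) - (c : ℂ) ^ 2 * dirDeriv U 2 (1, 0) (y, s)‖ ≤ δ) :
    ‖(∫ y in (-k)..k, U (y, t) * character w y) -
      ((∫ y in (-k)..k, dirDeriv U 1 (0, 1) (y, 0) * character w y) * (sineOver (c * w) t : ℂ) +
        (∫ y in (-k)..k, U (y, 0) * character w y) * (Real.cos (c * w * t) : ℂ) +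
        ((sineOver (c * w) t : ℂ) *
          (∫ s in (0 : ℝ)..t, boundaryTerm U k c w s * (Real.cos (c * w * s) : ℂ)) -
        (Real.cos (c * w * t) : ℂ) *
          ∫ s in (0 : ℝ)..t, boundaryTerm U k c w s * (sineOver (c * w) s : ℂ)))‖ ≤
      δ * (2 * k) * t * t := by
  have hcont : ∀ m v, Continuous (Function.uncurry fun s y : ℝ =>
      dirDeriv U m v (y, s) * character w y) := fun m v => by
    have h1 : Continuous fun p : ℝ × ℝ => dirDeriv U m v (p.2, p.1) :=
      (continuous_dirDeriv hU m v).comp (by fun_prop)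
    exact h1.mul ((continuous_character w).comp continuous_snd)
  have hd : ∀ m s, HasDerivAt (fun s => ∫ y in (-k)..k, dirDeriv U m (0, 1) (y, s) * character w y)
      (∫ y in (-k)..k, dirDeriv U (m + 1) (0, 1) (y, s) * character w y) s := fun m s =>
    hasDerivAt_integral_of_continuous (hcont m _) (hcont (m + 1) _)
      (fun s y => (hasDerivAt_dirDeriv_snd hU m y s).mul_const _) _ _ s
  have hslice : ∀ m v s, Continuous fun y => dirDeriv U m v (y, s) := fun m v s =>
    (continuous_dirDeriv hU m v).comp (by fun_prop)
  have hc2 : ∀ m v, Continuous fun s => ∫ y in (-k)..k, dirDeriv U m v (y, s) * character w y :=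
    fun m v => intervalIntegral.continuous_parametric_intervalIntegral_of_continuous' (hcont m v) _ _
  have hD := duhamel (a := c * w) (hd 0) (hd 1) (hc2 2 (0, 1)) t
  simp only [dirDeriv_zero] at hD
  -- The transform of the residual of the wave equation, which is small but not zero for
  -- representatives.
  let n : ℝ → ℂ := fun s => ∫ y in (-k)..k,
    (dirDeriv U 2 (0, 1) (y, s) - (c : ℂ) ^ 2 * dirDeriv U 2 (1, 0) (y, s)) * character w y
  have hn : ∀ s, n s = (∫ y in (-k)..k, dirDeriv U 2 (0, 1) (y, s) * character w y) -
      (c : ℂ) ^ 2 * ∫ y in (-k)..k, dirDeriv U 2 (1, 0) (y, s) * character w y := fun s => by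
    rw [← intervalIntegral.integral_const_mul, ← intervalIntegral.integral_sub]
    · exact intervalIntegral.integral_congr fun y _ => by ring
    · exact ((hslice _ _ s).mul (continuous_character w)).intervalIntegrable _ _
    · exact (continuous_const.mul ((hslice _ _ s).mul (continuous_character w))).intervalIntegrable _ _
  have hnc : Continuous n := by
    rw [funext hn]
    exact (hc2 2 _).sub (continuous_const.mul (hc2 2 _))
  -- Two integrations by parts in space: `(cw)²` times the transform cancels against that of `c²
  -- u_xx`, leaving boundary values and the residual.
  have hsum : ∀ s, (∫ y in (-k)..k, dirDeriv U 2 (0, 1) (y, s) * character w y) +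
      ((c * w : ℝ) : ℂ) ^ 2 * (∫ y in (-k)..k, U (y, s) * character w y) =
      boundaryTerm U k c w s + n s := fun s => by
    have e1 := integral_deriv_mul_character (fun y => hasDerivAt_dirDeriv_fst hU 1 y s)
      (hslice 2 _ s) k w
    have e2 := integral_deriv_mul_character (fun y => hasDerivAt_dirDeriv_fst hU 0 y s)
      (hslice 1 _ s) k w
    simp only [dirDeriv_zero, zero_add, Nat.reduceAdd] at e1 e2
    rw [hn, e1, e2, boundaryTerm]
    push_cast
    linear_combination (c : ℂ) ^ 2 * (w : ℂ) ^ 2 *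
      (∫ y in (-k)..k, U (y, s) * character w y) * Complex.I_sq
  simp only [hsum] at hD
  have hb := continuous_boundaryTerm hU k c w
  have hS : Continuous fun s => (sineOver (c * w) s : ℂ) :=
    Complex.continuous_ofReal.comp (continuous_sineOver _)
  have hC : Continuous fun s : ℝ => (Real.cos (c * w * s) : ℂ) := by fun_prop
  have hS' : Continuous fun s => (sineOver (c * w) (t - s) : ℂ) := hS.comp (by fun_prop)
  -- The addition theorem for the sine separates `t` from `s`. It is applied to the boundary term
  -- only; the residual keeps `t - s`, where `|sin(a r)/a| ≤ |r|` gives a bound independent of `w`.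
  have hsplit : ∫ s in (0 : ℝ)..t, (boundaryTerm U k c w s + n s) * (sineOver (c * w) (t - s) : ℂ) =
      ((sineOver (c * w) t : ℂ) *
          (∫ s in (0 : ℝ)..t, boundaryTerm U k c w s * (Real.cos (c * w * s) : ℂ)) -
        (Real.cos (c * w * t) : ℂ) *
          ∫ s in (0 : ℝ)..t, boundaryTerm U k c w s * (sineOver (c * w) s : ℂ)) +
      ∫ s in (0 : ℝ)..t, n s * (sineOver (c * w) (t - s) : ℂ) := by
    rw [← intervalIntegral.integral_const_mul, ← intervalIntegral.integral_const_mul,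
      ← intervalIntegral.integral_sub, ← intervalIntegral.integral_add]
    · congr 1
      ext s
      rw [sineOver_sub]
      push_cast
      ring
    · exact ((continuous_const.mul (hb.mul hC)).sub
        (continuous_const.mul (hb.mul hS))).intervalIntegrable _ _
    · exact (hnc.mul hS').intervalIntegrable _ _
    · exact (continuous_const.mul (hb.mul hC)).intervalIntegrable _ _
    · exact (continuous_const.mul (hb.mul hS)).intervalIntegrable _ _
  rw [hsplit] at hD
  rw [hD]
  have heq : ∀ A B C D : ℂ, A + B + (C + D) - (A + B + C) = D := fun A B C D => by ring
  rw [heq]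
  have hkk : -k ≤ k := by linarith
  have hbound : ∀ s ∈ uIoc 0 t, ‖n s * (sineOver (c * w) (t - s) : ℂ)‖ ≤ δ * (2 * k) * t := by
    intro s hs
    rw [uIoc_of_le ht] at hs
    have h1 : ‖n s‖ ≤ δ * (2 * k) := by
      have := intervalIntegral.norm_integral_le_of_norm_le_const (a := -k) (b := k) (C := δ)
        (f := fun y => (dirDeriv U 2 (0, 1) (y, s) -
          (c : ℂ) ^ 2 * dirDeriv U 2 (1, 0) (y, s)) * character w y) (fun y hy => by
          rw [norm_mul, norm_character, mul_one]
          rw [uIoc_of_le hkk] at hy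
          exact hδ y ⟨hy.1.le, hy.2⟩ s ⟨hs.1.le, hs.2⟩)
      rw [show |k - -k| = 2 * k by rw [sub_neg_eq_add, abs_of_nonneg (by linarith)]; ring] at this
      exact this
    have h2 : |sineOver (c * w) (t - s)| ≤ t := (abs_sineOver_le _ _).trans (by
      rw [abs_of_nonneg (by linarith [hs.2])]; linarith [hs.1])
    rw [norm_mul, Complex.norm_real, Real.norm_eq_abs]
    exact mul_le_mul h1 h2 (abs_nonneg _) ((norm_nonneg _).trans h1)
  have := intervalIntegral.norm_integral_le_of_norm_le_const hbound
  rwa [sub_zero, abs_of_nonneg ht] at this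

end Duhamel

/-! ### Cosine, exponential and cardinal sine as tame functions -/

section TameFunctions

/-- The inclusion is unbounded, and it is the reason why `Tame` asks nothing of the derivative of
order zero. -/
theorem tame_ofReal : Tame (fun a : ℝ => (a : ℂ)) where
  contDiff := Complex.ofRealCLM.contDiff
  bound := by
    intro m hm
    refine ⟨1, fun x => ?_⟩
    have h1 : deriv (fun a : ℝ => (a : ℂ)) = fun _ => 1 := by
      ext x; exact Complex.ofRealCLM.hasDerivAt.deriv
    obtain ⟨n, rfl⟩ := Nat.exists_eq_add_of_le' hm
    rw [iteratedDeriv_succ', h1, iteratedDeriv_const]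
    split_ifs <;> simp

theorem norm_iteratedDeriv_cos_le (m : ℕ) (x : ℝ) :
    ‖iteratedDeriv m (fun a : ℝ => (Real.cos a : ℂ)) x‖ ≤ 1 := by
  have h := Complex.ofRealLI.norm_iteratedFDeriv_comp_left (f := Real.cos) (x := x) (n := ∞) (i := m)
    Real.contDiff_cos.contDiffAt (by exact_mod_cast le_top)
  rw [norm_iteratedFDeriv_eq_norm_iteratedDeriv, norm_iteratedFDeriv_eq_norm_iteratedDeriv] at h
  have h2 := Real.abs_iteratedDeriv_cos_le_one m x
  rw [← Real.norm_eq_abs, ← h] at h2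
  exact h2

theorem tame_cos : Tame (fun a : ℝ => (Real.cos a : ℂ)) where
  contDiff := Complex.ofRealCLM.contDiff.comp Real.contDiff_cos
  bound m _ := ⟨1, norm_iteratedDeriv_cos_le m⟩

theorem tame_cis : Tame (fun a : ℝ => Complex.exp (a * Complex.I)) where
  contDiff := (Complex.ofRealCLM.contDiff.mul contDiff_const).cexp
  bound m _ := by
    refine ⟨1, fun x => ?_⟩
    have h : ∀ m : ℕ, iteratedDeriv m (fun a : ℝ => Complex.exp (a * Complex.I)) =
        fun a : ℝ => Complex.I ^ m * Complex.exp (a * Complex.I) := by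
      intro m
      induction m with
      | zero => simp
      | succ m ih =>
        rw [iteratedDeriv_succ, ih]
        ext a
        have h1 : HasDerivAt (fun a : ℝ => (a : ℂ) * Complex.I) (1 * Complex.I) a :=
          (Complex.ofRealCLM.hasDerivAt (x := a)).mul_const Complex.I
        rw [(h1.cexp.const_mul (Complex.I ^ m)).deriv]
        ring
    rw [h, norm_mul, norm_pow, Complex.norm_I, one_pow, one_mul, Complex.norm_exp_ofReal_mul_I]

theorem half_integral_cos (z : ℝ) : 1 / 2 * ∫ t in (-1 : ℝ)..1, Real.cos (z * t) = Real.sinc z := by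
  by_cases hz : z = 0
  · subst hz; norm_num
  · have h2 := intervalIntegral.mul_integral_comp_mul_left (a := -1) (b := 1) (f := Real.cos) z
    rw [integral_cos, mul_neg, mul_one, Real.sin_neg] at h2
    rw [Real.sinc_of_ne_zero hz]
    field_simp
    linarith

theorem ofReal_sinc (z : ℝ) :
    (Real.sinc z : ℂ) = ∫ s in (-1 : ℝ)..1, (1 / 2 : ℂ) * (Real.cos (1 * z * s) : ℂ) := by
  rw [← half_integral_cos, intervalIntegral.integral_const_mul, intervalIntegral.integral_ofReal]
  push_cast
  simp

/-- Written as an average of `cos(zs)` over `|s| ≤ 1`, it inherits smoothness at `0` and the bounds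
on all derivatives from the cosine. -/
theorem tame_sinc : Tame (fun a : ℝ => (Real.sinc a : ℂ)) where
  contDiff := by
    rw [funext ofReal_sinc]
    exact contDiff_integral_mul_comp (φ := fun a : ℝ => (Real.cos a : ℂ)) continuousOn_const tame_cos
  bound m _ := by
    refine ⟨1, fun x => ?_⟩
    rw [funext ofReal_sinc, iteratedDeriv_integral_mul_comp (φ := fun a : ℝ => (Real.cos a : ℂ))
      continuousOn_const tame_cos]
    have h := intervalIntegral.norm_integral_le_of_norm_le_const (a := -1) (b := 1) (C := 1 / 2)
      (f := fun s => (1 / 2 : ℂ) * (((1 * s) ^ m : ℝ) : ℂ) *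
        iteratedDeriv m (fun a : ℝ => (Real.cos a : ℂ)) (1 * x * s)) (fun s hs => by
        rw [uIoc_of_le (by norm_num)] at hs
        have hs' : |s| ≤ 1 := abs_le.2 ⟨hs.1.le, hs.2⟩
        rw [norm_mul, norm_mul, Complex.norm_real, norm_pow, one_mul, Real.norm_eq_abs]
        have h1 := pow_le_one₀ (n := m) (abs_nonneg s) hs'
        have h2 := norm_iteratedDeriv_cos_le m (1 * x * s)
        have h3 : ‖(1 / 2 : ℂ)‖ = 1 / 2 := by norm_num
        rw [h3]
        calc 1 / 2 * |s| ^ m * _ ≤ 1 / 2 * 1 * 1 := by gcongr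
          _ = 1 / 2 := by norm_num)
    refine h.trans (by norm_num)

theorem exists_lipschitz_sinc : ∃ K : NNReal, LipschitzWith K fun z : ℝ =>
    1 / 2 * ∫ t in (-1 : ℝ)..1, Real.cos (z * t) := by
  obtain ⟨K, hK⟩ := tame_sinc.exists_lipschitz
  refine ⟨K, LipschitzWith.of_dist_le_mul fun x y => ?_⟩
  have := hK.dist_le_mul x y
  rwa [dist_eq_norm, ← Complex.ofReal_sub, Complex.norm_real, ← dist_eq_norm,
    ← half_integral_cos, ← half_integral_cos] at this

variable {ρ : Gauge}

theorem Rep.gS {x : Gen ρ ℝ} {xe : Idx → ℝ} (hx : Rep x xe) :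
    Rep (gS x) (fun ε => Real.sinc (xe ε)) := by
  obtain ⟨K, hK⟩ := exists_lipschitz_sinc
  have := hx.map hK
  simp only [half_integral_cos] at this
  convert this using 2
  simp only [GenSmooth.gS, half_integral_cos]

theorem Rep.gcis {x : Gen ρ ℝ} {xe : Idx → ℝ} (hx : Rep x xe) :
    Rep (gcis x) (fun ε => Complex.exp (xe ε * Complex.I)) := tame_cis.rep_map hx

theorem toC_gcos (x : Gen ρ ℝ) : toC (gcos x) = map (fun a : ℝ => (Real.cos a : ℂ)) x :=
  (rep_spec x).gcos.toC.eq (tame_cos.rep_map (rep_spec x))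

theorem toC_gS (x : Gen ρ ℝ) : toC (gS x) = map (fun a : ℝ => (Real.sinc a : ℂ)) x :=
  (rep_spec x).gS.toC.eq (tame_sinc.rep_map (rep_spec x))

theorem toC_mul (x y : Gen ρ ℝ) : toC (x * y) = toC x * toC y :=
  ((rep_spec x).mul (rep_spec y)).toC.eq
    (((rep_spec x).toC.mul (rep_spec y).toC).congr
      (Eventually.of_forall fun ε => Complex.ofReal_mul _ _))

theorem gcis_mul_gcos (x y : Gen ρ ℝ) :
    toC (gcos y) * gcis x = const ρ (1 / 2 : ℂ) * (gcis (x - y) + gcis (x + y)) := by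
  have hx := rep_spec x
  have hy := rep_spec y
  refine (hy.gcos.toC.mul hx.gcis).eq (((rep_const (1 / 2 : ℂ)).mul
    ((hx.sub hy).gcis.add (hx.add hy).gcis)).congr (Eventually.of_forall fun ε => ?_))
  push_cast
  rw [Complex.cos, sub_mul, add_mul, Complex.exp_sub, Complex.exp_add, neg_mul, Complex.exp_neg]
  ring

theorem isGSF_toC (X : Set (Gen ρ ℝ)) : IsGSF X (fun s : Gen ρ ℝ => toC s) :=
  (isGSF_map_mul tame_ofReal 1 X).congr fun x _ => by rw [one_mul]; rfl

theorem isGSF_gcis_mul (a : Gen ρ ℝ) (X : Set (Gen ρ ℝ)) : IsGSF X (fun w => gcis (a * w)) :=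
  isGSF_map_mul tame_cis a X

theorem isGSF_toC_gcos (a b : Gen ρ ℝ) (X : Set (Gen ρ ℝ)) :
    IsGSF X (fun w => toC (gcos (a * w * b))) :=
  (isGSF_map_mul tame_cos (a * b) X).congr fun w _ => by
    rw [toC_gcos, show a * w * b = a * b * w by ring]

theorem isGSF_toC_gS (a b : Gen ρ ℝ) (X : Set (Gen ρ ℝ)) :
    IsGSF X (fun w => toC (gS (a * w * b))) :=
  (isGSF_map_mul tame_sinc (a * b) X).congr fun w _ => by
    rw [toC_gS, show a * w * b = a * b * w by ring]

theorem isGSF_toC_mul_gS (c t : Gen ρ ℝ) (X : Set (Gen ρ ℝ)) :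
    IsGSF X (fun w => toC (t * gS (c * w * t))) :=
  ((isGSF_const X (toC t)).mul (isGSF_toC_gS c t X)).congr fun w _ => toC_mul _ _

end TameFunctions

/-! ### Families whose integral is smooth in the parameter -/

section Param

variable {ρ : Gauge} {X Y : Set (Gen ρ ℝ)} {a b : Gen ρ ℝ} {ae be : Idx → ℝ}

/-- Families of generalized smooth functions whose integral is smooth in the parameter. -/
structure ParamGSF (X Y : Set (Gen ρ ℝ)) (a b : Gen ρ ℝ) (Ψ : Gen ρ ℝ → Gen ρ ℝ → Gen ρ ℂ) :
    Prop where
  integrand : ∀ w, IsGSF X (Ψ w)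
  integral : IsGSF Y (fun w => gint X (Ψ w) a b)

theorem paramGSF_mul_map {f : Gen ρ ℝ → Gen ρ ℂ} (hf : IsGSF X f) (ha : Rep a ae) (hb : Rep b be)
    (hX : NetsIn X fun ε => uIcc (ae ε) (be ε)) {φ : ℝ → ℂ} (hφ : Tame φ)
    (hφ0 : ∃ C : ℝ, ∀ x, ‖φ x‖ ≤ C) (c : Gen ρ ℝ) (Y : Set (Gen ρ ℝ)) :
    ParamGSF X Y a b (fun w s => f s * map φ (c * w * s)) :=
  ⟨fun w => hf.mul (isGSF_map_mul hφ (c * w) X), isGSF_gint_mul_map hf ha hb hX hφ hφ0 c Y⟩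

theorem ParamGSF.add {Ψ Ψ' : Gen ρ ℝ → Gen ρ ℝ → Gen ρ ℂ} (h : ParamGSF X Y a b Ψ)
    (h' : ParamGSF X Y a b Ψ') (ha : Rep a ae) (hb : Rep b be)
    (hX : NetsIn X fun ε => uIcc (ae ε) (be ε)) :
    ParamGSF X Y a b (fun w s => Ψ w s + Ψ' w s) :=
  ⟨fun w => (h.integrand w).add (h'.integrand w),
    (h.integral.add h'.integral).congr fun w _ =>
      gint_add (h.integrand w) (h'.integrand w) ha hb hX⟩

theorem ParamGSF.const_mul {Ψ : Gen ρ ℝ → Gen ρ ℝ → Gen ρ ℂ} (h : ParamGSF X Y a b Ψ)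
    {C : Gen ρ ℝ → Gen ρ ℂ} (hC : IsGSF Y C) (ha : Rep a ae) (hb : Rep b be)
    (hX : NetsIn X fun ε => uIcc (ae ε) (be ε)) :
    ParamGSF X Y a b (fun w s => C w * Ψ w s) :=
  ⟨fun w => (isGSF_const X (C w)).mul (h.integrand w),
    (hC.mul h.integral).congr fun w _ => gint_const_mul (C w) (h.integrand w) ha hb hX⟩

end Param

/-! ### Representatives and algebra of the hyperfinite transforms -/

section Fourier

variable {ρ : Gauge} {k : Gen ρ ℝ} {ke : Idx → ℝ} {f g : Gen ρ ℝ → Gen ρ ℂ}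

theorem netsIn_uIcc_box_self (hk : Rep k ke) (hk0 : ∀ᶠ ε in atBot, 0 ≤ ke ε) :
    NetsIn (box k) (fun ε => uIcc (-ke ε) (ke ε)) := by
  obtain ⟨h1, h2⟩ := netsIn_Icc_box hk hk0
  refine ⟨Eventually.of_forall fun ε => nonempty_uIcc, fun xe h => h2 xe ?_⟩
  filter_upwards [h, hk0] with ε h h0
  rwa [uIcc_of_le (by linarith)] at h

theorem isGSF_mul_gcis_neg (hf : IsGSF (box k) f) (w : Gen ρ ℝ) :
    IsGSF (box k) (fun x => f x * gcis (-(x * w))) :=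
  (hf.mul (isGSF_gcis_mul (-w) _)).congr fun x _ => by rw [show -w * x = -(x * w) by ring]

theorem isGSF_HFT (hf : IsGSF (box k) f) (hk : Rep k ke) (hk0 : ∀ᶠ ε in atBot, 0 ≤ ke ε)
    (Y : Set (Gen ρ ℝ)) : IsGSF Y (HFT k f) := by
  refine (isGSF_gint_mul_map hf hk.neg hk (netsIn_uIcc_box_self hk hk0) tame_cis
    ⟨1, fun x => (Complex.norm_exp_ofReal_mul_I x).le⟩ (-1) Y).congr fun w _ => ?_
  rw [HFT]
  congr 1
  ext x
  rw [show -1 * w * x = -(x * w) by ring]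
  rfl

theorem HFT_rep (hf : IsGSF (box k) f) (hk : Rep k ke) (hk0 : ∀ᶠ ε in atBot, 0 ≤ ke ε)
    {F : Idx → ℝ → ℂ} (hF : ∀ x ∈ box k, ∀ xe, Rep x xe → (∀ᶠ ε in atBot, xe ε ∈ Icc (-ke ε) (ke ε)) →
      Rep (f x) (fun ε => F ε (xe ε)))
    (hc : ∀ᶠ ε in atBot, ContinuousOn (F ε) (Icc (-ke ε) (ke ε))) {w : Gen ρ ℝ} {we : Idx → ℝ}
    (hw : Rep w we) :
    Rep (HFT k f w) (fun ε => ∫ z in (-ke ε)..ke ε, F ε z * character (we ε) z) := by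
  refine gint_rep (isGSF_mul_gcis_neg hf w) hk.neg hk (netsIn_uIcc_box_self hk hk0)
    (fun x hx xe hxe hm => ?_) ?_
  · have hm' : ∀ᶠ ε in atBot, xe ε ∈ Icc (-ke ε) (ke ε) := by
      filter_upwards [hm, hk0] with ε h h0
      rwa [uIcc_of_le (by linarith)] at h
    refine ((hF x hx xe hxe hm').mul (hxe.mul hw).neg.gcis).congr (Eventually.of_forall fun ε => ?_)
    rw [character]
    ring_nf
  · filter_upwards [hc, hk0] with ε h h0
    rw [← uIcc_of_le (by linarith)] at h
    exact (h.mul (continuous_character _).continuousOn).intervalIntegrable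

variable {h : Gen ρ ℝ} {he : Idx → ℝ} {P P' : Gen ρ ℝ → Gen ρ ℂ}

theorem isGSF_mul_gcis (hP : IsGSF (box h) P) (x : Gen ρ ℝ) :
    IsGSF (box h) (fun w => P w * gcis (x * w)) := hP.mul (isGSF_gcis_mul x _)

theorem invHFT_rep (hP : IsGSF (box h) P) (hh : Rep h he) (hh0 : ∀ᶠ ε in atBot, 0 ≤ he ε)
    {F : Idx → ℝ → ℂ} (hF : ∀ w ∈ box h, ∀ we, Rep w we → Rep (P w) (fun ε => F ε (we ε)))
    (hc : ∀ᶠ ε in atBot, Continuous (F ε)) {x : Gen ρ ℝ} {xe : Idx → ℝ} (hx : Rep x xe) :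
    Rep (invHFT h P x) (fun ε => ((1 / (2 * Real.pi) : ℝ) : ℂ) *
      ∫ w in (-he ε)..he ε, F ε w * Complex.exp (((xe ε * w : ℝ) : ℂ) * Complex.I)) :=
  (rep_const _).mul (gint_rep (isGSF_mul_gcis hP x) hh.neg hh (netsIn_uIcc_box_self hh hh0)
    (fun w hw we hwe _ => (hF w hw we hwe).mul (hx.mul hwe).gcis)
    (hc.mono fun ε h => Continuous.intervalIntegrable (by fun_prop) _ _))

theorem invHFT_congr (hP : IsGSF (box h) P) (hh : Rep h he) (hh0 : ∀ᶠ ε in atBot, 0 ≤ he ε)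
    (hPP : ∀ w ∈ box h, P w = P' w) (x : Gen ρ ℝ) : invHFT h P x = invHFT h P' x := by
  rw [invHFT, invHFT, gint_congr (isGSF_mul_gcis hP x) hh.neg hh (netsIn_uIcc_box_self hh hh0)
    fun w hw => by rw [hPP w hw]]

theorem invHFT_add (hP : IsGSF (box h) P) (hP' : IsGSF (box h) P') (hh : Rep h he)
    (hh0 : ∀ᶠ ε in atBot, 0 ≤ he ε) (x : Gen ρ ℝ) :
    invHFT h (fun w => P w + P' w) x = invHFT h P x + invHFT h P' x := by
  rw [invHFT, invHFT, invHFT, ← mul_add, ← gint_add (isGSF_mul_gcis hP x) (isGSF_mul_gcis hP' x)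
    hh.neg hh (netsIn_uIcc_box_self hh hh0)]
  simp only [add_mul]

theorem invHFT_const_mul (z : Gen ρ ℂ) (hP : IsGSF (box h) P) (hh : Rep h he)
    (hh0 : ∀ᶠ ε in atBot, 0 ≤ he ε) (x : Gen ρ ℝ) :
    invHFT h (fun w => z * P w) x = z * invHFT h P x := by
  rw [invHFT, invHFT, mul_left_comm, ← gint_const_mul z (isGSF_mul_gcis hP x)
    hh.neg hh (netsIn_uIcc_box_self hh hh0)]
  simp only [mul_assoc]

theorem invHFT_sub (hP : IsGSF (box h) P) (hP' : IsGSF (box h) P') (hh : Rep h he)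
    (hh0 : ∀ᶠ ε in atBot, 0 ≤ he ε) (x : Gen ρ ℝ) :
    invHFT h (fun w => P w - P' w) x = invHFT h P x - invHFT h P' x := by
  rw [sub_eq_add_neg, ← neg_one_mul (invHFT h P' x), ← invHFT_const_mul (-1) hP' hh hh0,
    ← invHFT_add hP ((isGSF_const _ (-1)).mul hP') hh hh0]
  simp only [neg_one_mul, sub_eq_add_neg]

theorem invHFT_eq_zero (hh : Rep h he) (hh0 : ∀ᶠ ε in atBot, 0 ≤ he ε)
    (hP : ∀ w ∈ box h, P w = 0) (x : Gen ρ ℝ) : invHFT h P x = 0 := by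
  rw [← invHFT_congr (P := fun _ => 0) (isGSF_const _ 0) hh hh0 fun w hw => (hP w hw).symm]
  have := invHFT_const_mul 0 (isGSF_const (box h) 0) hh hh0 x
  simpa using this

/-- Multiplication of the transform by a cosine averages two translates. -/
theorem invHFT_mul_gcos (hP : IsGSF (box h) P) (hh : Rep h he) (hh0 : ∀ᶠ ε in atBot, 0 ≤ he ε)
    (c t x : Gen ρ ℝ) : invHFT h (fun w => P w * toC (gcos (c * w * t))) x =
      const ρ (1 / 2 : ℂ) * (invHFT h P (x - c * t) + invHFT h P (x + c * t)) := by
  have hX := netsIn_uIcc_box_self hh hh0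
  have h1 := isGSF_mul_gcis hP (x - c * t)
  have h2 := isGSF_mul_gcis hP (x + c * t)
  rw [invHFT, invHFT, invHFT, ← mul_add, mul_left_comm, ← gint_add h1 h2 hh.neg hh hX,
    ← gint_const_mul _ (h1.add h2) hh.neg hh hX]
  congr 2
  ext w
  rw [mul_assoc, gcis_mul_gcos, show x * w - c * w * t = (x - c * t) * w by ring,
    show x * w + c * w * t = (x + c * t) * w by ring]
  ring

end Fourier

/-! ### Limits in the sharp topology -/

section Limits

variable {ρ : Gauge}

theorem Gen.le_trans {x y z : Gen ρ ℝ} (h1 : x ≤ y) (h2 : y ≤ z) : x ≤ z := by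
  rw [le_iff_forall (rep_spec x) (rep_spec z)]
  intro n
  filter_upwards [(le_iff_forall (rep_spec x) (rep_spec y)).1 h1 (n + 1),
    (le_iff_forall (rep_spec y) (rep_spec z)).1 h2 (n + 1), eventually_mul_pow_le ρ 2 n] with ε a b c
  linarith

theorem Gen.exists_ge (x y : Gen ρ ℝ) : ∃ z, x ≤ z ∧ y ≤ z := by
  have hm : Moderate ρ ℝ fun ε => max (rep x ε) (rep y ε) := by
    refine ((rep_spec x).1.norm.add (rep_spec y).1.norm).of_le (Eventually.of_forall fun ε => ?_)
    refine _root_.le_trans ?_ (Real.le_norm_self _)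
    simp only [Pi.add_apply, Real.norm_eq_abs]
    rcases max_cases (rep x ε) (rep y ε) with h | h <;> rw [h.1] <;>
    linarith [abs_nonneg (rep x ε), abs_nonneg (rep y ε)]
  exact ⟨_, le_of_eventually (rep_spec x) hm.rep (Eventually.of_forall fun ε => le_max_left _ _),
    le_of_eventually (rep_spec y) hm.rep (Eventually.of_forall fun ε => le_max_right _ _)⟩

/-- Generalized numbers past which every representative exceeds `ρ_ε^{-n}`. -/
theorem exists_forall_ge_eventually_inv_pow_le (ρ : Gauge) (n : ℕ) : ∃ h₀ : Gen ρ ℝ, ∀ h, h₀ ≤ h →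
    ∀ he, Rep h he → ∀ᶠ ε in atBot, (ρ.net ε ^ n)⁻¹ ≤ he ε := by
  -- The added `1` absorbs the slack `ρ^0` in the comparison of representatives.
  have hm := (moderate_inv_pow ρ n).add (moderate_const ρ ℝ 1)
  refine ⟨ofNet ρ ((fun ε => (ρ.net ε ^ n)⁻¹) + fun _ => 1), fun h hh he hhe => ?_⟩
  filter_upwards [(le_iff_forall hm.rep hhe).1 hh 0] with ε h1
  rw [pow_zero, Pi.add_apply] at h1
  linarith

theorem eventually_le_of_gnorm_le {z : Gen ρ ℂ} {ze : Idx → ℂ} (hz : Rep z ze) {q : ℕ}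
    (h : gnorm z ≤ dRho ρ ^ (q + 1)) : ∀ᶠ ε in atBot, ‖ze ε‖ ≤ ρ.net ε ^ q := by
  filter_upwards [(le_iff_forall hz.gnorm ((rep_dRho ρ).pow (q + 1))).1 h (q + 1),
    eventually_mul_pow_le ρ 2 q] with ε h1 h2
  linarith

theorem eq_of_forall_gnorm_le {z : Gen ρ ℂ} (h : ∀ q, gnorm z ≤ dRho ρ ^ q) : z = 0 :=
  (rep_spec z).eq_zero_iff.2 fun q => eventually_le_of_gnorm_le (rep_spec z) (h (q + 1))

variable {Φ Ψ : Gen ρ ℝ → Gen ρ ℂ} {l m : Gen ρ ℂ}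

theorem gnorm_add_le_dRho_pow {z z' : Gen ρ ℂ} {q : ℕ} (h : gnorm z ≤ dRho ρ ^ (q + 2))
    (h' : gnorm z' ≤ dRho ρ ^ (q + 2)) : gnorm (z + z') ≤ dRho ρ ^ q := by
  refine gnorm_le_dRho_pow ((rep_spec z).add (rep_spec z')) ?_
  filter_upwards [eventually_le_of_gnorm_le (rep_spec z) h,
    eventually_le_of_gnorm_le (rep_spec z') h', eventually_mul_pow_le ρ 2 q] with ε h1 h2 h3
  exact (norm_add_le _ _).trans (by linarith)

theorem LimAtTop.add (h : LimAtTop Φ l) (h' : LimAtTop Ψ m) :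
    LimAtTop (fun x => Φ x + Ψ x) (l + m) := by
  intro q
  obtain ⟨h1, hh1⟩ := h (q + 2)
  obtain ⟨h2, hh2⟩ := h' (q + 2)
  obtain ⟨h0, ha, hb⟩ := Gen.exists_ge h1 h2
  refine ⟨h0, fun x hx => ?_⟩
  rw [add_sub_add_comm]
  exact gnorm_add_le_dRho_pow (hh1 x (Gen.le_trans ha hx)) (hh2 x (Gen.le_trans hb hx))

theorem LimAtTop.const_mul (z : Gen ρ ℂ) (h : LimAtTop Φ l) :
    LimAtTop (fun x => z * Φ x) (z * l) := by
  intro q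
  obtain ⟨N, hN⟩ := (rep_spec z).1
  -- A factor of size `ρ^(-N)` costs `N` powers, and passing from the order to representatives costs
  -- one.
  obtain ⟨h1, hh1⟩ := h (q + N + 1)
  refine ⟨h1, fun x hx => ?_⟩
  rw [← mul_sub]
  refine gnorm_le_dRho_pow ((rep_spec z).mul (rep_spec (Φ x - l))) ?_
  filter_upwards [hN, eventually_le_of_gnorm_le (rep_spec _) (hh1 x hx)] with ε a b
  have hp := pow_pos (ρ.pos ε) N
  rw [norm_mul]
  calc _ ≤ (ρ.net ε ^ N)⁻¹ * ρ.net ε ^ (q + N) := by gcongr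
    _ = _ := by rw [pow_add]; field_simp

theorem LimAtTop.sub (h : LimAtTop Φ l) (h' : LimAtTop Ψ m) :
    LimAtTop (fun x => Φ x - Ψ x) (l - m) := by
  have := h.add (h'.const_mul (-1))
  simpa only [neg_one_mul, ← sub_eq_add_neg] using this

theorem LimAtTop.congr (h : LimAtTop Φ l) {h₁ : Gen ρ ℝ} (hΨ : ∀ x, h₁ ≤ x → Ψ x = Φ x) :
    LimAtTop Ψ l := by
  intro q
  obtain ⟨h2, hh2⟩ := h q
  obtain ⟨h0, ha, hb⟩ := Gen.exists_ge h₁ h2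
  exact ⟨h0, fun x hx => by rw [hΨ x (Gen.le_trans ha hx)]; exact hh2 x (Gen.le_trans hb hx)⟩

theorem LimAtTop.unique (h : LimAtTop Φ l) (h' : LimAtTop Φ m) : l = m := by
  have h0 := h'.sub h
  rw [← sub_eq_zero]
  refine eq_of_forall_gnorm_le fun q => ?_
  -- The difference of the two limits no longer depends on the variable, so its bound can be read
  -- off at the threshold itself.
  obtain ⟨x, hx⟩ := h0 q
  have := hx x (Gen.le_refl x)
  beta_reduce at this
  rwa [sub_self, zero_sub, neg_sub] at this

end Limits

/-! ### Estimates at a fixed index -/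

section FixedParameter

variable {V : ℝ → ℂ} {k h y c t : ℝ}

theorem inverse_transform_eq (hV : Continuous V) (k h y : ℝ) :
    ((1 / (2 * Real.pi) : ℝ) : ℂ) * ∫ w in (-h)..h, (∫ z in (-k)..k, V z * character w z) *
        Complex.exp (((y * w : ℝ) : ℂ) * Complex.I) =
      ∫ z in (-k)..k, V z * ((Real.pi⁻¹ * h * Real.sinc (h * (y - z)) : ℝ) : ℂ) := by
  have h1 := integral_mul_integral_exp_swap (κ := fun _ => 1) continuous_const (h := h) (k := k)
    (y := y) hV.continuousOn
  simp only [one_mul, integral_exp_eq_sinc] at h1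
  simp only [character]
  rw [h1, ← intervalIntegral.integral_const_mul]
  refine intervalIntegral.integral_congr fun z _ => ?_
  have := Real.pi_ne_zero
  have hpi : (Real.pi : ℂ) ≠ 0 := by exact_mod_cast this
  push_cast
  field_simp

theorem inverse_transform_sinc_eq (hV : Continuous V) (hc : c ≠ 0) (k h y t : ℝ) :
    ((1 / (2 * Real.pi) : ℝ) : ℂ) * ∫ w in (-h)..h, ((∫ z in (-k)..k, V z * character w z) *
        ((t * Real.sinc (c * w * t) : ℝ) : ℂ)) * Complex.exp (((y * w : ℝ) : ℂ) * Complex.I) =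
      (1 / 2 : ℂ) * ((c⁻¹ : ℝ) : ℂ) * ((∫ z in (-k)..k, V z * (sineInt (h * (y + c * t - z)) : ℂ)) -
        ∫ z in (-k)..k, V z * (sineInt (h * (y - c * t - z)) : ℂ)) := by
  have hκ : Continuous fun w : ℝ => ((t * Real.sinc (c * w * t) : ℝ) : ℂ) :=
    Complex.continuous_ofReal.comp (continuous_const.mul (Real.continuous_sinc.comp (by fun_prop)))
  have h1 := integral_mul_integral_exp_swap hκ (h := h) (k := k) (y := y) hV.continuousOn
  simp only [integral_sinc_mul_exp hc] at h1
  have h2 : ∀ w : ℝ, ((∫ z in (-k)..k, V z * character w z) *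
      ((t * Real.sinc (c * w * t) : ℝ) : ℂ)) = ((t * Real.sinc (c * w * t) : ℝ) : ℂ) *
      ∫ z in (-k)..k, V z * Complex.exp (((-1 * w * z : ℝ) : ℂ) * Complex.I) := fun w => mul_comm _ _
  have hi : ∀ a : ℝ, IntervalIntegrable (fun z => V z * (sineInt (h * (a - z)) : ℂ)) volume (-k) k :=
    fun a => (hV.mul (Complex.continuous_ofReal.comp
      (continuous_sineInt.comp (by fun_prop)))).intervalIntegrable _ _
  simp only [h2]
  rw [h1, ← intervalIntegral.integral_sub (hi _) (hi _), ← intervalIntegral.integral_const_mul,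
    ← intervalIntegral.integral_const_mul]
  refine intervalIntegral.integral_congr fun z _ => ?_
  have hpi : (Real.pi : ℂ) ≠ 0 := by exact_mod_cast Real.pi_ne_zero
  have hc' : (c : ℂ) ≠ 0 := by exact_mod_cast hc
  rw [show y - z + c * t = y + c * t - z by ring, show y - z - c * t = y - c * t - z by ring]
  push_cast
  field_simp

/-- For each of `a` and `b` the limit is half of left minus right integral; in the difference both
halves contribute the integral between the clipped points. -/
theorem norm_integral_sineInt_sub_le {M η a b : ℝ} (hk : 0 ≤ k) (hh : 0 < h) (hη : 0 < η)
    (hV : Continuous V) (hM : ∀ z ∈ Icc (-k) k, ‖V z‖ ≤ M) :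
    ‖((∫ z in (-k)..k, V z * (sineInt (h * (a - z)) : ℂ)) -
        ∫ z in (-k)..k, V z * (sineInt (h * (b - z)) : ℂ)) -
      ∫ z in clipReal k b..clipReal k a, V z‖ ≤ 2 * (M * (2 * k * (h * η)⁻¹ + 2 * η)) := by
  have h1 := norm_integral_mul_sineInt_sub_le (a := a) hk hh hη hV.continuousOn hM
  have h2 := norm_integral_mul_sineInt_sub_le (a := b) hk hh hη hV.continuousOn hM
  have hi : ∀ a b, IntervalIntegrable V volume a b := fun a b => hV.intervalIntegrable a b
  have e1 := intervalIntegral.integral_add_adjacent_intervals (hi (-k) (clipReal k b))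
    (hi (clipReal k b) (clipReal k a))
  have e2 := intervalIntegral.integral_add_adjacent_intervals (hi (clipReal k b) (clipReal k a))
    (hi (clipReal k a) k)
  have h3 := (norm_sub_le _ _).trans (add_le_add h1 h2)
  rw [two_mul]
  refine le_trans (le_of_eq (congrArg norm ?_)) h3
  linear_combination (-1 / 2 : ℂ) * (e1 + e2)

/-- The choice is `η = r^(3N+q+1)` and `h ≥ η⁻²`, so that `(hη)⁻¹ ≤ η`. The bounds on `V` or its
derivative and on `k` use up two of the three factors `r^N`; the third is kept to compensate for
`c⁻¹` in the term with `g`. -/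
theorem error_term_le {r : ℝ} (hr : 0 < r) (hr1 : r ≤ 1) {N q : ℕ} (hk : k ≤ (r ^ N)⁻¹)
    (hh : (r ^ (2 * (3 * N + q + 1)))⁻¹ ≤ h) :
    (r ^ N)⁻¹ * (2 * k * (h * r ^ (3 * N + q + 1))⁻¹ + 2 * r ^ (3 * N + q + 1)) ≤
      4 * (r ^ N * r ^ (q + 1)) := by
  set d := r ^ (3 * N + q + 1) with hd
  have hd0 : 0 < d := pow_pos hr _
  have hP : 0 < r ^ N := pow_pos hr _
  have hP1 : 1 ≤ (r ^ N)⁻¹ := (one_le_inv₀ hP).2 (pow_le_one₀ hr.le hr1)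
  have h1 : (h * d)⁻¹ ≤ d := by
    rw [inv_le_comm₀ (mul_pos ((inv_pos.2 (pow_pos hr _)).trans_le hh) hd0) hd0]
    calc d⁻¹ = (r ^ (2 * (3 * N + q + 1)))⁻¹ * d := by
          rw [mul_comm 2, pow_mul, ← hd]; field_simp
      _ ≤ h * d := by gcongr
  have h2 : d = r ^ N * r ^ N * (r ^ N * r ^ (q + 1)) := by
    rw [hd, ← pow_add, ← pow_add, ← pow_add]; congr 1; ring
  calc (r ^ N)⁻¹ * (2 * k * (h * d)⁻¹ + 2 * d)
      ≤ (r ^ N)⁻¹ * (2 * (r ^ N)⁻¹ * d + 2 * ((r ^ N)⁻¹ * d)) := by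
        gcongr
        · exact inv_nonneg.2 (mul_pos ((inv_pos.2 (pow_pos hr _)).trans_le hh) hd0).le
        · exact le_mul_of_one_le_left hd0.le hP1
    _ = 4 * (r ^ N * r ^ (q + 1)) := by
        rw [h2]; field_simp; norm_num

theorem boundary_term_le {r : ℝ} (hr : 0 < r) (hr1 : r ≤ 1) {N q : ℕ}
    (hh : (r ^ (2 * (3 * N + q + 1)))⁻¹ ≤ h) : (r ^ N)⁻¹ * (h * r ^ N)⁻¹ ≤ r ^ (q + 1) := by
  have hP : 0 < r ^ N := pow_pos hr _
  have h0 : 0 < h := (inv_pos.2 (pow_pos hr _)).trans_le hh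
  calc (r ^ N)⁻¹ * (h * r ^ N)⁻¹ = (r ^ N)⁻¹ * (r ^ N)⁻¹ * h⁻¹ := by rw [mul_inv]; ring
    _ ≤ (r ^ N)⁻¹ * (r ^ N)⁻¹ * r ^ (2 * (3 * N + q + 1)) := by
        gcongr
        rwa [inv_le_comm₀ h0 (pow_pos hr _)]
    _ = r ^ (4 * N + q + 1) * r ^ (q + 1) := by
        rw [show 2 * (3 * N + q + 1) = N + N + (4 * N + q + 1) + (q + 1) by ring, pow_add, pow_add,
          pow_add]
        field_simp
    _ ≤ 1 * r ^ (q + 1) := by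
        gcongr
        exact pow_le_one₀ hr.le hr1
    _ = _ := one_mul _

end FixedParameter

/-! ### Globally smooth nets and the extension by zero -/

section SmoothNets

variable {ρ : Gauge}

theorem exists_smooth_net {A B : Type} [NormedCommRing A] [NormedAlgebra ℝ A]
    [FiniteDimensional ℝ A] [NormedCommRing B] [NormedAlgebra ℝ B] {X : Set (Gen ρ A)}
    {f : Gen ρ A → Gen ρ B} (hf : IsGSF X f) {S : Idx → Set A} (hS : NetsIn X S)
    (hc : ∀ ε, IsClosed (S ε)) :
    ∃ V : Idx → A → B, (∀ ε, ContDiff ℝ ∞ (V ε)) ∧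
      ∀ᶠ ε in atBot, ∀ x ∈ S ε, V ε =ᶠ[𝓝 x] defNet X f ε := by
  obtain ⟨Ω, hF⟩ := hf.defines
  have key : ∀ ε, ∃ V : A → B, ContDiff ℝ ∞ V ∧
      (S ε ⊆ Ω ε → ∀ x ∈ S ε, V =ᶠ[𝓝 x] defNet X f ε) := fun ε => by
    by_cases h : S ε ⊆ Ω ε
    · obtain ⟨V, h1, h2⟩ := exists_contDiff_eventuallyEq (hc ε) (hF.isOpen ε) h (hF.smooth ε)
      exact ⟨V, h1, fun _ => h2⟩
    · exact ⟨0, contDiff_const, fun h' => absurd h' h⟩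
  choose V h1 h2 using key
  exact ⟨V, h1, (hS.defines_subset hF).mono fun ε h => h2 ε h⟩

theorem inv_pow_le_inv_pow (ρ : Gauge) (ε : Idx) {m n : ℕ} (h : m ≤ n) :
    (ρ.net ε ^ m)⁻¹ ≤ (ρ.net ε ^ n)⁻¹ :=
  inv_anti₀ (pow_pos (ρ.pos ε) _) (pow_le_pow_of_le_one (ρ.pos ε).le (ρ.le_one ε) h)

variable {k : Gen ρ ℝ} {ke : Idx → ℝ} {v : Gen ρ ℝ → Gen ρ ℂ}

theorem self_mem_box (hk : Rep k ke) (hk0 : ∀ ε, 0 ≤ ke ε) : k ∈ box k :=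
  mem_box_of_eventually hk hk (Eventually.of_forall fun ε => ⟨by linarith [hk0 ε], le_rfl⟩)

theorem neg_self_mem_box (hk : Rep k ke) (hk0 : ∀ ε, 0 ≤ ke ε) : -k ∈ box k :=
  mem_box_of_eventually hk hk.neg (Eventually.of_forall fun ε => ⟨le_rfl, by linarith [hk0 ε]⟩)

theorem exists_smooth_net_box (hv : IsGSF (box k) v) (hk : Rep k ke) (hk0 : ∀ ε, 0 ≤ ke ε) :
    ∃ V : Idx → ℝ → ℂ, (∀ ε, ContDiff ℝ ∞ (V ε)) ∧
      (∀ x ∈ box k, ∀ xe, Rep x xe → (∀ᶠ ε in atBot, xe ε ∈ Icc (-ke ε) (ke ε)) →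
        Rep (v x) (fun ε => V ε (xe ε))) ∧
      ∃ N : ℕ, ∀ᶠ ε in atBot, ∀ z ∈ Icc (-ke ε) (ke ε),
        ‖V ε z‖ ≤ (ρ.net ε ^ N)⁻¹ ∧ ‖deriv (V ε) z‖ ≤ (ρ.net ε ^ N)⁻¹ := by
  have hS := netsIn_Icc_box hk (Eventually.of_forall hk0)
  obtain ⟨V, hV, hVe⟩ := exists_smooth_net hv hS fun ε => isClosed_Icc
  obtain ⟨Ω, hF⟩ := hv.defines
  obtain ⟨N₀, hN₀⟩ := hS.defines_moderate hF 0
  obtain ⟨N₁, hN₁⟩ := hS.defines_moderate hF 1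
  refine ⟨V, hV, fun x hx xe hxe hm => (hF.value x hx xe hxe).congr ?_, N₀ + N₁, ?_⟩
  · filter_upwards [hVe, hm] with ε h1 h2 using (h1 _ h2).eq_of_nhds
  · filter_upwards [hVe, hN₀, hN₁] with ε h1 h2 h3 z hz
    have e0 := (h1 z hz).eq_of_nhds
    have e1 := (h1 z hz).deriv_eq
    have b0 := h2 z hz
    have b1 := h3 z hz
    rw [norm_iteratedFDeriv_zero] at b0
    rw [norm_iteratedFDeriv_eq_norm_iteratedDeriv, iteratedDeriv_one] at b1
    rw [e0, e1]
    exact ⟨b0.trans (inv_pow_le_inv_pow ρ ε (by omega)), b1.trans (inv_pow_le_inv_pow ρ ε (by omega))⟩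

theorem Rep.clip {y : Gen ρ ℝ} {ye : Idx → ℝ} (hk : Rep k ke) (hy : Rep y ye) :
    Rep (clip k y) (fun ε => clipReal (ke ε) (ye ε)) := by
  have h : LipschitzWith (max 1 (max 1 1)) fun p : ℝ × ℝ => max (-p.1) (min p.2 p.1) :=
    LipschitzWith.prod_fst.neg.max (LipschitzWith.prod_snd.min LipschitzWith.prod_fst)
  exact (hk.pair hy).map h

theorem clip_mem_box (hk : Rep k ke) (hk0 : ∀ ε, 0 ≤ ke ε) (y : Gen ρ ℝ) : clip k y ∈ box k :=
  mem_box_of_eventually hk (hk.clip (rep_spec y))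
    (Eventually.of_forall fun ε => clipReal_mem (hk0 ε) _)

theorem continuous_transform {V : ℝ → ℂ} (hV : Continuous V) (k : ℝ) :
    Continuous fun w => ∫ z in (-k)..k, V z * character w z := by
  refine intervalIntegral.continuous_parametric_intervalIntegral_of_continuous'
    (f := fun w z => V z * character w z) ?_ _ _
  unfold character
  fun_prop

theorem rep_zeroExt (hk : Rep k ke) (hk0 : ∀ ε, 0 ≤ ke ε) {y : Gen ρ ℝ}
    {ye : Idx → ℝ} (hy : Rep y ye) {V : Idx → ℝ → ℂ}
    (hV : ∀ x ∈ box k, ∀ xe, Rep x xe → (∀ᶠ ε in atBot, xe ε ∈ Icc (-ke ε) (ke ε)) →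
      Rep (v x) (fun ε => V ε (xe ε))) :
    Rep (zeroExt k v y) (fun ε => (if 0 < rep (k - gnorm y) ε then (1 : ℂ) else 0) *
      V ε (clipReal (ke ε) (ye ε))) := by
  refine Rep.mul (Moderate.rep ⟨0, Eventually.of_forall fun ε => ?_⟩)
    (hV _ (clip_mem_box hk hk0 y) _ (hk.clip hy)
      (Eventually.of_forall fun ε => clipReal_mem (hk0 ε) _))
  beta_reduce
  split_ifs <;> simp

/-- Sharp interior points stay at distance at least a power of `ρ` from both ends, which settles the
test in `zeroExt` and bounds the inverse of `|y| - k`. -/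
theorem zeroExt_of_mem_interior (hv : IsGSF (box k) v) (hk : Rep k ke) (hk0 : ∀ ε, 0 ≤ ke ε)
    {y : Gen ρ ℝ} (hy : y ∈ boxInterior k) : zeroExt k v y = v y ∧ IsUnit (gnorm y - k) := by
  have hyb : y ∈ box k := ⟨hy.1.1, hy.2.1⟩
  obtain ⟨ye, hye, hm⟩ := exists_rep_mem_Icc hyb hk hk0
  obtain ⟨V, hV, hVv, -⟩ := exists_smooth_net_box hv hk hk0
  obtain ⟨m₁, h1⟩ := IsUnit.eventually_ge hy.1.2 (hye.sub hk.neg)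
  obtain ⟨m₂, h2⟩ := IsUnit.eventually_ge hy.2.2 (hk.sub hye)
  -- The test in `zeroExt` uses a fixed representative of `k - |y|`. One extra power makes its
  -- deviation at most half of the distance, so the sign is right.
  have hd := (rep_spec (k - gnorm y)).negligible_sub (hk.sub hye.gnorm) (m₁ + m₂ + 1)
  have hlt : ∀ᶠ ε in atBot, ρ.net ε ^ (m₁ + m₂) ≤ ke ε - |ye ε| := by
    filter_upwards [h1, h2] with ε h1 h2
    have p1 : ρ.net ε ^ (m₁ + m₂) ≤ ρ.net ε ^ m₁ :=
      pow_le_pow_of_le_one (ρ.pos ε).le (ρ.le_one ε) (by omega)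
    have p2 : ρ.net ε ^ (m₁ + m₂) ≤ ρ.net ε ^ m₂ :=
      pow_le_pow_of_le_one (ρ.pos ε).le (ρ.le_one ε) (by omega)
    have := hm ε
    rw [abs_of_nonneg (by linarith [this.1])] at h1
    rw [abs_of_nonneg (by linarith [this.2])] at h2
    rcases abs_cases (ye ε) with h | h <;> linarith
  constructor
  · refine (rep_zeroExt hk hk0 hye hVv).eq ((hVv y hyb ye hye (Eventually.of_forall hm)).congr ?_)
    filter_upwards [hd, hlt, eventually_mul_pow_le ρ 2 (m₁ + m₂)] with ε h1 h2 h3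
    have hp := pow_pos (ρ.pos ε) (m₁ + m₂)
    have h4 := (abs_le.1 h1).1
    simp only [Pi.sub_apply, Real.norm_eq_abs] at h4
    rw [if_pos (by linarith), one_mul, clipReal_of_mem (abs_le.2 (hm ε))]
  · have hinv : Moderate ρ ℝ fun ε => (|ye ε| - ke ε)⁻¹ := by
      refine (moderate_inv_pow ρ (m₁ + m₂)).of_le ?_
      filter_upwards [hlt] with ε h
      have hp := pow_pos (ρ.pos ε) (m₁ + m₂)
      rw [norm_inv, norm_inv]
      refine inv_anti₀ (norm_pos_iff.2 hp.ne') ?_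
      rw [Real.norm_of_nonneg hp.le, Real.norm_eq_abs, abs_sub_comm]
      exact h.trans (le_abs_self _)
    refine IsUnit.of_mul_eq_one _ (((hye.gnorm.sub hk).mul hinv.rep).eq (rep_one.congr ?_))
    filter_upwards [hlt] with ε h
    have hp := pow_pos (ρ.pos ε) (m₁ + m₂)
    exact mul_inv_cancel₀ (show ‖ye ε‖ - ke ε ≠ 0 by rw [Real.norm_eq_abs]; linarith)

end SmoothNets

/-! ### Fourier inversion and the free part of the solution -/

section Inversion

variable {ρ : Gauge} {k : Gen ρ ℝ} {ke : Idx → ℝ} {v : Gen ρ ℝ → Gen ρ ℂ}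

/-- The boundary terms and the target in the Dirichlet integral. -/
theorem eventually_boundary_le (hk : Rep k ke) (hk0 : ∀ ε, 0 ≤ ke ε)
    {V : Idx → ℝ → ℂ} (hVs : ∀ ε, ContDiff ℝ ∞ (V ε))
    (hV : ∀ x ∈ box k, ∀ xe, Rep x xe → (∀ᶠ ε in atBot, xe ε ∈ Icc (-ke ε) (ke ε)) →
      Rep (v x) (fun ε => V ε (xe ε)))
    {N₀ : ℕ} (hN₀ : ∀ᶠ ε in atBot, ∀ z ∈ Icc (-ke ε) (ke ε),
        ‖V ε z‖ ≤ (ρ.net ε ^ N₀)⁻¹ ∧ ‖deriv (V ε) z‖ ≤ (ρ.net ε ^ N₀)⁻¹)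
    {y : Gen ρ ℝ} {ye : Idx → ℝ} (hye : Rep y ye)
    (hy : IsUnit (gnorm y - k) ∨ (v k = 0 ∧ v (-k) = 0)) :
    ∃ N : ℕ, N₀ ≤ N ∧ ∀ q : ℕ, ∀ᶠ ε in atBot,
      (∀ h, (ρ.net ε ^ (2 * (3 * N + q + 1)))⁻¹ ≤ h →
        ‖V ε (ke ε)‖ * |sineInt (h * (ye ε - ke ε)) - SignType.sign (ye ε - ke ε) / 2| ≤
          ρ.net ε ^ (q + 1) ∧
        ‖V ε (-ke ε)‖ * |sineInt (h * (ye ε + ke ε)) - SignType.sign (ye ε + ke ε) / 2| ≤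
          ρ.net ε ^ (q + 1)) ∧
      ‖(V ε (clipReal (ke ε) (ye ε)) -
          V ε (ke ε) * ((1 / 2 + SignType.sign (ye ε - ke ε) / 2 : ℝ) : ℂ) -
          V ε (-ke ε) * ((1 / 2 - SignType.sign (ye ε + ke ε) / 2 : ℝ) : ℂ)) -
        (if 0 < rep (k - gnorm y) ε then (1 : ℂ) else 0) * V ε (clipReal (ke ε) (ye ε))‖ ≤
        4 * ρ.net ε ^ (q + 1) := by
  have hd := (rep_spec (k - gnorm y)).negligible_sub (hk.sub hye.gnorm)
  rcases hy with hy | ⟨hy1, hy2⟩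
  · obtain ⟨m, hm⟩ := IsUnit.eventually_ge hy (hye.gnorm.sub hk)
    refine ⟨N₀ + m, by omega, fun q => ?_⟩
    filter_upwards [hm, hN₀, hd (m + 1), eventually_mul_pow_le ρ 2 m] with ε h1 h2 h3 h4
    have hr := ρ.pos ε
    have hr1 := ρ.le_one ε
    have hp := pow_pos hr m
    have hP := pow_pos hr (N₀ + m)
    have hkε := hk0 ε
    have hpm : ρ.net ε ^ (N₀ + m) ≤ ρ.net ε ^ m := pow_le_pow_of_le_one hr.le hr1 (by omega)
    rw [Real.norm_eq_abs] at h1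
    -- Invertibility of `|y| - k` keeps `y ± k` above `ρ^m`, so the decay `(h|b|)⁻¹` of the sine
    -- integral beats the size of `V`.
    have hside : ∀ a b : ℝ, ‖V ε a‖ ≤ (ρ.net ε ^ N₀)⁻¹ → ρ.net ε ^ m ≤ |b| →
        ∀ h, (ρ.net ε ^ (2 * (3 * (N₀ + m) + q + 1)))⁻¹ ≤ h →
        ‖V ε a‖ * |sineInt (h * b) - SignType.sign b / 2| ≤ ρ.net ε ^ (q + 1) := by
      intro a b ha hb h hh
      have h0 : 0 < h := (inv_pos.2 (pow_pos hr _)).trans_le hh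
      have hb0 : b ≠ 0 := abs_pos.1 (hp.trans_le hb)
      have e1 := (abs_sineInt_sub_sign_le (h * b)).2 (mul_ne_zero h0.ne' hb0)
      rw [sign_mul, sign_pos h0, one_mul, abs_mul, abs_of_pos h0] at e1
      refine le_trans ?_ (boundary_term_le hr hr1 hh)
      refine mul_le_mul (ha.trans (inv_pow_le_inv_pow ρ ε (by omega))) (e1.trans ?_) (abs_nonneg _)
        (inv_nonneg.2 hP.le)
      exact inv_anti₀ (mul_pos h0 hP) (by gcongr; exact hpm.trans hb)
    refine ⟨fun h hh => ⟨hside _ _ (h2 _ ⟨by linarith, le_rfl⟩).1 ?_ h hh,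
      hside _ _ (h2 _ ⟨le_rfl, by linarith⟩).1 ?_ h hh⟩, ?_⟩
    · have := abs_abs_sub_abs_le_abs_sub (ye ε) (ke ε)
      rw [abs_of_nonneg hkε] at this
      exact h1.trans this
    · have := abs_abs_sub_abs_le_abs_sub (ye ε) (-ke ε)
      rw [abs_neg, abs_of_nonneg hkε, sub_neg_eq_add] at this
      exact h1.trans this
    · have h5 := abs_le.1 h3
      simp only [Pi.sub_apply, Real.norm_eq_abs] at h5
      have hz : (0 : ℝ) ≤ 4 * ρ.net ε ^ (q + 1) := by positivity
      refine le_trans (le_of_eq ?_) hz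
      rw [norm_eq_zero]
      -- Equality is exact here. Outside the interval the clipped point is an endpoint and its value
      -- is cancelled by the full boundary term; inside, both boundary coefficients vanish.
      rcases le_abs.1 h1 with h6 | h6
      · rw [if_neg (by linarith)]
        rcases le_abs.1 (show ke ε ≤ |ye ε| by linarith) with h7 | h7
        · rw [abs_of_nonneg (by linarith)] at h6
          rw [clipReal_of_ge hkε h7, sign_pos (by linarith), sign_pos (by linarith)]
          simp only [SignType.coe_one]; push_cast; ring
        · rw [abs_of_nonpos (by linarith)] at h6
          rw [clipReal_of_le (by linarith), sign_neg (by linarith), sign_neg (by linarith)]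
          simp only [SignType.coe_neg_one]; push_cast; ring
      · rw [if_pos (by linarith)]
        have h8 := abs_lt.1 (show |ye ε| < ke ε by linarith)
        rw [sign_neg (by linarith), sign_pos (by linarith)]
        simp only [SignType.coe_one, SignType.coe_neg_one]; push_cast; ring
  · have hk1 := (hy1 ▸ hV k (self_mem_box hk hk0) ke hk
      (Eventually.of_forall fun ε => ⟨by linarith [hk0 ε], le_rfl⟩)).eq_zero_iff.1 rfl
    have hk2 := (hy2 ▸ hV (-k) (neg_self_mem_box hk hk0) _ hk.neg
      (Eventually.of_forall fun ε => ⟨le_rfl, by linarith [hk0 ε]⟩)).eq_zero_iff.1 rfl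
    refine ⟨N₀, le_rfl, fun q => ?_⟩
    filter_upwards [hN₀, hk1 (q + 1), hk2 (q + 1), hd (N₀ + (q + 1))] with ε h2 h3 h4 h5
    have hr := ρ.pos ε
    have hkε := hk0 ε
    have hrq := pow_pos hr (q + 1)
    have hsign : ∀ b : ℝ, |(1 / 2 + SignType.sign b / 2 : ℝ)| ≤ 1 ∧
        |(1 / 2 - SignType.sign b / 2 : ℝ)| ≤ 1 := fun b => by
      rcases lt_trichotomy b 0 with h | rfl | h
      · rw [sign_neg h]; norm_num
      · rw [sign_zero]; norm_num
      · rw [sign_pos h]; norm_num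
    refine ⟨fun h hh => ?_, ?_⟩
    · have h0 : 0 < h := (inv_pos.2 (pow_pos hr _)).trans_le hh
      have e : ∀ b : ℝ, |sineInt (h * b) - SignType.sign b / 2| ≤ 1 := fun b => by
        have := (abs_sineInt_sub_sign_le (h * b)).1
        rwa [sign_mul, sign_pos h0, one_mul] at this
      constructor
      · calc _ ≤ ρ.net ε ^ (q + 1) * 1 := mul_le_mul h3 (e _) (abs_nonneg _) hrq.le
          _ = _ := mul_one _
      · calc _ ≤ ρ.net ε ^ (q + 1) * 1 := mul_le_mul h4 (e _) (abs_nonneg _) hrq.le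
          _ = _ := mul_one _
    · set p := clipReal (ke ε) (ye ε) with hp
      have b1 : ‖V ε (ke ε) * ((1 / 2 + SignType.sign (ye ε - ke ε) / 2 : ℝ) : ℂ)‖ ≤
          ρ.net ε ^ (q + 1) := by
        rw [norm_mul, Complex.norm_real, Real.norm_eq_abs]
        calc _ ≤ ρ.net ε ^ (q + 1) * 1 := mul_le_mul h3 (hsign _).1 (abs_nonneg _) hrq.le
          _ = _ := mul_one _
      have b2 : ‖V ε (-ke ε) * ((1 / 2 - SignType.sign (ye ε + ke ε) / 2 : ℝ) : ℂ)‖ ≤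
          ρ.net ε ^ (q + 1) := by
        rw [norm_mul, Complex.norm_real, Real.norm_eq_abs]
        calc _ ≤ ρ.net ε ^ (q + 1) * 1 := mul_le_mul h4 (hsign _).2 (abs_nonneg _) hrq.le
          _ = _ := mul_one _
      -- If the test fails, then the clipped point lies within `ρ^(N₀+q+1)` of an endpoint. There
      -- `V` is negligible, and its derivative is at most `ρ^(-N₀)`, so `V` is small at `p` as well.
      have b3 : ‖V ε p - (if 0 < rep (k - gnorm y) ε then (1 : ℂ) else 0) * V ε p‖ ≤
          2 * ρ.net ε ^ (q + 1) := by
        by_cases hc : 0 < rep (k - gnorm y) ε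
        · rw [if_pos hc, one_mul, sub_self, norm_zero]; positivity
        rw [if_neg hc, zero_mul, sub_zero]
        have h6 := (abs_le.1 h5).1
        simp only [Pi.sub_apply, Real.norm_eq_abs] at h6
        have h7 : ke ε - |ye ε| ≤ ρ.net ε ^ (N₀ + (q + 1)) := by linarith
        have hmv : ∀ a ∈ Icc (-ke ε) (ke ε), ∀ b ∈ Icc (-ke ε) (ke ε),
            ‖V ε b - V ε a‖ ≤ (ρ.net ε ^ N₀)⁻¹ * ‖b - a‖ := fun a ha b hb =>
          (convex_Icc (-ke ε) (ke ε)).norm_image_sub_le_of_norm_deriv_le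
            (fun x _ => ((hVs ε).differentiable (by simp)) x) (fun x hx => (h2 x hx).2) ha hb
        have hpm := clipReal_mem hkε (ye ε)
        rw [← hp] at hpm
        have hfin : ∀ a ∈ Icc (-ke ε) (ke ε), ‖V ε a‖ ≤ ρ.net ε ^ (q + 1) →
            |p - a| ≤ ρ.net ε ^ (N₀ + (q + 1)) → ‖V ε p‖ ≤ 2 * ρ.net ε ^ (q + 1) := by
          intro a ha hVa hpa
          have e1 := hmv a ha p hpm
          have e2 : (ρ.net ε ^ N₀)⁻¹ * ‖p - a‖ ≤ ρ.net ε ^ (q + 1) := by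
            have := pow_pos hr N₀
            calc (ρ.net ε ^ N₀)⁻¹ * ‖p - a‖ ≤ (ρ.net ε ^ N₀)⁻¹ * ρ.net ε ^ (N₀ + (q + 1)) := by
                  gcongr; exact hpa
              _ = _ := by rw [pow_add]; field_simp
          have e3 := norm_add_le (V ε p - V ε a) (V ε a)
          rw [sub_add_cancel] at e3
          linarith
        have hpos := (pow_pos hr (N₀ + (q + 1))).le
        rcases le_total 0 (ye ε) with h8 | h8
        · rw [abs_of_nonneg h8] at h7
          refine hfin (ke ε) ⟨by linarith, le_rfl⟩ h3 ?_
          rw [abs_sub_comm, abs_of_nonneg (by linarith [hpm.2])]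
          rcases le_total (ke ε) (ye ε) with h9 | h9
          · rw [hp, clipReal_of_ge hkε h9, sub_self]; exact hpos
          · rw [hp, clipReal_of_mem (by rw [abs_of_nonneg h8]; exact h9)]; exact h7
        · rw [abs_of_nonpos h8] at h7
          refine hfin (-ke ε) ⟨le_rfl, by linarith⟩ h4 ?_
          rw [abs_of_nonneg (by linarith [hpm.1])]
          rcases le_total (ye ε) (-ke ε) with h9 | h9
          · rw [hp, clipReal_of_le h9, sub_self]; exact hpos
          · rw [hp, clipReal_of_mem (by rw [abs_of_nonpos h8]; linarith)]; linarith
      have heq : ∀ a b c d : ℂ, a - b - c - d = (a - d) - b - c := fun a b c d => by ring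
      rw [heq]
      have e1 := norm_sub_le (V ε p - (if 0 < rep (k - gnorm y) ε then (1 : ℂ) else 0) * V ε p -
        V ε (ke ε) * ((1 / 2 + SignType.sign (ye ε - ke ε) / 2 : ℝ) : ℂ))
        (V ε (-ke ε) * ((1 / 2 - SignType.sign (ye ε + ke ε) / 2 : ℝ) : ℂ))
      have e2 := norm_sub_le (V ε p - (if 0 < rep (k - gnorm y) ε then (1 : ℂ) else 0) * V ε p)
        (V ε (ke ε) * ((1 / 2 + SignType.sign (ye ε - ke ε) / 2 : ℝ) : ℂ))
      linarith

/-- Fourier inversion on `[-k, k]`. -/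
theorem limAtTop_invHFT_HFT (hv : IsGSF (box k) v) (hk : Rep k ke) (hk0 : ∀ ε, 0 ≤ ke ε)
    {y : Gen ρ ℝ} (hy : IsUnit (gnorm y - k) ∨ (v k = 0 ∧ v (-k) = 0)) :
    LimAtTop (fun h => invHFT h (HFT k v) y) (zeroExt k v y) := by
  obtain ⟨V, hVs, hV, N₀, hN₀⟩ := exists_smooth_net_box hv hk hk0
  have hye := rep_spec y
  obtain ⟨N₁, hN₁, hb⟩ := eventually_boundary_le hk hk0 hVs hV hN₀ hye hy
  obtain ⟨N₂, hN₂⟩ := hk.1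
  have hk0' : ∀ᶠ ε in atBot, 0 ≤ ke ε := Eventually.of_forall hk0
  intro q
  obtain ⟨h₀, hh₀⟩ := exists_forall_ge_eventually_inv_pow_le ρ (2 * (3 * (N₁ + N₂) + q + 1))
  refine ⟨h₀, fun h hh => ?_⟩
  have hhe := rep_spec h
  have hge := hh₀ h hh _ hhe
  have hh0 : ∀ᶠ ε in atBot, 0 ≤ rep h ε := hge.mono fun ε h =>
    (inv_nonneg.2 (pow_pos (ρ.pos ε) _).le).trans h
  have hr1 := invHFT_rep (isGSF_HFT hv hk hk0' (box h)) hhe hh0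
    (F := fun ε w => ∫ z in (-ke ε)..ke ε, V ε z * character w z)
    (fun w _ we hwe => HFT_rep hv hk hk0' hV
      (Eventually.of_forall fun ε => (hVs ε).continuous.continuousOn) hwe)
    (Eventually.of_forall fun ε => continuous_transform (hVs ε).continuous _) hye
  have hr2 := rep_zeroExt hk hk0 hye hV
  refine gnorm_le_dRho_pow (hr1.sub hr2) ?_
  -- The factor `10` adds up two boundary terms, `4` from the Dirichlet error and `4` from replacing
  -- the target by the extension by zero.
  filter_upwards [hge, hb q, hN₀, hN₂, eventually_mul_pow_le ρ 10 q] with ε h1 h2 h3 h4 h5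
  have hr := ρ.pos ε
  have hle := ρ.le_one ε
  have hpow : (ρ.net ε ^ (2 * (3 * N₁ + q + 1)))⁻¹ ≤ rep h ε :=
    (inv_pow_le_inv_pow ρ ε (by omega)).trans h1
  have h0 : 0 < rep h ε := (inv_pos.2 (pow_pos hr _)).trans_le h1
  obtain ⟨b1, b2⟩ := h2.1 _ hpow
  have hkN : ke ε ≤ (ρ.net ε ^ (N₁ + N₂))⁻¹ :=
    ((le_abs_self _).trans h4).trans (inv_pow_le_inv_pow ρ ε (by omega))
  have hD := norm_dirichlet_sub_le (y := rep y ε) (hk0 ε) h0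
    (η := ρ.net ε ^ (3 * (N₁ + N₂) + q + 1)) (pow_pos hr _)
    (fun z _ => ((hVs ε).differentiable (by simp) z).hasDerivAt)
    ((hVs ε).continuous_deriv (by simp)).continuousOn
    (M := (ρ.net ε ^ (N₁ + N₂))⁻¹)
    (fun z hz => (h3 z hz).2.trans (inv_pow_le_inv_pow ρ ε (by omega)))
  have hE := error_term_le hr hle hkN h1
  have hEP : 4 * (ρ.net ε ^ (N₁ + N₂) * ρ.net ε ^ (q + 1)) ≤ 4 * (1 * ρ.net ε ^ (q + 1)) := by
    gcongr
    exact pow_le_one₀ hr.le hle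
  rw [inverse_transform_eq (hVs ε).continuous]
  have hT := norm_sub_le_norm_sub_add_norm_sub
    (∫ z in (-ke ε)..ke ε, V ε z * ((Real.pi⁻¹ * rep h ε * Real.sinc (rep h ε * (rep y ε - z)) : ℝ) : ℂ))
    (V ε (clipReal (ke ε) (rep y ε)) -
          V ε (ke ε) * ((1 / 2 + SignType.sign (rep y ε - ke ε) / 2 : ℝ) : ℂ) -
          V ε (-ke ε) * ((1 / 2 - SignType.sign (rep y ε + ke ε) / 2 : ℝ) : ℂ))
    ((if 0 < rep (k - gnorm y) ε then (1 : ℂ) else 0) * V ε (clipReal (ke ε) (rep y ε)))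
  have h6 := h2.2
  linarith

theorem Rep.units_inv {c : (Gen ρ ℝ)ˣ} {ce : Idx → ℝ} (hc : Rep (c : Gen ρ ℝ) ce) :
    Rep (↑c⁻¹ : Gen ρ ℝ) (fun ε => (ce ε)⁻¹) := by
  obtain ⟨m, hm⟩ := IsUnit.eventually_ge c.isUnit hc
  have hmod : Moderate ρ ℝ fun ε => (ce ε)⁻¹ := by
    refine (moderate_inv_pow ρ m).of_le ?_
    filter_upwards [hm] with ε h
    have hp := pow_pos (ρ.pos ε) m
    rw [norm_inv, norm_inv, Real.norm_of_nonneg hp.le]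
    exact inv_anti₀ hp h
  have h1 : (c : Gen ρ ℝ) * ofNet ρ (fun ε => (ce ε)⁻¹) = 1 := by
    refine (hc.mul hmod.rep).eq (rep_one.congr ?_)
    filter_upwards [hm] with ε h
    exact mul_inv_cancel₀ (abs_pos.1 ((pow_pos (ρ.pos ε) m).trans_le h))
  rw [Units.inv_eq_of_mul_eq_one_right h1]
  exact hmod.rep

/-- The inverse transform of `F_k(g)(w) t S(cwt)` is a mean of `g`, extended by zero. -/
theorem limAtTop_invHFT_mul_gS {g : Gen ρ ℝ → Gen ρ ℂ} (hg : IsGSF (box k) g) (hk : Rep k ke)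
    (hk0 : ∀ ε, 0 ≤ ke ε) (c : (Gen ρ ℝ)ˣ) (x t : Gen ρ ℝ) :
    LimAtTop (fun h => invHFT h (fun w => HFT k g w * toC (t * gS ((c : Gen ρ ℝ) * w * t))) x)
      (const ρ (1 / 2 : ℂ) * toC ↑c⁻¹ * gint (box k) g (clip k (x - ↑c * t)) (clip k (x + ↑c * t))) := by
  obtain ⟨V, hVs, hV, N₀, hN₀⟩ := exists_smooth_net_box hg hk hk0
  have hx := rep_spec x
  have ht := rep_spec t
  have hc := rep_spec (c : Gen ρ ℝ)
  have hci := hc.units_inv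
  obtain ⟨m, hm⟩ := IsUnit.eventually_ge c.isUnit hc
  obtain ⟨N₂, hN₂⟩ := hk.1
  have hk0' : ∀ᶠ ε in atBot, 0 ≤ ke ε := Eventually.of_forall hk0
  intro q
  obtain ⟨h₀, hh₀⟩ := exists_forall_ge_eventually_inv_pow_le ρ (2 * (3 * (N₀ + N₂ + m) + q + 1))
  refine ⟨h₀, fun h hh => ?_⟩
  have hhe := rep_spec h
  have hge := hh₀ h hh _ hhe
  have hh0 : ∀ᶠ ε in atBot, 0 ≤ rep h ε := hge.mono fun ε h =>
    (inv_nonneg.2 (pow_pos (ρ.pos ε) _).le).trans h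
  have hr1 := invHFT_rep ((isGSF_HFT hg hk hk0' (box h)).mul (isGSF_toC_mul_gS (c : Gen ρ ℝ) t _))
    hhe hh0 (F := fun ε w => (∫ z in (-ke ε)..ke ε, V ε z * character w z) *
      ((rep t ε * Real.sinc (rep (c : Gen ρ ℝ) ε * w * rep t ε) : ℝ) : ℂ))
    (fun w _ we hwe => (HFT_rep hg hk hk0' hV
      (Eventually.of_forall fun ε => (hVs ε).continuous.continuousOn) hwe).mul
        (ht.mul ((hc.mul hwe).mul ht).gS).toC)
    (Eventually.of_forall fun ε => (continuous_transform (hVs ε).continuous _).mul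
      (Complex.continuous_ofReal.comp (continuous_const.mul
        (Real.continuous_sinc.comp (by fun_prop))))) hx
  have hclip : ∀ ε y, clipReal (ke ε) y ∈ Icc (-ke ε) (ke ε) := fun ε y => clipReal_mem (hk0 ε) y
  have hr2 := ((rep_const (ρ := ρ) (1 / 2 : ℂ)).mul hci.toC).mul (gint_rep hg
    (hk.clip (hx.sub (hc.mul ht))) (hk.clip (hx.add (hc.mul ht)))
    (netsIn_uIcc_box (clip_mem_box hk hk0 _) (clip_mem_box hk hk0 _) (hk.clip (hx.sub (hc.mul ht)))
      (hk.clip (hx.add (hc.mul ht))))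
    (fun z hz ze hze hm => hV z hz ze hze (hm.mono fun ε h =>
      (uIcc_subset_Icc (hclip _ _) (hclip _ _)) h))
    (Eventually.of_forall fun ε => (hVs ε).continuous.intervalIntegrable _ _))
  refine gnorm_le_dRho_pow (hr1.sub hr2) ?_
  filter_upwards [hge, hm, hN₀, hN₂, eventually_mul_pow_le ρ 4 q] with ε h1 h2 h3 h4 h5
  have hr := ρ.pos ε
  have hle := ρ.le_one ε
  have hP := pow_pos hr (N₀ + N₂ + m)
  have hcne : rep (c : Gen ρ ℝ) ε ≠ 0 := abs_pos.1 ((pow_pos hr m).trans_le h2)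
  have h0 : 0 < rep h ε := (inv_pos.2 (pow_pos hr _)).trans_le h1
  have hkN : ke ε ≤ (ρ.net ε ^ (N₀ + N₂ + m))⁻¹ :=
    ((le_abs_self _).trans h4).trans (inv_pow_le_inv_pow ρ ε (by omega))
  have hD := norm_integral_sineInt_sub_le (a := rep x ε + rep (c : Gen ρ ℝ) ε * rep t ε)
    (b := rep x ε - rep (c : Gen ρ ℝ) ε * rep t ε) (hk0 ε) h0
    (η := ρ.net ε ^ (3 * (N₀ + N₂ + m) + q + 1)) (pow_pos hr _) (hVs ε).continuous
    (M := (ρ.net ε ^ (N₀ + N₂ + m))⁻¹)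
    (fun z hz => (h3 z hz).1.trans (inv_pow_le_inv_pow ρ ε (by omega)))
  have hE := error_term_le hr hle hkN h1
  rw [inverse_transform_sinc_eq (hVs ε).continuous hcne, ← mul_sub, norm_mul, norm_mul,
    Complex.norm_real, norm_inv, Real.norm_eq_abs]
  -- The spare power of `ρ` in `error_term_le` cancels this bound.
  have hcb : |rep (c : Gen ρ ℝ) ε|⁻¹ ≤ (ρ.net ε ^ (N₀ + N₂ + m))⁻¹ :=
    inv_anti₀ hP ((pow_le_pow_of_le_one hr.le hle (by omega)).trans h2)
  have h12 : ‖(1 / 2 : ℂ)‖ = 1 / 2 := by norm_num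
  rw [h12]
  calc _ ≤ 1 / 2 * (ρ.net ε ^ (N₀ + N₂ + m))⁻¹ *
        (2 * (4 * (ρ.net ε ^ (N₀ + N₂ + m) * ρ.net ε ^ (q + 1)))) := by
        gcongr
        exact hD.trans (by linarith)
    _ = 4 * ρ.net ε ^ (q + 1) := by field_simp
    _ ≤ _ := h5

end Inversion

/-! ### The transform of the solution, its limit and the boundary contribution -/

section Strip

variable {ρ : Gauge} {k c t : Gen ρ ℝ} {ke ce te : Idx → ℝ} {f g : Gen ρ ℝ → Gen ρ ℂ}
  {u : Gen ρ (ℝ × ℝ) → Gen ρ ℂ}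

theorem IsInfinite.exists_rep_one_le (hi : IsInfinite k) (hk : 0 < k) :
    ∃ ke, Rep k ke ∧ ∀ ε, 1 ≤ ke ε := by
  obtain ⟨ke, hke, h0⟩ := exists_rep_nonneg (t := k) hk.1
  refine ⟨fun ε => max 1 (ke ε), hke.congr ?_, fun ε => le_max_left _ _⟩
  -- Comparison with `2`, minus the slack `ρ^0 = 1`, leaves the bound `1`.
  filter_upwards [(le_iff_forall (rep_const 2) hke.gnorm).1 (hi 2 two_pos) 0] with ε h
  rw [Real.norm_of_nonneg (h0 ε), pow_zero] at h
  exact max_eq_right (by linarith)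

theorem netsIn_strip (hk : Rep k ke) (hk0 : ∀ ε, 0 ≤ ke ε) (ht : Rep t te) (ht0 : ∀ ε, 0 ≤ te ε) :
    NetsIn (strip k) (fun ε => Icc (-ke ε) (ke ε) ×ˢ Icc 0 (te ε)) := by
  refine ⟨Eventually.of_forall fun ε => ⟨(0, 0), ?_, le_rfl, ht0 ε⟩, fun p hp => ?_⟩
  · exact ⟨by linarith [hk0 ε], hk0 ε⟩
  · obtain ⟨x, hx, hxe⟩ := (netsIn_Icc_box hk (Eventually.of_forall hk0)).2 (fun ε => (p ε).1)
      (hp.mono fun ε h => h.1)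
    obtain ⟨s, hs, hse⟩ := (netsIn_uIcc_nonneg
      (mem_nonneg_of_eventually rep_zero (Eventually.of_forall fun _ => le_rfl))
      (mem_nonneg_of_eventually ht (Eventually.of_forall ht0)) rep_zero ht).2 (fun ε => (p ε).2)
      (hp.mono fun ε h => by beta_reduce; rw [uIcc_of_le (ht0 ε)]; exact h.2)
    exact ⟨_, ⟨x, hx, s, hs, rfl⟩, hxe.pair hse⟩

/-- The net `V` of smooth functions on the plane defines `u` and its directional derivatives on
`[-k_ε, k_ε] × [0, t_ε]`. -/
structure RepresentsOn (k : Gen ρ ℝ) (u : Gen ρ (ℝ × ℝ) → Gen ρ ℂ) (ke te : Idx → ℝ)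
    (V : Idx → ℝ × ℝ → ℂ) : Prop where
  smooth : ∀ ε, ContDiff ℝ ∞ (V ε)
  gderiv : ∀ y ∈ box k, ∀ ye, Rep y ye → (∀ᶠ ε in atBot, ye ε ∈ Icc (-ke ε) (ke ε)) →
    ∀ s ∈ nonneg ρ, ∀ se, Rep s se → (∀ᶠ ε in atBot, se ε ∈ Icc 0 (te ε)) → ∀ m v,
      Rep (gderiv (strip k) m v u (pair y s)) (fun ε => dirDeriv (V ε) m v (ye ε, se ε))
  value : ∀ y ∈ box k, ∀ ye, Rep y ye → (∀ᶠ ε in atBot, ye ε ∈ Icc (-ke ε) (ke ε)) →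
    ∀ s ∈ nonneg ρ, ∀ se, Rep s se → (∀ᶠ ε in atBot, se ε ∈ Icc 0 (te ε)) →
      Rep (u (pair y s)) (fun ε => V ε (ye ε, se ε))

theorem exists_representsOn (hu : IsGSF (strip k) u) (hk : Rep k ke) (hk0 : ∀ ε, 0 ≤ ke ε)
    (ht : Rep t te) (ht0 : ∀ ε, 0 ≤ te ε) : ∃ V, RepresentsOn k u ke te V := by
  obtain ⟨V, hV, hVe⟩ := exists_smooth_net hu (netsIn_strip hk hk0 ht ht0)
    fun ε => isClosed_Icc.prod isClosed_Icc
  obtain ⟨Ω, hF⟩ := hu.defines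
  refine ⟨V, hV, fun y hy ye hye hm s hs se hse hm' m v => ?_, fun y hy ye hye hm s hs se hse hm' => ?_⟩
  · refine (hF.rep_iteratedFDeriv ⟨y, hy, s, hs, rfl⟩ (hye.pair hse) m v).congr ?_
    filter_upwards [hVe, hm, hm'] with ε h1 h2 h3
    rw [dirDeriv, ((h1 _ ⟨h2, h3⟩).iteratedFDeriv ℝ m).eq_of_nhds]
  · refine (hF.value _ ⟨y, hy, s, hs, rfl⟩ _ (hye.pair hse)).congr ?_
    filter_upwards [hVe, hm, hm'] with ε h1 h2 h3 using (h1 _ ⟨h2, h3⟩).eq_of_nhds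

theorem isGSF_time (hu : IsGSF (strip k) u) {y : Gen ρ ℝ} (hy : y ∈ box k) :
    IsGSF (nonneg ρ) (fun s => u (pair y s)) :=
  isGSF_slice hu (ContinuousLinearMap.inr ℝ ℝ ℝ) (fun ε => (rep y ε, 0))
    (fun s hs => ⟨y, hy, s, hs, rfl⟩) fun s _ se hse =>
      ((rep_spec y).pair hse).congr (Eventually.of_forall fun ε => by simp)

theorem isGSF_space (hu : IsGSF (strip k) u) (ht : t ∈ nonneg ρ) :
    IsGSF (box k) (fun y => u (pair y t)) :=
  isGSF_slice hu (ContinuousLinearMap.inl ℝ ℝ ℝ) (fun ε => (0, rep t ε))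
    (fun y hy => ⟨y, hy, t, ht, rfl⟩) fun y _ ye hye =>
      (hye.pair (rep_spec t)).congr (Eventually.of_forall fun ε => by simp)

theorem isGSF_dX (hu : IsGSF (strip k) u) {y : Gen ρ ℝ} (hy : y ∈ box k) :
    IsGSF (nonneg ρ) (fun s => dX k 1 u y s) :=
  isGSF_time (hu.gderiv (1, 0)) hy

/-- Integrals of the boundary term against smooth kernels. -/
theorem paramGSF_waveBdry (hu : IsGSF (strip k) u) (hk : Rep k ke) (hk0 : ∀ ε, 0 ≤ ke ε)
    (ht : Rep t te) (ht0 : ∀ ε, 0 ≤ te ε) {φ : ℝ → ℂ} (hφ : Tame φ)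
    (hφ0 : ∃ C : ℝ, ∀ x, ‖φ x‖ ≤ C) {a : Gen ρ ℝ → Gen ρ ℂ} (ha : IsGSF (nonneg ρ) a)
    (c : Gen ρ ℝ) (Y : Set (Gen ρ ℝ)) : ParamGSF (nonneg ρ) Y 0 t
      (fun w s => a s * waveBdry k c u w s * map φ (c * w * s)) := by
  have hX : NetsIn (nonneg ρ) fun ε => uIcc 0 (te ε) := netsIn_uIcc_nonneg
    (mem_nonneg_of_eventually rep_zero (Eventually.of_forall fun _ => le_rfl))
    (mem_nonneg_of_eventually ht (Eventually.of_forall ht0)) rep_zero ht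
  have hp : ∀ {p C : Gen ρ ℝ → Gen ρ ℂ}, IsGSF (nonneg ρ) p → IsGSF Y C →
      -- The boundary term is a sum of four products of a function of `w` with a boundary value
      -- depending on `s`, so smoothness in `w` reduces to this separated form.
      ParamGSF (nonneg ρ) Y 0 t (fun w s => C w * (a s * p s * map φ (c * w * s))) :=
    fun h hC => (paramGSF_mul_map (ha.mul h) rep_zero ht hX hφ hφ0 c Y).const_mul hC rep_zero ht hX
  have hb := self_mem_box hk hk0
  have hb' := neg_self_mem_box hk hk0
  have hI : IsGSF Y (fun w => toC (c ^ 2) * (const ρ Complex.I * toC w)) :=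
    (isGSF_const Y _).mul ((isGSF_const Y _).mul (isGSF_toC Y))
  have h1 := hp (isGSF_time hu hb) (hI.mul (isGSF_gcis_mul (-k) Y))
  have h2 := hp (isGSF_time hu hb') (hI.mul (isGSF_gcis_mul k Y)).neg
  have h3 := hp (isGSF_dX hu hb) ((isGSF_const Y (toC (c ^ 2))).mul (isGSF_gcis_mul (-k) Y))
  have h4 := hp (isGSF_dX hu hb') ((isGSF_const Y (toC (c ^ 2))).mul (isGSF_gcis_mul k Y)).neg
  convert ((h1.add h2 rep_zero ht hX).add h3 rep_zero ht hX).add h4 rep_zero ht hX using 3 with w s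
  simp only [waveBdry, bdry, neg_mul]
  ring

theorem paramGSF_waveBdry_gcos (hu : IsGSF (strip k) u) (hk : Rep k ke) (hk0 : ∀ ε, 0 ≤ ke ε)
    (ht : Rep t te) (ht0 : ∀ ε, 0 ≤ te ε) (c : Gen ρ ℝ) (Y : Set (Gen ρ ℝ)) :
    ParamGSF (nonneg ρ) Y 0 t (fun w s => waveBdry k c u w s * toC (gcos (c * w * s))) := by
  simpa only [one_mul, ← toC_gcos] using paramGSF_waveBdry hu hk hk0 ht ht0 tame_cos
    ⟨1, norm_iteratedDeriv_cos_le 0⟩ (isGSF_const _ 1) c Y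

theorem paramGSF_waveBdry_gS (hu : IsGSF (strip k) u) (hk : Rep k ke) (hk0 : ∀ ε, 0 ≤ ke ε)
    (ht : Rep t te) (ht0 : ∀ ε, 0 ≤ te ε) (c : Gen ρ ℝ) (Y : Set (Gen ρ ℝ)) :
    ParamGSF (nonneg ρ) Y 0 t (fun w s => toC s * waveBdry k c u w s * toC (gS (c * w * s))) := by
  simpa only [← toC_gS] using paramGSF_waveBdry hu hk hk0 ht ht0 tame_sinc
    ⟨1, fun x => by
      rw [Complex.norm_real]; exact Real.abs_sinc_le_one x⟩ (isGSF_toC _) c Y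

variable {V : Idx → ℝ × ℝ → ℂ}

theorem RepresentsOn.waveBdry (hV : RepresentsOn k u ke te V) (hk : Rep k ke)
    (hk0 : ∀ ε, 0 ≤ ke ε) (hc : Rep c ce) {w s : Gen ρ ℝ} {we se : Idx → ℝ} (hw : Rep w we)
    (hs : s ∈ nonneg ρ) (hse : Rep s se) (hm : ∀ᶠ ε in atBot, se ε ∈ Icc 0 (te ε)) :
    Rep (waveBdry k c u w s)
      (fun ε => boundaryTerm (V ε) (ke ε) (ce ε) (we ε) (se ε)) := by
  have hb := self_mem_box hk hk0
  have hb' := neg_self_mem_box hk hk0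
  have m1 : ∀ᶠ ε in atBot, ke ε ∈ Icc (-ke ε) (ke ε) :=
    Eventually.of_forall fun ε => ⟨by linarith [hk0 ε], le_rfl⟩
  have m2 : ∀ᶠ ε in atBot, -ke ε ∈ Icc (-ke ε) (ke ε) :=
    Eventually.of_forall fun ε => ⟨le_rfl, by linarith [hk0 ε]⟩
  have g1 := (hk.mul hw).neg.gcis
  have g2 := (hk.mul hw).gcis
  refine ((hc.pow 2).toC.mul ((((rep_const Complex.I).mul hw.toC).mul
    (((hV.value k hb ke hk m1 s hs se hse hm).mul g1).sub
      ((hV.value (-k) hb' _ hk.neg m2 s hs se hse hm).mul g2))).add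
    (((hV.gderiv k hb ke hk m1 s hs se hse hm 1 (1, 0)).mul g1).sub
      ((hV.gderiv (-k) hb' _ hk.neg m2 s hs se hse hm 1 (1, 0)).mul g2)))).congr
    (Eventually.of_forall fun ε => ?_)
  simp only [boundaryTerm, character]
  rw [show -1 * we ε * ke ε = -(ke ε * we ε) by ring, show -1 * we ε * -ke ε = ke ε * we ε by ring]
  push_cast
  rfl

/-- The equation holds at every generalized point of the strip, hence negligibly along every net in
it, and therefore uniformly. -/
theorem IsWaveSolution.eventually_wave_le (hu : IsWaveSolution k c f g u)
    (hV : RepresentsOn k u ke te V) (hk : Rep k ke) (hk0 : ∀ ε, 0 ≤ ke ε) (ht : Rep t te)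
    (ht0 : ∀ ε, 0 ≤ te ε) (hc : Rep c ce) (n : ℕ) :
    ∀ᶠ ε in atBot, ∀ p ∈ Icc (-ke ε) (ke ε) ×ˢ Icc 0 (te ε),
      ‖dirDeriv (V ε) 2 (0, 1) p - (ce ε : ℂ) ^ 2 * dirDeriv (V ε) 2 (1, 0) p‖ ≤ ρ.net ε ^ n := by
  refine uniform_eventually (netsIn_strip hk hk0 ht ht0).1
    (P := fun ε p => ‖dirDeriv (V ε) 2 (0, 1) p - (ce ε : ℂ) ^ 2 * dirDeriv (V ε) 2 (1, 0) p‖ ≤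
      ρ.net ε ^ n) fun p hp => ?_
  obtain ⟨_, ⟨x, hx, s, hs, rfl⟩, hr⟩ := (netsIn_strip hk hk0 ht ht0).2 p hp
  have hd := hV.gderiv x hx _ hr.of_pair_fst (hp.mono fun ε h => h.1) s hs _ hr.of_pair_snd
    (hp.mono fun ε h => h.2) 2
  have h0 := ((hd (0, 1)).sub ((hc.pow 2).toC.mul (hd (1, 0)))).eq_zero_iff.1
    (sub_eq_zero.2 (hu.wave x hx s hs)) n
  filter_upwards [h0] with ε h
  simpa using h

/-- The transform of the solution at the time `t`. -/
theorem IsWaveSolution.HFT_eq (hu : IsWaveSolution k c f g u) (hf : IsGSF (box k) f)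
    (hg : IsGSF (box k) g) (hk : Rep k ke) (hk0 : ∀ ε, 0 ≤ ke ε) (ht : Rep t te)
    (ht0 : ∀ ε, 0 ≤ te ε) (w : Gen ρ ℝ) :
    HFT k (fun y => u (pair y t)) w =
      HFT k g w * toC (t * gS (c * w * t)) + HFT k f w * toC (gcos (c * w * t)) +
      (toC (t * gS (c * w * t)) *
        gint (nonneg ρ) (fun s => waveBdry k c u w s * toC (gcos (c * w * s))) 0 t -
      toC (gcos (c * w * t)) *
        gint (nonneg ρ) (fun s => toC s * waveBdry k c u w s * toC (gS (c * w * s))) 0 t) := by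
  obtain ⟨V, hV⟩ := exists_representsOn hu.isGSF hk hk0 ht ht0
  have hc := rep_spec c
  have hw := rep_spec w
  have hk0' : ∀ᶠ ε in atBot, 0 ≤ ke ε := Eventually.of_forall hk0
  have htm := mem_nonneg_of_eventually ht (Eventually.of_forall ht0)
  have h0m : (0 : Gen ρ ℝ) ∈ nonneg ρ :=
    mem_nonneg_of_eventually rep_zero (Eventually.of_forall fun _ => le_rfl)
  have hX := netsIn_uIcc_nonneg h0m htm rep_zero ht
  have mt : ∀ᶠ ε in atBot, te ε ∈ Icc 0 (te ε) := Eventually.of_forall fun ε => ⟨ht0 ε, le_rfl⟩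
  have m0 : ∀ᶠ ε in atBot, (0 : ℝ) ∈ Icc 0 (te ε) := Eventually.of_forall fun ε => ⟨le_rfl, ht0 ε⟩
  have hcont : ∀ ε m v s, Continuous fun y => dirDeriv (V ε) m v (y, s) := fun ε m v s =>
    (continuous_dirDeriv (hV.smooth ε) m v).comp (by fun_prop)
  have r1 := HFT_rep (isGSF_space hu.isGSF htm) hk hk0'
    (F := fun ε y => V ε (y, te ε)) (fun x hx xe hxe hm => hV.value x hx xe hxe hm t htm te ht mt)
    (Eventually.of_forall fun ε => (hcont ε 0 (0, 1) _).continuousOn) hw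
  have r2 := HFT_rep hf hk hk0' (F := fun ε y => V ε (y, 0))
    (fun x hx xe hxe hm => hu.init x hx ▸ hV.value x hx xe hxe hm 0 h0m _ rep_zero m0)
    (Eventually.of_forall fun ε => (hcont ε 0 (0, 1) _).continuousOn) hw
  have r3 := HFT_rep hg hk hk0' (F := fun ε y => dirDeriv (V ε) 1 (0, 1) (y, 0))
    (fun x hx xe hxe hm => hu.init_deriv x hx ▸
      hV.gderiv x hx xe hxe hm 0 h0m _ rep_zero m0 1 (0, 1))
    (Eventually.of_forall fun ε => (hcont ε 1 (0, 1) _).continuousOn) hw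
  have hm' : ∀ {se : Idx → ℝ}, (∀ᶠ ε in atBot, se ε ∈ uIcc 0 (te ε)) →
      ∀ᶠ ε in atBot, se ε ∈ Icc 0 (te ε) := fun h => h.mono fun ε h => by
    rwa [uIcc_of_le (ht0 ε)] at h
  have hbc := fun ε => continuous_boundaryTerm (hV.smooth ε) (ke ε) (rep c ε) (rep w ε)
  have r4 := gint_rep ((paramGSF_waveBdry_gcos hu.isGSF hk hk0 ht ht0 c univ).integrand w)
    rep_zero ht hX (F := fun ε s => boundaryTerm (V ε) (ke ε) (rep c ε) (rep w ε) s *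
      (Real.cos (rep c ε * rep w ε * s) : ℂ))
    (fun s hs se hse hm => (hV.waveBdry hk hk0 hc hw hs hse (hm' hm)).mul
      ((hc.mul hw).mul hse).gcos.toC)
    (Eventually.of_forall fun ε => ((hbc ε).mul (by fun_prop)).intervalIntegrable _ _)
  have r5 := gint_rep ((paramGSF_waveBdry_gS hu.isGSF hk hk0 ht ht0 c univ).integrand w)
    rep_zero ht hX (F := fun ε s => boundaryTerm (V ε) (ke ε) (rep c ε) (rep w ε) s *
      (sineOver (rep c ε * rep w ε) s : ℂ))
    (fun s hs se hse hm => ((hse.toC.mul (hV.waveBdry hk hk0 hc hw hs hse (hm' hm))).mul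
      ((hc.mul hw).mul hse).gS.toC).congr (Eventually.of_forall fun ε => by
        rw [sineOver]; push_cast; ring))
    (Eventually.of_forall fun ε => ((hbc ε).mul (Complex.continuous_ofReal.comp
      (continuous_sineOver _))).intervalIntegrable _ _)
  have rS := (ht.mul ((hc.mul hw).mul ht).gS).toC
  have rC := ((hc.mul hw).mul ht).gcos.toC
  refine r1.eq_of_negligible (((r3.mul rS).add (r2.mul rC)).add ((rS.mul r4).sub (rC.mul r5)))
    fun n => ?_
  -- The residual is multiplied by `2kt²` in `norm_transform_sub_le`; this exponent says how small
  -- it must be taken.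
  obtain ⟨N, hN⟩ := (((moderate_const ρ ℝ 2).mul hk.1).mul ht.1).mul ht.1
  filter_upwards [hN, hu.eventually_wave_le hV hk hk0 ht ht0 hc (N + n)] with ε h1 h2
  have h3 := norm_transform_sub_le (hV.smooth ε) (w := rep w ε) (hk0 ε) (ht0 ε)
    fun y hy s hs => h2 (y, s) ⟨hy, hs⟩
  rw [norm_sub_rev] at h3
  refine h3.trans ?_
  have hp := pow_pos (ρ.pos ε) N
  have h4 := (le_abs_self _).trans h1
  simp only [Pi.mul_apply] at h4
  calc _ = ρ.net ε ^ (N + n) * (2 * ke ε * te ε * te ε) := by ring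
    _ ≤ ρ.net ε ^ (N + n) * (ρ.net ε ^ N)⁻¹ := by
        gcongr; exact (pow_pos (ρ.pos ε) _).le
    _ = _ := by rw [pow_add]; field_simp

theorem IsWaveSolution.waveFree_add_waveExtra (hu : IsWaveSolution k c f g u)
    (hf : IsGSF (box k) f) (hg : IsGSF (box k) g) (hk : Rep k ke) (hk0 : ∀ ε, 0 ≤ ke ε)
    (ht : Rep t te) (ht0 : ∀ ε, 0 ≤ te ε) {h : Gen ρ ℝ} {he : Idx → ℝ} (hh : Rep h he)
    (hh0 : ∀ᶠ ε in atBot, 0 ≤ he ε) (x : Gen ρ ℝ) :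
    waveFree k c f g x t h + waveExtra k c u x t h =
      invHFT h (HFT k fun y => u (pair y t)) x := by
  have hk0' : ∀ᶠ ε in atBot, 0 ≤ ke ε := Eventually.of_forall hk0
  have hS := isGSF_toC_mul_gS c t (box h)
  have hC := isGSF_toC_gcos c t (box h)
  have p1 := hS.mul (paramGSF_waveBdry_gcos hu.isGSF hk hk0 ht ht0 c (box h)).integral
  have p2 := hC.mul (paramGSF_waveBdry_gS hu.isGSF hk hk0 ht ht0 c (box h)).integral
  have p0 := ((isGSF_HFT hg hk hk0' (box h)).mul hS).add ((isGSF_HFT hf hk hk0' (box h)).mul hC)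
  rw [waveFree, waveExtra, ← invHFT_sub p1 p2 hh hh0, ← invHFT_add p0 (p1.sub p2) hh hh0]
  exact invHFT_congr (p0.add (p1.sub p2)) hh hh0
    (fun w _ => (hu.HFT_eq hf hg hk hk0 ht ht0 w).symm) x

/-- The Fourier representation of the solution. -/
theorem IsWaveSolution.limAtTop (hu : IsWaveSolution k c f g u)
    (hf : IsGSF (box k) f) (hg : IsGSF (box k) g) (hk : Rep k ke) (hk0 : ∀ ε, 0 ≤ ke ε)
    {x : Gen ρ ℝ} (hx : x ∈ boxInterior k) (ht : t ∈ nonneg ρ) :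
    LimAtTop (fun h => waveFree k c f g x t h + waveExtra k c u x t h) (u (pair x t)) := by
  obtain ⟨te, hte, ht0⟩ := exists_rep_nonneg ht
  have hv := isGSF_space hu.isGSF ht
  obtain ⟨e, hunit⟩ := zeroExt_of_mem_interior hv hk hk0 hx
  obtain ⟨h₁, hh₁⟩ := exists_forall_ge_eventually_inv_pow_le ρ 0
  have hl := limAtTop_invHFT_HFT hv hk hk0 (Or.inl hunit)
  rw [e] at hl
  exact hl.congr fun h hh => hu.waveFree_add_waveExtra hf hg hk hk0 hte ht0 (rep_spec h)
    ((hh₁ h hh _ (rep_spec h)).mono fun ε h => by rw [pow_zero, inv_one] at h; linarith) x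

/-- The cosine factor reduces the term with `f` to inversion at `x ± ct`. Either alternative
suffices there: invertibility serves the general formula, vanishing at `±k` the case of zero
boundary values. The term with `g` needs neither. -/
theorem limAtTop_waveFree (hf : IsGSF (box k) f) (hg : IsGSF (box k) g) (hk : Rep k ke)
    (hk0 : ∀ ε, 0 ≤ ke ε) (c : (Gen ρ ℝ)ˣ) {x : Gen ρ ℝ}
    (h1 : IsUnit (gnorm (x - (c : Gen ρ ℝ) * t) - k) ∨ (f k = 0 ∧ f (-k) = 0))
    (h2 : IsUnit (gnorm (x + (c : Gen ρ ℝ) * t) - k) ∨ (f k = 0 ∧ f (-k) = 0)) :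
    LimAtTop (waveFree k (c : Gen ρ ℝ) f g x t) (dAlembert k c f g x t) := by
  have hk0' : ∀ᶠ ε in atBot, 0 ≤ ke ε := Eventually.of_forall hk0
  obtain ⟨h₁, hh₁⟩ := exists_forall_ge_eventually_inv_pow_le ρ 0
  refine ((((limAtTop_invHFT_HFT hf hk hk0 h1).add (limAtTop_invHFT_HFT hf hk hk0 h2)).const_mul
    (const ρ (1 / 2 : ℂ))).add (limAtTop_invHFT_mul_gS hg hk hk0 c x t)).congr
    (h₁ := h₁) fun h hh => ?_
  have hh0 : ∀ᶠ ε in atBot, 0 ≤ rep h ε :=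
    (hh₁ h hh _ (rep_spec h)).mono fun ε h => by rw [pow_zero, inv_one] at h; linarith
  have hP := isGSF_HFT hf hk hk0' (box h)
  rw [waveFree, invHFT_add ((isGSF_HFT hg hk hk0' (box h)).mul (isGSF_toC_mul_gS _ t _))
    (hP.mul (isGSF_toC_gcos _ t _)) (rep_spec h) hh0,
    invHFT_mul_gcos hP (rep_spec h) hh0, add_comm]

/-- If the boundary term vanishes up to the time `t`, there is no boundary contribution. -/
theorem waveExtra_eq_zero (hu : IsGSF (strip k) u) (hk : Rep k ke) (hk0 : ∀ ε, 0 ≤ ke ε)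
    (ht : Rep t te) (ht0 : ∀ ε, 0 ≤ te ε)
    (hb : ∀ s ∈ nonneg ρ, s ≤ t → ∀ w, waveBdry k c u w s = 0) {h : Gen ρ ℝ} {he : Idx → ℝ}
    (hh : Rep h he) (hh0 : ∀ᶠ ε in atBot, 0 ≤ he ε) (x : Gen ρ ℝ) : waveExtra k c u x t h = 0 := by
  have hX : NetsIn (nonneg ρ) fun ε => uIcc 0 (te ε) := netsIn_uIcc_nonneg
    (mem_nonneg_of_eventually rep_zero (Eventually.of_forall fun _ => le_rfl))
    (mem_nonneg_of_eventually ht (Eventually.of_forall ht0)) rep_zero ht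
  have key : ∀ Ψ : Gen ρ ℝ → Gen ρ ℂ, IsGSF (nonneg ρ) Ψ → (∀ s ∈ nonneg ρ, s ≤ t → Ψ s = 0) →
      gint (nonneg ρ) Ψ 0 t = 0 := fun Ψ hΨ h0 => by
    -- The integrand vanishes only on `[0,t]`, which is enough because `gint_rep` tests values only
    -- along nets between the endpoints.
    have hr := gint_rep hΨ rep_zero ht hX (F := fun _ _ => 0) (fun s hs se hse hm => by
      rw [h0 s hs (le_of_eventually hse ht (hm.mono fun ε h => by
        rw [uIcc_of_le (ht0 ε)] at h; exact h.2))]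
      exact rep_zero) (Eventually.of_forall fun ε => intervalIntegrable_const)
    exact hr.eq (rep_zero.congr (Eventually.of_forall fun ε => by simp))
  rw [waveExtra, invHFT_eq_zero hh hh0, invHFT_eq_zero hh hh0, sub_zero]
  · intro w _
    rw [key _ ((paramGSF_waveBdry_gS hu hk hk0 ht ht0 c univ).integrand w), mul_zero]
    exact fun s hs hst => by rw [hb s hs hst, mul_zero, zero_mul]
  · intro w _
    rw [key _ ((paramGSF_waveBdry_gcos hu hk hk0 ht ht0 c univ).integrand w), mul_zero]
    exact fun s hs hst => by rw [hb s hs hst, zero_mul]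

theorem IsWaveSolution.eq_dAlembert_of_boundary_eq_zero {c : (Gen ρ ℝ)ˣ}
    (hu : IsWaveSolution k (c : Gen ρ ℝ) f g u) (hf : IsGSF (box k) f) (hg : IsGSF (box k) g)
    (hk : Rep k ke) (hk0 : ∀ ε, 0 ≤ ke ε) (ht : t ∈ nonneg ρ)
    (hb : ∀ s ∈ nonneg ρ, s ≤ t → u (pair k s) = 0 ∧ u (pair (-k) s) = 0 ∧
      dX k 1 u k s = 0 ∧ dX k 1 u (-k) s = 0) {x : Gen ρ ℝ} (hx : x ∈ boxInterior k) :
    u (pair x t) = dAlembert k c f g x t := by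
  obtain ⟨te, hte, ht0⟩ := exists_rep_nonneg ht
  -- At time zero the boundary condition and the initial condition give `f(±k) = 0`, so inversion of
  -- `f` is available at every point.
  obtain ⟨b1, b2, -, -⟩ := hb 0 (Gen.le_refl 0) ht
  rw [hu.init k (self_mem_box hk hk0)] at b1
  rw [hu.init (-k) (neg_self_mem_box hk hk0)] at b2
  obtain ⟨h₁, hh₁⟩ := exists_forall_ge_eventually_inv_pow_le ρ 0
  have hl := hu.limAtTop hf hg hk hk0 hx ht
  refine LimAtTop.unique (hl.congr (h₁ := h₁) fun h hh => ?_)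
    (limAtTop_waveFree hf hg hk hk0 c (Or.inr ⟨b1, b2⟩) (Or.inr ⟨b1, b2⟩))
  rw [waveExtra_eq_zero hu.isGSF hk hk0 hte ht0 (fun s hs hst w => ?_) (rep_spec h)
    ((hh₁ h hh _ (rep_spec h)).mono fun ε h => by rw [pow_zero, inv_one] at h; linarith), add_zero]
  obtain ⟨e1, e2, e3, e4⟩ := hb s hs hst
  rw [waveBdry, bdry, bdry, e1, e2, e3, e4]
  ring

theorem IsWaveSolution.exists_limAtTop_waveExtra {c : (Gen ρ ℝ)ˣ}
    (hu : IsWaveSolution k (c : Gen ρ ℝ) f g u) (hf : IsGSF (box k) f) (hg : IsGSF (box k) g)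
    (hk : Rep k ke) (hk0 : ∀ ε, 0 ≤ ke ε) (ht : t ∈ nonneg ρ) {x : Gen ρ ℝ}
    (hx : x ∈ boxInterior k) (h1 : IsUnit (gnorm (x - (c : Gen ρ ℝ) * t) - k))
    (h2 : IsUnit (gnorm (x + (c : Gen ρ ℝ) * t) - k)) :
    ∃ l, LimAtTop (waveExtra k (c : Gen ρ ℝ) u x t) l ∧
      u (pair x t) = dAlembert k c f g x t + l := by
  refine ⟨u (pair x t) - dAlembert k c f g x t, ?_, by ring⟩
  exact ((hu.limAtTop hf hg hk hk0 hx ht).sub (limAtTop_waveFree hf hg hk hk0 c (Or.inl h1)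
    (Or.inl h2))).congr (h₁ := 0) fun h _ => by ring

end Strip

/-! ### Dirac delta, Heaviside function and the wave kernel -/

section WaveKernel

variable {ρ : Gauge} {k : Gen ρ ℝ} {ke : Idx → ℝ} (M : Mollifier ρ)

/-- The scaled mollifier `y ↦ b_ε ψ_ε(b_ε y)`. -/
noncomputable def Mollifier.net (ε : Idx) (y : ℝ) : ℝ := M.b ε * M.ψ ε (M.b ε * y)

theorem Mollifier.continuous_net (ε : Idx) : Continuous (M.net ε) :=
  continuous_const.mul ((M.smooth ε).continuous.comp (by fun_prop))

theorem Mollifier.ψ_eq_zero (ε : Idx) {z : ℝ} (hz : 1 ≤ |z|) : M.ψ ε z = 0 :=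
  image_eq_zero_of_notMem_tsupport fun h => by
    have := M.support ε h
    rw [mem_ball_zero_iff, Real.norm_eq_abs] at this
    linarith

theorem Mollifier.integrable_ψ (ε : Idx) : Integrable (M.ψ ε) :=
  (M.smooth ε).continuous.integrable_of_hasCompactSupport
    (Metric.isCompact_of_isClosed_isBounded (isClosed_tsupport _)
      (Metric.isBounded_ball.subset (M.support ε)))

theorem Mollifier.integrable_net (ε : Idx) : Integrable (M.net ε) :=
  ((M.integrable_ψ ε).comp_mul_left' (M.b_pos ε).ne').const_mul _

theorem Mollifier.integral_norm_net (ε : Idx) : ∫ y, ‖M.net ε y‖ = ∫ y, |M.ψ ε y| := by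
  have hb := M.b_pos ε
  have h := Measure.integral_comp_mul_left (fun y => |M.ψ ε y|) (M.b ε)
  simp only [Mollifier.net, norm_mul, Real.norm_eq_abs, abs_of_pos hb]
  rw [integral_const_mul, h, smul_eq_mul, abs_of_pos (inv_pos.2 hb), mul_inv_cancel_left₀ hb.ne']

theorem Mollifier.exists_bound (j : ℕ) :
    ∃ d : Idx → ℝ, Moderate ρ ℝ d ∧ ∀ᶠ ε in atBot, ∀ x, |iteratedDeriv j (M.ψ ε) x| ≤ d ε := by
  obtain ⟨p, C, h⟩ := M.deriv_bound j
  exact ⟨_, (moderate_const ρ ℝ C).mul (M.b_moderate.pow p), h⟩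

/-- The scaled mollifier is bounded by a moderate net. -/
theorem Mollifier.exists_norm_net_le :
    ∃ d : Idx → ℝ, Moderate ρ ℝ d ∧ ∀ᶠ ε in atBot, ∀ y, ‖M.net ε y‖ ≤ d ε := by
  obtain ⟨d, hd, h⟩ := M.exists_bound 0
  refine ⟨M.b * d, M.b_moderate.mul hd, h.mono fun ε h y => ?_⟩
  rw [Mollifier.net, norm_mul, Real.norm_of_nonneg (M.b_pos ε).le]
  have := h (M.b ε * y)
  rw [iteratedDeriv_zero] at this
  exact mul_le_mul_of_nonneg_left this (M.b_pos ε).le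

/-- The scaled mollifier is Lipschitz with a moderate constant, so negligible changes of the
argument are harmless. -/
theorem Mollifier.rep_delta {x : Gen ρ ℝ} {xe : Idx → ℝ} (hx : Rep x xe) :
    Rep (M.delta x) (fun ε => M.net ε (xe ε)) := by
  obtain ⟨d₀, hd₀, h0⟩ := M.exists_norm_net_le
  obtain ⟨d, hd, h1⟩ := M.exists_bound 1
  have hm : Moderate ρ ℝ fun ε => M.net ε (rep x ε) :=
    hd₀.of_le (h0.mono fun ε h => (h _).trans (Real.le_norm_self _))
  refine hm.rep.of_negligible_sub ((((M.b_moderate.mul hd).mul M.b_moderate).mul_negligible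
    (hx.negligible_sub (rep_spec x))).of_le ?_)
  filter_upwards [h1] with ε h1
  have hb := M.b_pos ε
  have h2 := convex_univ.norm_image_sub_le_of_norm_deriv_le (f := M.ψ ε) (C := d ε)
    (fun z _ => (M.smooth ε).differentiable (by simp) z)
    (fun z _ => by simpa only [iteratedDeriv_one, Real.norm_eq_abs] using h1 z)
    (mem_univ (M.b ε * rep x ε)) (mem_univ (M.b ε * xe ε))
  simp only [Pi.sub_apply, Pi.mul_apply, Mollifier.net]
  rw [← mul_sub, norm_mul, norm_mul, norm_mul, norm_mul, Real.norm_of_nonneg hb.le]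
  rw [← mul_sub, norm_mul, Real.norm_of_nonneg hb.le] at h2
  calc M.b ε * ‖M.ψ ε (M.b ε * xe ε) - M.ψ ε (M.b ε * rep x ε)‖
      ≤ M.b ε * (d ε * (M.b ε * ‖xe ε - rep x ε‖)) := by gcongr
    _ ≤ M.b ε * (‖d ε‖ * (M.b ε * ‖xe ε - rep x ε‖)) := by
        gcongr; exact Real.le_norm_self _
    _ = _ := by ring

/-- Moderateness comes from the bound on the integral of `|ψ_ε|`, and independence of the
representative from the moderate bound on the density. -/
theorem Mollifier.rep_heaviside {x : Gen ρ ℝ} {xe : Idx → ℝ} (hx : Rep x xe) :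
    Rep (M.heaviside x) (fun ε => ∫ y in Iic (xe ε), M.net ε y) := by
  obtain ⟨d, hd, h0⟩ := M.exists_norm_net_le
  have hm : Moderate ρ ℝ fun ε => ∫ y in Iic (rep x ε), M.net ε y := by
    refine (moderate_const ρ ℝ 2).of_le ?_
    filter_upwards [M.small_neg 1 one_pos] with ε h
    calc _ ≤ ∫ y in Iic (rep x ε), ‖M.net ε y‖ := norm_integral_le_integral_norm _
      _ ≤ ∫ y, ‖M.net ε y‖ := setIntegral_le_integral (M.integrable_net ε).norm
          (Eventually.of_forall fun y => norm_nonneg _)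
      _ ≤ 1 + 1 := (M.integral_norm_net ε).trans_le h
      _ = ‖(2 : ℝ)‖ := by norm_num
  refine hm.rep.of_negligible_sub ((hd.mul_negligible
    (hx.negligible_sub (rep_spec x))).of_le ?_)
  filter_upwards [h0] with ε h0
  simp only [Pi.sub_apply, Pi.mul_apply]
  rw [intervalIntegral.integral_Iic_sub_Iic (M.integrable_net ε).integrableOn
    (M.integrable_net ε).integrableOn, norm_mul]
  exact (intervalIntegral.norm_integral_le_of_norm_le_const fun y _ => h0 y).trans
    (mul_le_mul_of_nonneg_right (Real.le_norm_self _) (abs_nonneg _))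

theorem Mollifier.net_eq_zero {ε : Idx} (hb : 1 ≤ M.b ε) {y : ℝ} (hy : 1 ≤ |y|) :
    M.net ε y = 0 := by
  rw [Mollifier.net, M.ψ_eq_zero ε, mul_zero]
  rw [abs_mul, abs_of_pos (M.b_pos ε)]
  exact one_le_mul_of_one_le_of_one_le hb hy

/-- Clipping moves a point only across `|y| ≥ K ≥ 1`, where the scaled mollifier is zero because
`b_ε ≥ 1`. -/
theorem Mollifier.integral_net_clipReal {ε : Idx} (hb : 1 ≤ M.b ε) {K : ℝ} (hK : 1 ≤ K) (a : ℝ) :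
    ∫ y in clipReal K a..a, M.net ε y = 0 := by
  rcases le_or_gt |a| K with h | h
  · rw [clipReal_of_mem h, intervalIntegral.integral_same]
  · rw [intervalIntegral.integral_congr (g := fun _ => (0 : ℝ)), intervalIntegral.integral_zero]
    intro y hy
    refine M.net_eq_zero hb ?_
    rcases lt_abs.1 h with h | h
    · rw [clipReal_of_ge (by linarith) h.le, uIcc_of_le h.le] at hy
      exact le_abs.2 (Or.inl (by linarith [hy.1]))
    · rw [clipReal_of_le (by linarith), uIcc_of_ge (by linarith)] at hy
      exact le_abs.2 (Or.inr (by linarith [hy.2]))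

theorem Mollifier.integral_net_clipReal_eq {ε : Idx} (hb : 1 ≤ M.b ε) {K : ℝ} (hK : 1 ≤ K)
    (a b : ℝ) : ∫ y in clipReal K a..clipReal K b, M.net ε y =
      (∫ y in Iic b, M.net ε y) - ∫ y in Iic a, M.net ε y := by
  have hi := fun p q => (M.continuous_net ε).intervalIntegrable (μ := volume) p q
  rw [intervalIntegral.integral_Iic_sub_Iic (M.integrable_net ε).integrableOn
    (M.integrable_net ε).integrableOn]
  have h1 := M.integral_net_clipReal hb hK a
  have h2 := M.integral_net_clipReal hb hK b
  have h3 := intervalIntegral.integral_add_adjacent_intervals (hi (clipReal K a) a) (hi a b)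
  have h4 := intervalIntegral.integral_add_adjacent_intervals (hi (clipReal K a) (clipReal K b))
    (hi (clipReal K b) b)
  linarith

/-- The integral of the Dirac delta is the Heaviside function. -/
theorem gint_delta {g : Gen ρ ℝ → Gen ρ ℂ} (hg : IsGSF (box k) g) (hk : Rep k ke)
    (hk1 : ∀ ε, 1 ≤ ke ε) (hδ : ∀ x ∈ box k, g x = toC (M.delta x)) (y z : Gen ρ ℝ) :
    gint (box k) g (clip k y) (clip k z) = toC (M.heaviside z - M.heaviside y) := by
  have hk0 : ∀ ε, 0 ≤ ke ε := fun ε => zero_le_one.trans (hk1 ε)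
  have hy := rep_spec y
  have hz := rep_spec z
  have hr := gint_rep hg (hk.clip hy) (hk.clip hz)
    (netsIn_uIcc_box (clip_mem_box hk hk0 _) (clip_mem_box hk hk0 _) (hk.clip hy) (hk.clip hz))
    (F := fun ε x => (M.net ε x : ℂ)) (fun x hx xe hxe _ => hδ x hx ▸ (M.rep_delta hxe).toC)
    (Eventually.of_forall fun ε => (Complex.continuous_ofReal.comp
      (M.continuous_net ε)).intervalIntegrable _ _)
  refine hr.eq ((((M.rep_heaviside hz).sub (M.rep_heaviside hy)).toC).congr ?_)
  filter_upwards [M.b_tendsto.eventually_ge_atTop 1] with ε hb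
  rw [intervalIntegral.integral_ofReal, M.integral_net_clipReal_eq hb (hk1 ε)]

theorem zeroExt_eq_zero {f : Gen ρ ℝ → Gen ρ ℂ} (hk : Rep k ke) (hk0 : ∀ ε, 0 ≤ ke ε)
    (hf : ∀ x ∈ box k, f x = 0) (y : Gen ρ ℝ) : zeroExt k f y = 0 := by
  rw [zeroExt, hf _ (clip_mem_box hk hk0 y), mul_zero]

end WaveKernel

end GenSmooth

/-! ### The wave equation: representation, d'Alembert formula and wave kernel -/

theorem mainTheorem11 (ρ : GenSmooth.Gauge) (k : GenSmooth.Gen ρ ℝ) (hk : 0 < k)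
    (hk_inf : GenSmooth.IsInfinite k) (c : (GenSmooth.Gen ρ ℝ)ˣ)
    (f g : GenSmooth.Gen ρ ℝ → GenSmooth.Gen ρ ℂ)
    (hf : GenSmooth.IsGSF (GenSmooth.box k) f) (hg : GenSmooth.IsGSF (GenSmooth.box k) g)
    (u : GenSmooth.Gen ρ (ℝ × ℝ) → GenSmooth.Gen ρ ℂ)
    (hu : GenSmooth.IsWaveSolution k (c : GenSmooth.Gen ρ ℝ) f g u) :
    -- the solution is the limit of its Fourier representation, at all interior points and all times
    (∀ x ∈ GenSmooth.boxInterior k, ∀ t ∈ GenSmooth.nonneg ρ,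
      GenSmooth.LimAtTop
        (fun h => GenSmooth.waveFree k (c : GenSmooth.Gen ρ ℝ) f g x t h
          + GenSmooth.waveExtra k (c : GenSmooth.Gen ρ ℝ) u x t h)
        (u (GenSmooth.pair x t))) ∧
    -- generalized d'Alembert formula
    (∀ x ∈ GenSmooth.boxInterior k, ∀ t ∈ GenSmooth.nonneg ρ,
      IsUnit (GenSmooth.gnorm (x - (c : GenSmooth.Gen ρ ℝ) * t) - k) → IsUnit (GenSmooth.gnorm (x + (c : GenSmooth.Gen ρ ℝ) * t) - k) →
      ∃ l : GenSmooth.Gen ρ ℂ,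
        GenSmooth.LimAtTop (GenSmooth.waveExtra k (c : GenSmooth.Gen ρ ℝ) u x t) l ∧
        u (GenSmooth.pair x t) = GenSmooth.dAlembert k c f g x t + l) ∧
    -- vanishing boundary values
    (∀ t ∈ GenSmooth.nonneg ρ,
      (∀ s ∈ GenSmooth.nonneg ρ, s ≤ t →
        u (GenSmooth.pair k s) = 0 ∧ u (GenSmooth.pair (-k) s) = 0 ∧
        GenSmooth.dX k 1 u k s = 0 ∧ GenSmooth.dX k 1 u (-k) s = 0) →
      (∀ x ∈ GenSmooth.boxInterior k,
        u (GenSmooth.pair x t) = GenSmooth.dAlembert k c f g x t) ∧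
      -- wave kernel
      (∀ M : GenSmooth.Mollifier ρ,
        (∀ x ∈ GenSmooth.box k, f x = 0) →
        (∀ x ∈ GenSmooth.box k, g x = GenSmooth.toC (M.delta x)) →
        ∀ x ∈ GenSmooth.boxInterior k,
          u (GenSmooth.pair x t) = GenSmooth.const ρ (1 / 2 : ℂ) * GenSmooth.toC ↑c⁻¹ *
            GenSmooth.toC (M.heaviside (x + ↑c * t) - M.heaviside (x - ↑c * t)))) := by
  -- That `k` is infinite enters only through a representative bounded below by `1`, and beyond
  -- nonnegativity only the wave kernel uses it, to contain the support of `δ`.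
  obtain ⟨ke, hke, hk1⟩ := hk_inf.exists_rep_one_le hk
  have hk0 : ∀ ε, 0 ≤ ke ε := fun ε => zero_le_one.trans (hk1 ε)
  refine ⟨fun x hx t ht => hu.limAtTop hf hg hke hk0 hx ht,
    fun x hx t ht h1 h2 => hu.exists_limAtTop_waveExtra hf hg hke hk0 ht hx h1 h2,
    fun t ht hb => ⟨fun x hx => hu.eq_dAlembert_of_boundary_eq_zero hf hg hke hk0 ht hb hx,
      fun M hf0 hδ x hx => ?_⟩⟩
  rw [hu.eq_dAlembert_of_boundary_eq_zero hf hg hke hk0 ht hb hx, GenSmooth.dAlembert,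
    GenSmooth.zeroExt_eq_zero hke hk0 hf0, GenSmooth.zeroExt_eq_zero hke hk0 hf0,
    GenSmooth.gint_delta M hg hke hk1 hδ, add_zero, mul_zero, zero_add]
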